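/- **Definitions.** A *promise problem* is a pair $(L_{\rm yes},L_{\rm no})$ of disjoint sets of finite binary strings. It belongs to $\mathrm{PostBPP}$ iff there are a polynomial $p$ and predicates $a(x,y)$, $b(x,y)$ decidable by Turing machines in time polynomial in the length of the input $(x,y)$ such that, for $y$ uniformly random in $\{0,1\}^{p(|x|)}$: (i) $\Pr[b(x,y)=1]>0$ for all $x\in L_{\rm yes}\cup L_{\rm no}$; (ii) $\Pr[a(x,y)=1\mid b(x,y)=1]\ge 2/3$ for all $x\in L_{\rm yes}$; (iii) $\Pr[a(x,y)=1\mid b(x,y)=1]\le 1/3$ for all $x\in L_{\rm no}$. A *$k$-local Hamiltonian* on $n$ qubits is an operator $H=\sum_S H_S$ on $(\mathbb C^2)^{\otimes n}$, where $S$ runs over the $k$-element subsets of $\{1,\dots,n\}$ and $H_S$ is a Hermitian operator on the qubits in $S$ tensored with the identity on the other qubits. Let $\lambda(H)$ be its smallest eigenvalue and let $\Delta(H)$ be its spectral gap, the difference between its second smallest and its smallest eigenvalue, counted with multiplicity. $H$ is *stoquastic* if all its off-diagonal matrix elements in the standard basis are real and non-positive. For polynomials $p_1,p_2$ let $\Omega(k,p_1,p_2)$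 be the set of $k$-local Hamiltonians, on any number $n\ge k$ of qubits, with $\|H_S\|\le p_1(n)$ for all $S$ and with either $\lambda(H)\le 0$ or $\lambda(H)\ge 1/p_2(n)$. A Hamiltonian is described by the binary string that consists of $n$ in unary and the list of the sets $S$ with the matrices $H_S$ (at most one entry per $S$; unlisted terms are zero), whose entries are complex numbers with rational real and imaginary parts, written in binary. **Theorem.** Let $k$ be a fixed natural number and let $p_1,p_2,p_3$ be fixed real polynomials with $p_2(n)>0$ and $p_3(n)>0$ for all integers $n\ge k$. Consider the promise problem: given the description of a stoquastic $k$-local Hamiltonian $H\in\Omega(k,p_1,p_2)$ with spectral gap $\Delta(H)\ge 1/p_3(n)$, where $n$ is the number of qubits of $H$, decide whether $\lambda(H)\le 0$ (yes-instances: the descriptions of such $H$ with $\lambda(H)\le 0$; no-instances: the descriptions of all other such $H$). This promise problem belongs to $\mathrm{PostBPP}$. -/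

import Mathlib

namespace StoquasticLH

/-! ### Promise problems, the class P and the class PostBPP -/

/-- A promise problem: two non-overlapping sets of finite binary strings. -/
structure PromiseProblem where
  yes : Set (List Bool)
  no : Set (List Bool)
  disjoint : Disjoint yes no

/-- The pair `(x, y)` of binary strings, written as one word with a separator between them. -/
def encodePair (z : List Bool × List Bool) : List (Option Bool) :=
  z.1.map some ++ none :: z.2.map some

/-- The predicate `f (x, y)` on pairs of binary strings belongs to the class P: some
(multi-stack) Turing machine decides it in time polynomial in the length of the input word. -/
def InP (f : List Bool × List Bool → Bool) : Prop :=
  Nonempty (Turing.TM2ComputableInPolyTime encodePair Computability.encodeBool f)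

/-- The probability of the event `E` for a uniformly random bit string `y` of length `m`. -/
noncomputable def prob (m : ℕ) (E : List Bool → Bool) : ℝ :=
  ((Finset.univ.filter fun y : Fin m → Bool => E (List.ofFn y) = true).card : ℝ) / 2 ^ m

/-- The conditional probability `Pr [A | B]` for a uniformly random bit string of length `m`. -/
noncomputable def condProb (m : ℕ) (A B : List Bool → Bool) : ℝ :=
  prob m (fun y => A y && B y) / prob m B

/-- The class PostBPP of promise problems. -/
def PostBPP : Set PromiseProblem :=
  {L | ∃ (p : Polynomial ℕ) (a b : List Bool × List Bool → Bool), InP a ∧ InP b ∧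
    (∀ x ∈ L.yes ∪ L.no, 0 < prob (p.eval x.length) (fun y => b (x, y))) ∧
    (∀ x ∈ L.yes,
      2 / 3 ≤ condProb (p.eval x.length) (fun y => a (x, y)) (fun y => b (x, y))) ∧
    (∀ x ∈ L.no,
      condProb (p.eval x.length) (fun y => a (x, y)) (fun y => b (x, y)) ≤ 1 / 3)}

/-! ### Local Hamiltonians on qubits -/

/-- An interaction on `k` out of `n` qubits: the support `S`, given by its increasing enumeration
`site`, and a Hermitian `2 ^ k × 2 ^ k` matrix with entries in `ℚ + i ℚ`. The standard basis
vectors of the `k` qubits are indexed by bit strings; bit `j` belongs to the qubit `site j`. -/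
structure LocalTerm (k n : ℕ) where
  site : Fin k ↪o Fin n
  re : (Fin k → Bool) → (Fin k → Bool) → ℚ
  im : (Fin k → Bool) → (Fin k → Bool) → ℚ
  hermitian : (Matrix.of fun a b => (⟨re a b, im a b⟩ : ℂ)).IsHermitian

/-- The `2 ^ k × 2 ^ k` matrix of an interaction. -/
noncomputable def LocalTerm.mat {k n : ℕ} (t : LocalTerm k n) :
    Matrix (Fin k → Bool) (Fin k → Bool) ℂ :=
  Matrix.of fun a b => (⟨t.re a b, t.im a b⟩ : ℂ)

/-- The interaction tensored with the identity on all qubits outside its support. -/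
noncomputable def LocalTerm.op {k n : ℕ} (t : LocalTerm k n) :
    Matrix (Fin n → Bool) (Fin n → Bool) ℂ :=
  Matrix.of fun x y =>
    if ∀ i : Fin n, (∀ j, t.site j ≠ i) → x i = y i then t.mat (x ∘ t.site) (y ∘ t.site) else 0

/-- The operator norm of the interaction on `(ℂ ^ 2) ^ ⊗ k`. -/
noncomputable def LocalTerm.opNorm {k n : ℕ} (t : LocalTerm k n) : ℝ :=
  ‖Matrix.toEuclideanCLM (n := Fin k → Bool) (𝕜 := ℂ) t.mat‖

/-- A `k`-local Hamiltonian: the number `n` of qubits and the interactions `H_S`, at most one for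
every set `S` of `k` qubits; interactions that are not listed are zero. -/
structure LocalHamiltonian (k : ℕ) where
  n : ℕ
  terms : List (LocalTerm k n)
  nodup : (terms.map LocalTerm.site).Nodup

/-- The Hermitian operator `H = ∑ S, H_S` in the standard basis. -/
noncomputable def LocalHamiltonian.matrix {k : ℕ} (D : LocalHamiltonian k) :
    Matrix (Fin D.n → Bool) (Fin D.n → Bool) ℂ :=
  (D.terms.map LocalTerm.op).sum

theorem LocalTerm.op_isHermitian {k n : ℕ} (t : LocalTerm k n) : t.op.IsHermitian := by
  ext x y
  have h := t.hermitian.apply (x ∘ t.site) (y ∘ t.site)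
  simp only [Matrix.conjTranspose_apply, LocalTerm.op, LocalTerm.mat, Matrix.of_apply] at h ⊢
  by_cases hxy : ∀ i : Fin n, (∀ j, t.site j ≠ i) → x i = y i
  · rw [if_pos hxy, if_pos fun i hi => (hxy i hi).symm]
    exact h
  · rw [if_neg hxy, if_neg fun hc => hxy fun i hi => (hc i hi).symm]
    simp

theorem LocalHamiltonian.isHermitian {k : ℕ} (D : LocalHamiltonian k) :
    D.matrix.IsHermitian := by
  unfold LocalHamiltonian.matrix
  induction D.terms with
  | nil => simp
  | cons t l ih =>
    rw [List.map_cons, List.sum_cons]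
    exact t.op_isHermitian.add ih

/-- The eigenvalues of `H`, listed with multiplicity. -/
noncomputable def LocalHamiltonian.eigenvalue {k : ℕ} (D : LocalHamiltonian k) :
    (Fin D.n → Bool) → ℝ :=
  D.isHermitian.eigenvalues

/-- The ground-state energy `λ(H)`, the smallest eigenvalue of `H`. -/
noncomputable def LocalHamiltonian.groundEnergy {k : ℕ} (D : LocalHamiltonian k) : ℝ :=
  Finset.univ.inf' Finset.univ_nonempty D.eigenvalue

/-- All off-diagonal matrix elements of `H` in the standard basis are real and non-positive. -/
def LocalHamiltonian.IsStoquastic {k : ℕ} (D : LocalHamiltonian k) : Prop :=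
  ∀ x y, x ≠ y → (D.matrix x y).im = 0 ∧ (D.matrix x y).re ≤ 0

/-- The spectral gap of `H`, the difference between the second smallest and the smallest
eigenvalue (counted with multiplicity, so that a degenerate ground state means gap zero),
is at least `g`. -/
def LocalHamiltonian.HasSpectralGap {k : ℕ} (D : LocalHamiltonian k) (g : ℝ) : Prop :=
  ∃ i₀ i₁, i₁ ≠ i₀ ∧ (∀ i, D.eigenvalue i₀ ≤ D.eigenvalue i) ∧
    (∀ i, i ≠ i₀ → D.eigenvalue i₁ ≤ D.eigenvalue i) ∧ g ≤ D.eigenvalue i₁ - D.eigenvalue i₀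

/-- The set `Ω(k, p₁, p₂)` of instances of the Local Hamiltonian Problem. -/
def Omega (k : ℕ) (p₁ p₂ : Polynomial ℝ) : Set (LocalHamiltonian k) :=
  {D | k ≤ D.n ∧ (∀ t ∈ D.terms, t.opNorm ≤ p₁.eval (D.n : ℝ)) ∧
    (D.groundEnergy ≤ 0 ∨ 1 / p₂.eval (D.n : ℝ) ≤ D.groundEnergy)}

/-! ### Description of local Hamiltonians by binary strings -/

/-- A list, every item preceded by the bit `1`, the end marked by the bit `0`. -/
def encList {α : Type*} (enc : α → List Bool) (l : List α) : List Bool :=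
  (l.flatMap fun a => true :: enc a) ++ [false]

/-- A natural number in binary, least significant bit first. -/
def encNat (m : ℕ) : List Bool :=
  encList (fun b => [b]) m.bits

/-- A rational number: the sign, the absolute value of the numerator and the denominator. -/
def encRat (r : ℚ) : List Bool :=
  decide (r < 0) :: (encNat r.num.natAbs ++ encNat r.den)

/-- The bit string of length `k` with bits `j` of `r`. -/
def bitsOf (k : ℕ) (r : Fin (2 ^ k)) : Fin k → Bool :=
  fun j => r.val.testBit j

/-- The indicator string of the support, then the real and imaginary parts of all matrix entries,
row by row. -/
def encTerm {k n : ℕ} (t : LocalTerm k n) : List Bool :=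
  ((List.finRange n).flatMap fun i => [decide (∃ j, t.site j = i)]) ++
    (List.finRange (2 ^ k)).flatMap fun r => (List.finRange (2 ^ k)).flatMap fun c =>
      encRat (t.re (bitsOf k r) (bitsOf k c)) ++ encRat (t.im (bitsOf k r) (bitsOf k c))

/-- The number of qubits in unary, then the list of the interactions. -/
def encode {k : ℕ} (D : LocalHamiltonian k) : List Bool :=
  (List.replicate D.n true ++ [false]) ++ encList encTerm D.terms

theorem encList_prefix {α : Type*} {enc : α → List Bool}
    (h : ∀ a b u v, enc a ++ u = enc b ++ v → a = b ∧ u = v) :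
    ∀ l l' u v, encList enc l ++ u = encList enc l' ++ v → l = l' ∧ u = v := by
  intro l
  induction l with
  | nil =>
    intro l' u v e
    cases l' with
    | nil => simpa [encList] using e
    | cons b l' => simp [encList] at e
  | cons a l ih =>
    intro l' u v e
    cases l' with
    | nil => simp [encList] at e
    | cons b l' =>
      have e' : enc a ++ (encList enc l ++ u) = enc b ++ (encList enc l' ++ v) := by
        simpa [encList] using e
      obtain ⟨rfl, e2⟩ := h _ _ _ _ e'
      obtain ⟨rfl, rfl⟩ := ih _ _ _ e2
      exact ⟨rfl, rfl⟩

theorem encNat_prefix (a b : ℕ) (u v : List Bool) (h : encNat a ++ u = encNat b ++ v) :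
    a = b ∧ u = v := by
  obtain ⟨h1, h2⟩ := encList_prefix (enc := fun b : Bool => [b])
    (fun a b u v e => by simpa using e) _ _ _ _ h
  refine ⟨?_, h2⟩
  apply Nat.eq_of_testBit_eq
  intro i
  rw [Nat.testBit_eq_inth, Nat.testBit_eq_inth, h1]

theorem encRat_prefix (a b : ℚ) (u v : List Bool) (h : encRat a ++ u = encRat b ++ v) :
    a = b ∧ u = v := by
  simp only [encRat, List.cons_append, List.append_assoc, List.cons.injEq] at h
  obtain ⟨h0, h⟩ := h
  obtain ⟨h1, h⟩ := encNat_prefix _ _ _ _ h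
  obtain ⟨h2, h⟩ := encNat_prefix _ _ _ _ h
  refine ⟨Rat.ext ?_ h2, h⟩
  have h0' : a.num < 0 ↔ b.num < 0 := by simpa using h0
  omega

theorem flatMap_prefix {ι α : Type*} {enc : α → List Bool}
    (h : ∀ a b u v, enc a ++ u = enc b ++ v → a = b ∧ u = v) (f g : ι → α) :
    ∀ (l : List ι) (u v : List Bool),
      (l.flatMap fun i => enc (f i)) ++ u = (l.flatMap fun i => enc (g i)) ++ v →
        (∀ i ∈ l, f i = g i) ∧ u = v := by
  intro l
  induction l with
  | nil => intro u v e; simpa using e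
  | cons i l ih =>
    intro u v e
    simp only [List.flatMap_cons, List.append_assoc] at e
    obtain ⟨h1, e⟩ := h _ _ _ _ e
    obtain ⟨h2, e⟩ := ih _ _ e
    exact ⟨by simpa [h1] using h2, e⟩

theorem bitsOf_surjective (k : ℕ) : Function.Surjective (bitsOf k) := by
  intro f
  refine ⟨⟨Nat.ofBits f, Nat.ofBits_lt_two_pow f⟩, ?_⟩
  funext j
  exact Nat.testBit_ofBits_lt f j j.isLt

theorem encTerm_prefix {k n : ℕ} (s t : LocalTerm k n) (u v : List Bool)
    (h : encTerm s ++ u = encTerm t ++ v) : s = t ∧ u = v := by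
  unfold encTerm at h
  rw [List.append_assoc, List.append_assoc] at h
  obtain ⟨hsite, h⟩ := flatMap_prefix (enc := fun b : Bool => [b])
    (fun a b u v e => by simpa using e) _ _ _ _ _ h
  have hpair : ∀ (a b : ℚ × ℚ) (u v : List Bool),
      (encRat a.1 ++ encRat a.2) ++ u = (encRat b.1 ++ encRat b.2) ++ v → a = b ∧ u = v := by
    intro a b u v e
    rw [List.append_assoc, List.append_assoc] at e
    obtain ⟨h1, e⟩ := encRat_prefix _ _ _ _ e
    obtain ⟨h2, e⟩ := encRat_prefix _ _ _ _ e
    exact ⟨Prod.ext h1 h2, e⟩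
  have hrow : ∀ (a b : Fin (2 ^ k) → ℚ × ℚ) (u v : List Bool),
      ((List.finRange (2 ^ k)).flatMap fun c => encRat (a c).1 ++ encRat (a c).2) ++ u =
        ((List.finRange (2 ^ k)).flatMap fun c => encRat (b c).1 ++ encRat (b c).2) ++ v →
        a = b ∧ u = v := by
    intro a b u v e
    obtain ⟨h1, e⟩ := flatMap_prefix (enc := fun z : ℚ × ℚ => encRat z.1 ++ encRat z.2)
      hpair a b _ _ _ e
    exact ⟨funext fun c => h1 c (List.mem_finRange c), e⟩
  obtain ⟨hmat, huv⟩ := flatMap_prefix hrow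
    (fun r c => (s.re (bitsOf k r) (bitsOf k c), s.im (bitsOf k r) (bitsOf k c)))
    (fun r c => (t.re (bitsOf k r) (bitsOf k c), t.im (bitsOf k r) (bitsOf k c))) _ _ _ h
  refine ⟨?_, huv⟩
  have hent : ∀ a b, s.re a b = t.re a b ∧ s.im a b = t.im a b := by
    intro a b
    obtain ⟨r, rfl⟩ := bitsOf_surjective k a
    obtain ⟨c, rfl⟩ := bitsOf_surjective k b
    have := congrFun (hmat r (List.mem_finRange r)) c
    exact ⟨congrArg Prod.fst this, congrArg Prod.snd this⟩
  have hs : s.site = t.site := by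
    apply (OrderEmbedding.range_inj).1
    ext i
    have := hsite i (List.mem_finRange i)
    simpa using this
  obtain ⟨s1, s2, s3, s4⟩ := s
  obtain ⟨t1, t2, t3, t4⟩ := t
  have h2 : s2 = t2 := funext fun a => funext fun b => (hent a b).1
  have h3 : s3 = t3 := funext fun a => funext fun b => (hent a b).2
  simp only at hs
  subst hs h2 h3
  rfl

theorem encode_injective (k : ℕ) : Function.Injective (encode (k := k)) := by
  intro D D' h
  obtain ⟨n, l, hl⟩ := D
  obtain ⟨n', l', hl'⟩ := D'
  have hn : ∀ (m m' : ℕ) (u v : List Bool),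
      List.replicate m true ++ false :: u = List.replicate m' true ++ false :: v →
        m = m' ∧ u = v := by
    intro m
    induction m with
    | zero =>
      intro m' u v e
      cases m' with
      | zero => simpa using e
      | succ m' => simp [List.replicate_succ] at e
    | succ m ih =>
      intro m' u v e
      cases m' with
      | zero => simp [List.replicate_succ] at e
      | succ m' =>
        simp only [List.replicate_succ, List.cons_append, List.cons.injEq, true_and] at e
        obtain ⟨h1, h2⟩ := ih _ _ _ e
        exact ⟨congrArg Nat.succ h1, h2⟩
  simp only [encode, List.append_assoc, List.singleton_append] at h
  obtain ⟨rfl, h⟩ := hn _ _ _ _ h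
  obtain ⟨rfl, -⟩ := encList_prefix encTerm_prefix l l' [] [] (by simpa using h)
  rfl

/-! ### The computational problem -/

/-- `k`-local stoquastic LH-MIN with the promise that the spectral gap is at least `1 / p₃(n)`:
given the description of a stoquastic Hamiltonian `H ∈ Ω(k, p₁, p₂)` with this promise, decide
whether `λ(H) ≤ 0`. -/
def stoquasticLHMin (k : ℕ) (p₁ p₂ p₃ : Polynomial ℝ) : PromiseProblem where
  yes := {x | ∃ D ∈ Omega k p₁ p₂, D.IsStoquastic ∧
    D.HasSpectralGap (1 / p₃.eval (D.n : ℝ)) ∧ encode D = x ∧ D.groundEnergy ≤ 0}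
  no := {x | ∃ D ∈ Omega k p₁ p₂, D.IsStoquastic ∧
    D.HasSpectralGap (1 / p₃.eval (D.n : ℝ)) ∧ encode D = x ∧ ¬ D.groundEnergy ≤ 0}
  disjoint := by
    rw [Set.disjoint_left]
    rintro x ⟨D, -, -, -, hD, h⟩ ⟨D', -, -, -, hD', h'⟩
    obtain rfl := encode_injective k (hD.trans hD'.symm)
    exact h' h

end StoquasticLH

namespace StoquasticLH

/-! ### Structured stack programs and their compilation to multi-stack machines -/

/-- Structured programs that act on a family of stacks. -/
inductive Prog {K : Type} (Γ : K → Type) : Type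
  | push (k : K) (s : Γ k) : Prog Γ
  | pop (k : K) : Prog Γ
  | seq (p q : Prog Γ) : Prog Γ
  | ite (k : K) (c : Option (Γ k) → Bool) (p q : Prog Γ) : Prog Γ
  | loop (k : K) (c : Option (Γ k) → Bool) (p : Prog Γ) : Prog Γ

namespace Prog

variable {K : Type} [DecidableEq K] {Γ : K → Type}

/-- `Exec p S t S'`: the program `p` started on the stacks `S` halts after `t` steps with the
stacks `S'`. -/
inductive Exec : Prog Γ → (∀ k, List (Γ k)) → ℕ → (∀ k, List (Γ k)) → Prop
  | push (k s S) : Exec (.push k s) S 1 (Function.update S k (s :: S k))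
  | pop (k S) : Exec (.pop k) S 1 (Function.update S k (S k).tail)
  | seq {p q S t S' t' S''} : Exec p S t S' → Exec q S' t' S'' → Exec (.seq p q) S (t + t') S''
  | ite_pos {k c p q S t S'} : c (S k).head? = true → Exec p S t S' →
      Exec (.ite k c p q) S (t + 1) S'
  | ite_neg {k c p q S t S'} : c (S k).head? = false → Exec q S t S' →
      Exec (.ite k c p q) S (t + 1) S'
  | loop_pos {k c p S t S' t' S''} : c (S k).head? = true → Exec p S t S' →
      Exec (.loop k c p) S' t' S'' → Exec (.loop k c p) S (t + t' + 1) S''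
  | loop_neg {k c p S} : c (S k).head? = false → Exec (.loop k c p) S 1 S

/-- A push enlarges one stack by one symbol, so the growth is bounded by the running time. -/
theorem Exec.length_le {p : Prog Γ} {S t S'} (h : Exec p S t S') (k : K) :
    (S' k).length ≤ (S k).length + t := by
  induction h with
  | push j s S =>
    rcases eq_or_ne k j with rfl | hk
    · simp
    · simp [Function.update_of_ne hk]
  | pop j S =>
    rcases eq_or_ne k j with rfl | hk
    · simp; omega
    · simp [Function.update_of_ne hk]
  | _ => omega

/-- The labels of the compiled program. -/
def Lab : Prog Γ → Type
  | .push _ _ => Unit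
  | .pop _ => Unit
  | .seq p q => Lab p ⊕ Lab q
  | .ite _ _ p q => Option (Lab p ⊕ Lab q)
  | .loop _ _ p => Option (Lab p)

noncomputable instance Lab.fintype : (p : Prog Γ) → Fintype (Lab p)
  | .push _ _ => inferInstanceAs (Fintype Unit)
  | .pop _ => inferInstanceAs (Fintype Unit)
  | .seq p q =>
    have := Lab.fintype p
    have := Lab.fintype q
    inferInstanceAs (Fintype (Lab p ⊕ Lab q))
  | .ite _ _ p q =>
    have := Lab.fintype p
    have := Lab.fintype q
    inferInstanceAs (Fintype (Option (Lab p ⊕ Lab q)))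
  | .loop _ _ p =>
    have := Lab.fintype p
    inferInstanceAs (Fintype (Option (Lab p)))

/-- The label at which the compiled program is entered. -/
def start : (p : Prog Γ) → Lab p
  | .push _ _ => ()
  | .pop _ => ()
  | .seq p _ => Sum.inl (start p)
  | .ite _ _ _ _ => none
  | .loop _ _ _ => none

open Turing.TM2 in
/-- The statements of the compiled program, with its labels embedded in `Λ`. -/
def compile {Λ : Type} : (p : Prog Γ) → (Lab p → Λ) → Λ → Lab p → Stmt Γ Λ Bool
  | .push k s, _, exit, _ => .push k (fun _ => s) (.goto fun _ => exit)
  | .pop k, _, exit, _ => .pop k (fun v _ => v) (.goto fun _ => exit)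
  | .seq p q, emb, exit, l =>
    match l with
    | .inl l => compile p (fun l => emb (.inl l)) (emb (.inr (start q))) l
    | .inr l => compile q (fun l => emb (.inr l)) exit l
  | .ite k c p q, emb, exit, l =>
    match l with
    | none => .peek k (fun _ o => c o)
        (.goto fun v => bif v then emb (some (.inl (start p))) else emb (some (.inr (start q))))
    | some (.inl l) => compile p (fun l => emb (some (.inl l))) exit l
    | some (.inr l) => compile q (fun l => emb (some (.inr l))) exit l
  | .loop k c p, emb, exit, l =>
    match l with
    | none => .peek k (fun _ o => c o)
        (.goto fun v => bif v then emb (some (start p)) else exit)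
    | some l => compile p (fun l => emb (some l)) (emb none) l

/-- `t` steps of the machine with program `m`. -/
def steps {Λ : Type} (m : Λ → Turing.TM2.Stmt Γ Λ Bool) (t : ℕ) (c : Turing.TM2.Cfg Γ Λ Bool) :
    Option (Turing.TM2.Cfg Γ Λ Bool) :=
  (flip bind (Turing.TM2.step m))^[t] (some c)

theorem steps_add {Λ : Type} {m : Λ → Turing.TM2.Stmt Γ Λ Bool} {t t' : ℕ} {c c' c''}
    (h : steps m t c = some c') (h' : steps m t' c' = c'') : steps m (t + t') c = c'' := by
  unfold steps at *
  rw [add_comm, Function.iterate_add_apply, h, h']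

theorem steps_one {Λ : Type} (m : Λ → Turing.TM2.Stmt Γ Λ Bool) (l v S) :
    steps m 1 ⟨some l, v, S⟩ = some (Turing.TM2.stepAux (m l) v S) := rfl

theorem Exec.compile {p : Prog Γ} {S t S'} (h : Exec p S t S') :
    ∀ {Λ : Type} (m : Λ → Turing.TM2.Stmt Γ Λ Bool) (emb : Lab p → Λ) (exit : Λ) (v : Bool),
      (∀ l, m (emb l) = p.compile emb exit l) →
      ∃ v', steps m t ⟨some (emb p.start), v, S⟩ = some ⟨some exit, v', S'⟩ := by
  induction h with
  | push k s S =>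
    intro Λ m emb exit v hm
    refine ⟨v, ?_⟩
    rw [steps_one, hm]
    simp [Prog.compile]
  | pop k S =>
    intro Λ m emb exit v hm
    refine ⟨v, ?_⟩
    rw [steps_one, hm]
    simp [Prog.compile]
  | @seq p q S t S' t' S'' _ _ ih₁ ih₂ =>
    intro Λ m emb exit v hm
    obtain ⟨v', h₁⟩ := ih₁ m (fun l => emb (.inl l)) (emb (.inr (start q))) v
      (fun l => hm (.inl l))
    obtain ⟨v'', h₂⟩ := ih₂ m (fun l => emb (.inr l)) exit v' (fun l => hm (.inr l))
    exact ⟨v'', steps_add h₁ h₂⟩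
  | @ite_pos k c p q S t S' hc _ ih =>
    intro Λ m emb exit v hm
    obtain ⟨v', h₁⟩ := ih m (fun l => emb (some (.inl l))) exit true
      (fun l => hm (some (.inl l)))
    refine ⟨v', ?_⟩
    rw [add_comm]
    refine steps_add (c' := ⟨some (emb (some (.inl p.start))), true, S⟩) ?_ h₁
    rw [steps_one, hm]
    simp [Prog.compile, start, hc]
  | @ite_neg k c p q S t S' hc _ ih =>
    intro Λ m emb exit v hm
    obtain ⟨v', h₁⟩ := ih m (fun l => emb (some (.inr l))) exit false
      (fun l => hm (some (.inr l)))
    refine ⟨v', ?_⟩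
    rw [add_comm]
    refine steps_add (c' := ⟨some (emb (some (.inr q.start))), false, S⟩) ?_ h₁
    rw [steps_one, hm]
    simp [Prog.compile, start, hc]
  | @loop_pos k c p S t S' t' S'' hc _ _ ih₁ ih₂ =>
    intro Λ m emb exit v hm
    obtain ⟨v', h₁⟩ := ih₁ m (fun l => emb (some l)) (emb none) true
      (fun l => hm (some l))
    obtain ⟨v'', h₂⟩ := ih₂ m emb exit v' hm
    refine ⟨v'', ?_⟩
    rw [add_comm]
    refine steps_add (c' := ⟨some (emb (some p.start)), true, S⟩) ?_ (steps_add h₁ h₂)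
    rw [steps_one, hm]
    simp [Prog.compile, start, hc]
  | @loop_neg k c p S hc =>
    intro Λ m emb exit v hm
    refine ⟨false, ?_⟩
    rw [steps_one, hm]
    simp [Prog.compile, start, hc]

/-- The machine that runs `p` and halts. -/
noncomputable def machine [Fintype K] (p : Prog Γ) (k₀ k₁ : K) [Fintype (Γ k₀)] :
    Turing.FinTM2 where
  k₀ := k₀
  k₁ := k₁
  Γ := Γ
  Λ := Option (Lab p)
  main := some p.start
  σ := Bool
  initialState := false
  m := fun l => match l with
    | some l => p.compile some none l
    | none => .load (fun _ => false) .halt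

/-- The stacks of which only `k` is possibly non-empty, with contents `s`. -/
def single (k : K) (s : List (Γ k)) : ∀ k, List (Γ k) :=
  Function.update (fun _ => []) k s

theorem dite_eq_single (k₀ : K) (s : List (Γ k₀)) :
    (fun k => if h : k = k₀ then (by rw [h]; exact s : List (Γ k)) else []) = single k₀ s := by
  funext k
  by_cases hk : k = k₀
  · subst hk; simp [single]
  · simp [single, hk]

/-- A program that computes `f` from the input stack to the output stack in polynomial time
gives a machine that computes `f` in polynomial time. -/
theorem computableInPolyTime [Fintype K] (p : Prog Γ) (k₀ k₁ : K) [Fintype (Γ k₀)]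
    {α β α' β' : Type} (e₀ : Γ k₀ ≃ α') (e₁ : Γ k₁ ≃ β') (ea : α → List α') (eb : β → List β')
    (f : α → β) (time : Polynomial ℕ)
    (h : ∀ a, ∃ t ≤ time.eval (ea a).length,
      Exec p (single k₀ ((ea a).map e₀.symm)) t (single k₁ ((eb (f a)).map e₁.symm))) :
    Nonempty (Turing.TM2ComputableInPolyTime ea eb f) := by
  refine ⟨⟨⟨p.machine k₀ k₁, e₀, e₁⟩, time + 1, fun a => Nonempty.some ?_⟩⟩
  obtain ⟨t, ht, h⟩ := h a
  obtain ⟨v, hv⟩ := h.compile (p.machine k₀ k₁).m some none false (fun l => rfl)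
  refine ⟨⟨⟨t + 1, ?_⟩, ?_⟩⟩
  · refine Eq.trans (b := steps (p.machine k₀ k₁).m (t + 1)
      ⟨some (some p.start), false, single k₀ ((ea a).map e₀.symm)⟩) ?_ ?_
    · exact congrArg (fun S => steps (p.machine k₀ k₁).m (t + 1) ⟨some (some p.start), false, S⟩)
        (dite_eq_single k₀ _)
    · refine (steps_add hv (steps_one _ _ _ _)).trans ?_
      exact congrArg (fun S => some (⟨none, false, S⟩ : Turing.TM2.Cfg Γ _ Bool))
        (dite_eq_single k₁ _).symm
  · simpa using ht

end Prog

end StoquasticLH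

namespace StoquasticLH

/-! ### A machine that operates on a stack of binary trees -/

/-- The work stacks. -/
inductive Work
  | main | aux | cnt
  deriving DecidableEq

instance : Fintype Work := ⟨{.main, .aux, .cnt}, fun x => by cases x <;> simp⟩

/-- Stack alphabets: the work stacks hold bits and a marker `none`, the output stack holds bits. -/
abbrev Sym : Option Work → Type
  | some _ => Option Bool
  | none => Bool

abbrev Stacks := ∀ k, List (Sym k)

/-- The family of stacks with the given contents. -/
def st (m a c : List (Option Bool)) (o : List Bool) : Stacks
  | some .main => m
  | some .aux => a
  | some .cnt => c
  | none => o

section st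

variable (m a c : List (Option Bool)) (o : List Bool)

@[simp] theorem st_main : st m a c o (some .main) = m := rfl
@[simp] theorem st_aux : st m a c o (some .aux) = a := rfl
@[simp] theorem st_cnt : st m a c o (some .cnt) = c := rfl
@[simp] theorem st_out : st m a c o none = o := rfl

@[simp] theorem update_st_main (l : List (Option Bool)) :
    Function.update (st m a c o) (some .main) l = st l a c o := by
  funext k; rcases k with _ | _ | _ | _ <;> rfl
@[simp] theorem update_st_aux (l : List (Option Bool)) :
    Function.update (st m a c o) (some .aux) l = st m l c o := by
  funext k; rcases k with _ | _ | _ | _ <;> rfl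
@[simp] theorem update_st_cnt (l : List (Option Bool)) :
    Function.update (st m a c o) (some .cnt) l = st m a l o := by
  funext k; rcases k with _ | _ | _ | _ <;> rfl
@[simp] theorem update_st_out (l : List Bool) :
    Function.update (st m a c o) none l = st m a c l := by
  funext k; rcases k with _ | _ | _ | _ <;> rfl

end st

namespace Prog

theorem Exec.congr {K : Type} [DecidableEq K] {Γ : K → Type} {p : Prog Γ} {S t S' t' S''}
    (h : Exec p S t S') (ht : t = t') (hS : S' = S'') : Exec p S t' S'' := ht ▸ hS ▸ h

/-- Push one symbol. -/
def psh (X : Work) (s : Option Bool) : Prog Sym := .push (some X) s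

/-- Remove one symbol. -/
def del (X : Work) : Prog Sym := .pop (some X)

/-- Test for the bit `1` on the top of a stack. -/
def ifOne (X : Work) (p q : Prog Sym) : Prog Sym :=
  .ite (some X) (fun o => decide (o = some (some true))) p q

/-- Repeat until the marker is on the top of a stack, then remove it. -/
def untilMark (X : Work) (p : Prog Sym) : Prog Sym :=
  .seq (.loop (some X) (fun o => decide (o ≠ some none)) p) (del X)

/-- Move the top bit of the stack `X` to `Y`. -/
def mv (X Y : Work) : Prog Sym :=
  ifOne X (.seq (del X) (psh Y (some true))) (.seq (del X) (psh Y (some false)))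

/-- Move the top bit of the stack `X` to `Y` and `Z`. -/
def mv₂ (X Y Z : Work) : Prog Sym :=
  ifOne X (.seq (del X) (.seq (psh Y (some true)) (psh Z (some true))))
    (.seq (del X) (.seq (psh Y (some false)) (psh Z (some false))))

section basic

variable {m a c : List (Option Bool)} {o : List Bool}

theorem exec_push_main (s) : Exec (psh .main s) (st m a c o) 1 (st (s :: m) a c o) :=
  (Exec.push _ _ _).congr rfl (by simp)
theorem exec_push_aux (s) : Exec (psh .aux s) (st m a c o) 1 (st m (s :: a) c o) :=
  (Exec.push _ _ _).congr rfl (by simp)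
theorem exec_push_cnt (s) : Exec (psh .cnt s) (st m a c o) 1 (st m a (s :: c) o) :=
  (Exec.push _ _ _).congr rfl (by simp)
theorem exec_pop_main (s) : Exec (del .main) (st (s :: m) a c o) 1 (st m a c o) :=
  (Exec.pop _ _).congr rfl (by simp)
theorem exec_pop_aux (s) : Exec (del .aux) (st m (s :: a) c o) 1 (st m a c o) :=
  (Exec.pop _ _).congr rfl (by simp)
theorem exec_pop_cnt (s) : Exec (del .cnt) (st m a (s :: c) o) 1 (st m a c o) :=
  (Exec.pop _ _).congr rfl (by simp)

theorem Exec.ifOne_pos {X p q S t S'} {l : List (Option Bool)} (h : S (some X) = some true :: l)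
    (hp : Exec p S t S') : Exec (ifOne X p q) S (t + 1) S' :=
  .ite_pos (by simp [h]) hp

theorem Exec.ifOne_neg {X p q S t S'} {l : List (Option Bool)} (h : S (some X) = some false :: l)
    (hq : Exec q S t S') : Exec (ifOne X p q) S (t + 1) S' :=
  .ite_neg (by simp [h]) hq

/-- A loop that treats the bits above the marker one by one. -/
theorem Exec.untilMark {X : Work} {p : Prog Sym} (τ : ℕ) (S : List Bool → List Bool → Stacks)
    {S' : Stacks} (r : List (Option Bool)) (hS : ∀ u d, S u d (some X) = u.map some ++ none :: r)
    (hp : ∀ b u d, Exec p (S (b :: u) d) τ (S u (b :: d))) (u : List Bool)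
    (h' : Function.update (S [] u.reverse) (some X) r = S') :
    Exec (untilMark X p) (S u []) ((τ + 1) * u.length + 2) S' := by
  have : ∀ u d, Exec (.loop (some X) (fun o => decide (o ≠ some none)) p) (S u d)
      ((τ + 1) * u.length + 1) (S [] (u.reverse ++ d)) := by
    intro u
    induction u with
    | nil => exact fun d => .loop_neg (by simp [hS])
    | cons b u ih =>
      exact fun d => (Exec.loop_pos (by simp [hS]) (hp b u d) (ih _)).congr (by simp; ring)
        (by simp)
  refine ((this u []).seq (Exec.pop _ _)).congr (by ring) ?_
  rw [List.append_nil, hS, ← h']; rfl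

theorem exec_mv_aux_main (b : Bool) :
    Exec (mv .aux .main) (st m (some b :: a) c o) 3 (st (some b :: m) a c o) := by
  cases b
  · exact .ifOne_neg rfl ((exec_pop_aux _).seq (exec_push_main _))
  · exact .ifOne_pos rfl ((exec_pop_aux _).seq (exec_push_main _))

theorem exec_mv_aux_cnt (b : Bool) :
    Exec (mv .aux .cnt) (st m (some b :: a) c o) 3 (st m a (some b :: c) o) := by
  cases b
  · exact .ifOne_neg rfl ((exec_pop_aux _).seq (exec_push_cnt _))
  · exact .ifOne_pos rfl ((exec_pop_aux _).seq (exec_push_cnt _))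

theorem exec_mv_cnt_aux (b : Bool) :
    Exec (mv .cnt .aux) (st m a (some b :: c) o) 3 (st m (some b :: a) c o) := by
  cases b
  · exact .ifOne_neg rfl ((exec_pop_cnt _).seq (exec_push_aux _))
  · exact .ifOne_pos rfl ((exec_pop_cnt _).seq (exec_push_aux _))

theorem exec_mv₂ (b : Bool) :
    Exec (mv₂ .aux .main .cnt) (st m (some b :: a) c o) 4
      (st (some b :: m) a (some b :: c) o) := by
  cases b
  · exact .ifOne_neg rfl ((exec_pop_aux _).seq ((exec_push_main _).seq (exec_push_cnt _)))
  · exact .ifOne_pos rfl ((exec_pop_aux _).seq ((exec_push_main _).seq (exec_push_cnt _)))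

/-- Bits as stack symbols. -/
abbrev syms (u : List Bool) : List (Option Bool) := u.map some

theorem exec_xfer_aux_main (u : List Bool) :
    Exec (untilMark .aux (mv .aux .main)) (st m (syms u ++ none :: a) c o) (4 * u.length + 2)
      (st (syms u.reverse ++ m) a c o) :=
  Exec.untilMark 3 (fun u d => st (syms d ++ m) (syms u ++ none :: a) c o) a (by simp)
    (fun b u d => exec_mv_aux_main b) u (by simp)

theorem exec_xfer_aux_cnt (u : List Bool) :
    Exec (untilMark .aux (mv .aux .cnt)) (st m (syms u ++ none :: a) c o) (4 * u.length + 2)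
      (st m a (syms u.reverse ++ c) o) :=
  Exec.untilMark 3 (fun u d => st m (syms u ++ none :: a) (syms d ++ c) o) a (by simp)
    (fun b u d => exec_mv_aux_cnt b) u (by simp)

theorem exec_xfer_cnt_aux (u : List Bool) :
    Exec (untilMark .cnt (mv .cnt .aux)) (st m a (syms u ++ none :: c) o) (4 * u.length + 2)
      (st m (syms u.reverse ++ a) c o) :=
  Exec.untilMark 3 (fun u d => st m (syms d ++ a) (syms u ++ none :: c) o) c (by simp)
    (fun b u d => exec_mv_cnt_aux b) u (by simp)

theorem exec_xfer₂ (u : List Bool) :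
    Exec (untilMark .aux (mv₂ .aux .main .cnt)) (st m (syms u ++ none :: a) c o)
      (5 * u.length + 2) (st (syms u.reverse ++ m) a (syms u.reverse ++ c) o) :=
  Exec.untilMark 4 (fun u d => st (syms d ++ m) (syms u ++ none :: a) (syms d ++ c) o) a (by simp)
    (fun b u d => exec_mv₂ b) u (by simp)

theorem exec_drain (u : List Bool) :
    Exec (untilMark .aux (del .aux)) (st m (syms u ++ none :: a) c o)
      (2 * u.length + 2) (st m a c o) :=
  Exec.untilMark 1 (fun u _ => st m (syms u ++ none :: a) c o) a (by simp)
    (fun b u d => exec_pop_aux _) u (by simp)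

end basic

end Prog

/-- Binary trees, the universal data type. -/
inductive Tree
  | nil | cons (l r : Tree)

/-- The prefix code of a binary tree. -/
def Tree.code : Tree → List Bool
  | nil => [false]
  | cons l r => true :: (l.code ++ r.code)

namespace Prog

/-- Scan one tree from the main stack to the auxiliary stack; the counter holds the number of
pending subtrees. -/
def scanLoop : Prog Sym :=
  .loop (some .cnt) (fun o => decide (o ≠ some none))
    (ifOne .main
      (.seq (del .main) (.seq (psh .aux (some true)) (psh .cnt (some true))))
      (.seq (del .main) (.seq (psh .aux (some false)) (del .cnt))))

theorem exec_scanLoop (t : Tree) {m a c : List (Option Bool)} {o : List Bool} {τ S'}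
    (h : Exec scanLoop (st m (syms t.code.reverse ++ a) c o) τ S') :
    Exec scanLoop (st (syms t.code ++ m) a (some true :: c) o) (5 * t.code.length + τ) S' := by
  induction t generalizing m a c τ with
  | nil =>
    refine (Exec.loop_pos (by simp) (.ifOne_neg rfl
      ((exec_pop_main _).seq ((exec_push_aux _).seq (exec_pop_cnt _)))) h).congr ?_ rfl
    simp [Tree.code]; ring
  | cons l r ihl ihr =>
    have h₂ : Exec scanLoop (st (syms l.code ++ (syms r.code ++ m)) (some true :: a)
        (some true :: some true :: c) o) (5 * l.code.length + (5 * r.code.length + τ)) S' :=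
      ihl (ihr (by simpa [Tree.code] using h))
    refine (Exec.loop_pos (S := st (syms (Tree.cons l r).code ++ m) a (some true :: c) o)
      (by simp) (.ifOne_pos rfl
      ((exec_pop_main _).seq ((exec_push_aux _).seq (exec_push_cnt _)))) ?_).congr
      (t' := 5 * (Tree.cons l r).code.length + τ) (t := 1 + (1 + 1) + 1 +
        (5 * l.code.length + (5 * r.code.length + τ)) + 1) ?_ rfl
    · simpa [scanLoop] using h₂
    · simp [Tree.code]; ring

/-- Move one tree from the main stack to the auxiliary stack, above a marker. -/
def moveTree : Prog Sym :=
  .seq (psh .aux none) (.seq (psh .cnt none) (.seq (psh .cnt (some true))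
    (.seq scanLoop (del .cnt))))

theorem exec_moveTree (t : Tree) (m a c : List (Option Bool)) (o : List Bool) :
    Exec moveTree (st (syms t.code ++ m) a c o) (5 * t.code.length + 5)
      (st m (syms t.code.reverse ++ none :: a) c o) := by
  have h : Exec scanLoop (st m (syms t.code.reverse ++ none :: a) (none :: c) o) 1 _ :=
    Exec.loop_neg (by simp)
  exact ((exec_push_aux _).seq ((exec_push_cnt _).seq ((exec_push_cnt _).seq
    ((exec_scanLoop t h).seq (exec_pop_cnt _))))).congr (by ring) rfl

/-- `Runs p m t m'`: the program `p` changes the main stack from `m` to `m'` in time `t`, whatever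
the contents of the other stacks, which are preserved. -/
def Runs (p : Prog Sym) (m : List (Option Bool)) (t : ℕ) (m' : List (Option Bool)) : Prop :=
  ∀ a c o, Exec p (st m a c o) t (st m' a c o)

theorem Runs.seq {p q : Prog Sym} {m t m' t' m''} (h : Runs p m t m') (h' : Runs q m' t' m'') :
    Runs (.seq p q) m (t + t') m'' := fun _ _ _ => (h _ _ _).seq (h' _ _ _)

theorem Runs.push (s : Option Bool) (m) : Runs (psh .main s) m 1 (s :: m) :=
  fun _ _ _ => exec_push_main s

theorem Runs.pop (s : Option Bool) (m) : Runs (del .main) (s :: m) 1 m :=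
  fun _ _ _ => exec_pop_main s

/-- Remove the top tree. -/
def skipTree : Prog Sym := .seq moveTree (untilMark .aux (del .aux))

theorem runs_skipTree (t : Tree) (m) :
    Runs skipTree (syms t.code ++ m) (7 * t.code.length + 7) m := fun _ _ _ =>
  ((exec_moveTree t _ _ _ _).seq (exec_drain _)).congr (by simp; ring) rfl

/-- Run a program below the top tree. -/
def dip (p : Prog Sym) : Prog Sym :=
  .seq moveTree (.seq p (untilMark .aux (mv .aux .main)))

theorem Runs.dip (u : Tree) {p : Prog Sym} {m t m'} (h : Runs p m t m') :
    Runs (dip p) (syms u.code ++ m) (9 * u.code.length + t + 7) (syms u.code ++ m') :=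
  fun _ _ _ => ((exec_moveTree u _ _ _ _).seq ((h _ _ _).seq (exec_xfer_aux_main _))).congr
    (by simp; ring) (by simp)

/-- Duplicate the top tree. -/
def dup : Prog Sym :=
  .seq (.seq moveTree (.seq (psh .cnt none) (untilMark .aux (mv₂ .aux .main .cnt))))
    (.seq (psh .aux none) (.seq (untilMark .cnt (mv .cnt .aux)) (untilMark .aux (mv .aux .main))))

theorem runs_dup (u : Tree) (m) :
    Runs dup (syms u.code ++ m) (18 * u.code.length + 13) (syms u.code ++ (syms u.code ++ m)) :=
  fun _ _ _ => (Exec.seq ((exec_moveTree u _ _ _ _).seq ((exec_push_cnt _).seq (exec_xfer₂ _)))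
    ((exec_push_aux _).seq ((exec_xfer_cnt_aux _).seq (exec_xfer_aux_main _)))).congr
    (by simp; ring) (by simp)

/-- Exchange the two top trees. -/
def swap : Prog Sym :=
  .seq (.seq moveTree moveTree) (.seq (.seq (psh .cnt none) (untilMark .aux (mv .aux .cnt)))
    (.seq (untilMark .aux (mv .aux .main)) (.seq (psh .aux none)
      (.seq (untilMark .cnt (mv .cnt .aux)) (untilMark .aux (mv .aux .main))))))

theorem runs_swap (u v : Tree) (m) :
    Runs swap (syms u.code ++ (syms v.code ++ m)) (9 * u.code.length + 17 * v.code.length + 20)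
      (syms v.code ++ (syms u.code ++ m)) :=
  fun _ _ _ => (Exec.seq ((exec_moveTree u _ _ _ _).seq (exec_moveTree v _ _ _ _))
    (((exec_push_cnt _).seq (exec_xfer_aux_cnt _)).seq ((exec_xfer_aux_main _).seq
      ((exec_push_aux _).seq ((exec_xfer_cnt_aux _).seq (exec_xfer_aux_main _)))))).congr
    (by simp; ring) (by simp)

end Prog
end StoquasticLH

namespace StoquasticLH

open Prog

/-! ### Functions computable in polynomial time on the tree machine -/

theorem eval_mono (q : Polynomial ℕ) {a b : ℕ} (h : a ≤ b) : q.eval a ≤ q.eval b := by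
  induction q using Polynomial.induction_on' with
  | add p q hp hq => simpa using Nat.add_le_add hp hq
  | monomial n c => simpa using Nat.mul_le_mul_left c (Nat.pow_le_pow_left h n)

/-- Data types whose elements are represented by binary trees. -/
class Enc (α : Type) where
  tree : α → Tree

export Enc (tree)

/-- The code of the tree that represents `a`. -/
def word {α : Type} [Enc α] (a : α) : List Bool := (Enc.tree a).code

/-- The size of the representation of `a`. -/
def size {α : Type} [Enc α] (a : α) : ℕ := (word a).length

/-- `f` can be computed by the tree machine in polynomial time. -/
@[fun_prop]
def PT {α β : Type} [Enc α] [Enc β] (f : α → β) : Prop :=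
  ∃ (p : Prog Sym) (q : Polynomial ℕ), ∀ a, ∃ t ≤ q.eval (size a), ∀ m,
    Runs p (syms (word a) ++ m) t (syms (word (f a)) ++ m)

theorem Prog.Runs.size_le {α β : Type} [Enc α] [Enc β] {p : Prog Sym} {a : α} {b : β} {m t}
    (h : Runs p (syms (word a) ++ m) t (syms (word b) ++ m)) : size b ≤ size a + t := by
  have := (h [] [] []).length_le (some .main)
  simp only [st_main, List.length_append, List.length_map] at this
  unfold size
  omega

instance : Enc Unit := ⟨fun _ => .nil⟩
instance : Enc Bool := ⟨fun b => bif b then .cons .nil .nil else .nil⟩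
instance {α β : Type} [Enc α] [Enc β] : Enc (α × β) := ⟨fun p => .cons (Enc.tree p.1) (Enc.tree p.2)⟩

/-- The tree of a list. -/
def listTree {α : Type} [Enc α] : List α → Tree
  | [] => .nil
  | a :: l => .cons (Enc.tree a) (listTree l)

instance {α : Type} [Enc α] : Enc (List α) := ⟨listTree⟩
instance : Enc ℕ := ⟨fun n => Enc.tree n.bits⟩

section

variable {α β γ δ σ : Type} [Enc α] [Enc β] [Enc γ] [Enc δ] [Enc σ]

theorem word_true : word true = [true, false, false] := rfl
theorem word_false : word false = [false] := rfl
theorem word_prod (p : α × β) : word p = true :: (word p.1 ++ word p.2) := rfl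
theorem word_nil : word ([] : List α) = [false] := rfl
theorem word_cons (a : α) (l : List α) : word (a :: l) = true :: (word a ++ word l) := rfl

theorem size_unit (u : Unit) : size u = 1 := rfl
theorem size_bool_le (b : Bool) : size b ≤ 3 := by cases b <;> decide
theorem size_prod (p : α × β) : size p = size p.1 + size p.2 + 1 := by
  simp [size, word_prod]
theorem size_mk (a : α) (b : β) : size (a, b) = size a + size b + 1 := size_prod _
theorem size_nil : size ([] : List α) = 1 := rfl
theorem size_cons (a : α) (l : List α) : size (a :: l) = size a + size l + 1 := by
  simp [size, word_cons]
theorem size_nat (n : ℕ) : size n = size n.bits := rfl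
theorem size_pos (a : α) : 0 < size a := by
  unfold size word; cases Enc.tree a <;> simp [Tree.code]

theorem size_append (l l' : List α) : size (l ++ l') + 1 = size l + size l' := by
  induction l with
  | nil => simp [size_nil]; ring
  | cons a l ih => simp [size_cons]; omega

theorem length_lt_size (l : List α) : l.length < size l := by
  induction l with
  | nil => simp [size_nil]
  | cons a l ih => simp [size_cons]; omega

theorem size_bits_le (l : List Bool) : size l ≤ 4 * l.length + 1 := by
  induction l with
  | nil => simp [size_nil]
  | cons a l ih => have := size_bool_le a; simp [size_cons]; omega

theorem size_le_of_mem {a : α} {l : List α} (h : a ∈ l) : size a ≤ size l := by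
  induction l with
  | nil => simp at h
  | cons b l ih =>
    rw [size_cons]
    rcases List.mem_cons.1 h with rfl | h
    · omega
    · have := ih h; omega

theorem size_prefix_le {l l' : List α} (h : l <+: l') : size l ≤ size l' := by
  obtain ⟨u, rfl⟩ := h
  have := size_append l u
  have := size_pos u
  omega

theorem size_suffix_le {l l' : List α} (h : l <:+ l') : size l ≤ size l' := by
  obtain ⟨u, rfl⟩ := h
  have := size_append u l
  have := size_pos u
  omega

theorem PT.of_runs {f : α → β} (p : Prog Sym) (q : Polynomial ℕ) (τ : α → ℕ)
    (h : ∀ a m, Runs p (syms (word a) ++ m) (τ a) (syms (word (f a)) ++ m))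
    (hq : ∀ a, τ a ≤ q.eval (size a)) : PT f := ⟨p, q, fun a => ⟨_, hq a, h a⟩⟩

theorem runs_skip (a : α) (m) : Runs skipTree (syms (word a) ++ m) (7 * size a + 7) m :=
  runs_skipTree _ m

theorem runs_dup' (a : α) (m) :
    Runs dup (syms (word a) ++ m) (18 * size a + 13) (syms (word a) ++ (syms (word a) ++ m)) :=
  runs_dup _ m

theorem runs_swap' (a : α) (b : β) (m) :
    Runs swap (syms (word a) ++ (syms (word b) ++ m)) (9 * size a + 17 * size b + 20)
      (syms (word b) ++ (syms (word a) ++ m)) := runs_swap _ _ m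

theorem Prog.Runs.dip' (a : α) {p : Prog Sym} {m t m'} (h : Runs p m t m') :
    Runs (.dip p) (syms (word a) ++ m) (9 * size a + t + 7) (syms (word a) ++ m') := h.dip _

@[fun_prop]
theorem PT.id' : PT (fun a : α => a) :=
  .of_runs (.seq (psh .main none) (del .main)) 2 (fun _ => 2)
    (fun _ _ => (Runs.push _ _).seq (Runs.pop _ _)) (fun _ => by simp)

/-- Push the bits of `u`, the last one first. -/
def pushes : List Bool → Prog Sym
  | [] => .seq (psh .main none) (del .main)
  | b :: u => .seq (pushes u) (psh .main (some b))

theorem runs_pushes (u : List Bool) (m) : Runs (pushes u) m (u.length + 2) (syms u ++ m) := by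
  induction u with
  | nil => exact (Runs.push _ _).seq (Runs.pop _ _)
  | cons b u ih =>
    have := ih.seq (Runs.push (some b) _)
    rwa [show u.length + 2 + 1 = (b :: u).length + 2 by simp] at this

@[fun_prop]
theorem PT.const (b : β) : PT (fun _ : α => b) :=
  .of_runs (.seq skipTree (pushes (word b))) (7 * .X + .C ((word b).length + 9))
    (fun a => 7 * size a + 7 + ((word b).length + 2))
    (fun a m => (runs_skip a m).seq (runs_pushes _ _))
    (fun _ => by simp [Polynomial.eval_add]; omega)

@[fun_prop]
theorem PT.comp {f : β → γ} {g : α → β} (hf : PT f) (hg : PT g) : PT (fun a => f (g a)) := by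
  obtain ⟨p, q, hp⟩ := hf
  obtain ⟨p', q', hp'⟩ := hg
  refine ⟨.seq p' p, q' + q.comp (.X + q'), fun a => ?_⟩
  obtain ⟨t', ht', h'⟩ := hp' a
  obtain ⟨t, ht, h⟩ := hp (g a)
  refine ⟨t' + t, ?_, fun m => (h' m).seq (h m)⟩
  have h1 := (h' []).size_le
  have h2 : q.eval (size (g a)) ≤ q.eval (size a + q'.eval (size a)) := eval_mono q (by omega)
  simp only [Polynomial.eval_add, Polynomial.eval_comp, Polynomial.eval_X]
  omega

@[fun_prop]
theorem PT.prodMk {f : α → β} {g : α → γ} (hf : PT f) (hg : PT g) : PT (fun a => (f a, g a)) := by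
  obtain ⟨p, q, hp⟩ := hf
  obtain ⟨p', q', hp'⟩ := hg
  refine ⟨.seq (.seq dup (.seq (dip p') p)) (psh .main (some true)), 27 * .X + q + q' + 21,
    fun a => ?_⟩
  obtain ⟨t, ht, h⟩ := hp a
  obtain ⟨t', ht', h'⟩ := hp' a
  refine ⟨(18 * size a + 13 + ((9 * size a + t' + 7) + t)) + 1, ?_, fun m => ?_⟩
  · simp only [Polynomial.eval_add, Polynomial.eval_mul, Polynomial.eval_X,
      Polynomial.eval_ofNat]
    omega
  · have := (((runs_dup' a m).seq (((h' m).dip' a).seq (h _)))).seq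
      (Runs.push (some true) _)
    simpa [word_prod] using this

@[fun_prop]
theorem PT.fst' : PT (Prod.fst : α × β → α) := by
  refine .of_runs (.seq (del .main) (dip skipTree)) (16 * .X + 15)
    (fun a => 1 + (9 * size a.1 + (7 * size a.2 + 7) + 7)) (fun a m => ?_) (fun a => ?_)
  · have := (Runs.pop (some true) (syms (word a.1) ++ (syms (word a.2) ++ m))).seq
      ((runs_skip a.2 m).dip' a.1)
    simpa [word_prod] using this
  · simp [size_prod, Polynomial.eval_add]; omega

@[fun_prop]
theorem PT.snd' : PT (Prod.snd : α × β → β) := by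
  refine .of_runs (.seq (del .main) skipTree) (7 * .X + 15)
    (fun a => 1 + (7 * size a.1 + 7)) (fun a m => ?_) (fun a => ?_)
  · have := (Runs.pop (some true) (syms (word a.1) ++ (syms (word a.2) ++ m))).seq
      (runs_skip a.1 _)
    simpa [word_prod] using this
  · simp [size_prod, Polynomial.eval_add]; omega

@[fun_prop]
theorem PT.fst {f : α → β × γ} (hf : PT f) : PT (fun a => (f a).1) := PT.comp PT.fst' hf

@[fun_prop]
theorem PT.snd {f : α → β × γ} (hf : PT f) : PT (fun a => (f a).2) := PT.comp PT.snd' hf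

theorem PT.of_tree_eq {f : α → β} {g : α → γ} (hf : PT f)
    (h : ∀ a, Enc.tree (f a) = Enc.tree (g a)) : PT g := by
  obtain ⟨p, q, hp⟩ := hf
  refine ⟨p, q, fun a => ?_⟩
  have : word (g a) = word (f a) := by simp [word, h]
  rw [this]
  exact hp a

theorem Prog.Runs.ifOne_pos {p q : Prog Sym} {m t m'} (h : Runs p (some true :: m) t m') :
    Runs (ifOne .main p q) (some true :: m) (t + 1) m' :=
  fun a c o => .ifOne_pos (S := st _ a c o) rfl (h _ _ _)

theorem Prog.Runs.ifOne_neg {p q : Prog Sym} {m t m'} (h : Runs q (some false :: m) t m') :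
    Runs (ifOne .main p q) (some false :: m) (t + 1) m' :=
  fun a c o => .ifOne_neg (S := st _ a c o) rfl (h _ _ _)

@[fun_prop]
theorem PT.cond {c : α → Bool} {f g : α → β} (hc : PT c) (hf : PT f) (hg : PT g) :
    PT (fun a => bif c a then f a else g a) := by
  obtain ⟨p, q, hp⟩ := hc
  obtain ⟨p₁, q₁, hp₁⟩ := hf
  obtain ⟨p₂, q₂, hp₂⟩ := hg
  refine ⟨.seq (.seq dup p) (ifOne .main (.seq (.seq (del .main) (.seq (del .main) (del .main))) p₁)
    (.seq (del .main) p₂)), 18 * .X + q + q₁ + q₂ + 17, fun a => ?_⟩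
  obtain ⟨t, ht, h⟩ := hp a
  obtain ⟨t₁, ht₁, h₁⟩ := hp₁ a
  obtain ⟨t₂, ht₂, h₂⟩ := hp₂ a
  have key (m) := (runs_dup' a m).seq (h (syms (word a) ++ m))
  simp only [Polynomial.eval_add, Polynomial.eval_mul, Polynomial.eval_X, Polynomial.eval_ofNat]
  cases hca : c a
  · refine ⟨18 * size a + 13 + t + (1 + t₂ + 1), by omega, fun m => (key m).seq ?_⟩
    rw [hca]
    exact ((Runs.pop _ _).seq (h₂ m)).ifOne_neg
  · refine ⟨18 * size a + 13 + t + ((1 + (1 + 1)) + t₁ + 1), by omega, fun m => (key m).seq ?_⟩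
    rw [hca]
    exact (((Runs.pop _ _).seq ((Runs.pop _ _).seq (Runs.pop _ _))).seq (h₁ m)).ifOne_pos

/-- The loop of a fold over the list on top of the accumulator. -/
def foldLoop (p : Prog Sym) : Prog Sym :=
  .loop (some .main) (fun o => decide (o = some (some true)))
    (.seq (.seq (.seq (del .main) (dip swap)) (.seq swap (psh .main (some true)))) (.seq p swap))

theorem exists_runs_foldLoop {step : σ × α → σ} {p : Prog Sym} {q : Polynomial ℕ}
    (hp : ∀ a, ∃ t ≤ q.eval (size a), ∀ m,
      Runs p (syms (word a) ++ m) t (syms (word (step a)) ++ m)) (N : ℕ) (l : List α) (s : σ)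
    (hl : size l ≤ N) (hs : ∀ l', l' <+: l → size (l'.foldl (fun s a => step (s, a)) s) ≤ N) :
    ∃ t ≤ l.length * (q.eval (2 * N + 1) + 100 * N + 100) + 1, ∀ m,
      Runs (foldLoop p) (syms (word l) ++ (syms (word s) ++ m)) t
        (some false :: (syms (word (l.foldl (fun s a => step (s, a)) s)) ++ m)) := by
  induction l generalizing s with
  | nil => exact ⟨1, by simp, fun m a c o => Exec.loop_neg (by simp [word_nil])⟩
  | cons x l ih =>
    rw [size_cons] at hl
    obtain ⟨t, ht, h⟩ := ih (step (s, x)) (by omega)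
      (fun l' hl' => hs (x :: l') (by simpa using hl'))
    obtain ⟨t', ht', h'⟩ := hp (s, x)
    have hs0 := hs [] (by simp)
    have hs1 := hs [x] (by simp)
    simp only [List.foldl_nil, List.foldl_cons] at hs0 hs1
    have hq : q.eval (size (s, x)) ≤ q.eval (2 * N + 1) :=
      eval_mono q (by rw [size_mk]; omega)
    refine ⟨((1 + (9 * size x + (9 * size l + 17 * size s + 20) + 7) +
      ((9 * size x + 17 * size s + 20) + 1)) +
      (t' + (9 * size (step (s, x)) + 17 * size l + 20))) + t + 1, ?_, fun m a c o => ?_⟩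
    · rw [List.length_cons, add_mul]
      omega
    · refine Exec.loop_pos (by simp [word_cons]) ?_ (h m a c o)
      have e := ((((Runs.pop (some true) _).seq
        ((runs_swap' l s m).dip' x)).seq
        ((runs_swap' x s _).seq (Runs.push (some true) _))).seq
        ((by simpa [word_prod] using h' (syms (word l) ++ m) : Runs p (some true ::
            (syms (word s) ++ (syms (word x) ++ (syms (word l) ++ m)))) t'
            (syms (word (step (s, x))) ++ (syms (word l) ++ m))).seq
        (runs_swap' (step (s, x)) l m))) a c o
      simpa [word_cons] using e

/-- Folds are computable in polynomial time if all intermediate results are of polynomial size. -/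
theorem PT.foldl_aux {f : γ → List α} {g : γ → σ} {step : σ × α → σ} (hf : PT f) (hg : PT g)
    (hstep : PT step) (B : Polynomial ℕ)
    (hB : ∀ c l, l <+: f c → size (l.foldl (fun s a => step (s, a)) (g c)) ≤ B.eval (size c)) :
    PT (fun c => (f c).foldl (fun s a => step (s, a)) (g c)) := by
  obtain ⟨p₀, q₀, h₀⟩ := PT.prodMk hf hg
  obtain ⟨p, q, hp⟩ := hstep
  refine ⟨.seq p₀ (.seq (del .main) (.seq (foldLoop p) (del .main))),
    q₀ + (.X + q₀) * (q.comp (2 * (B + .X + q₀) + 1) + 100 * (B + .X + q₀) + 100) + 3,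
    fun c => ?_⟩
  obtain ⟨t₀, ht₀, h₀⟩ := h₀ c
  have hN := (h₀ []).size_le
  rw [size_mk] at hN
  set N := B.eval (size c) + size c + q₀.eval (size c) with hNdef
  obtain ⟨t, ht, h⟩ := exists_runs_foldLoop hp N (f c) (g c) (by omega)
    (fun l' hl' => (hB c l' hl').trans (by omega))
  refine ⟨t₀ + (1 + (t + 1)), ?_, fun m => (h₀ m).seq ?_⟩
  · have h1 : (f c).length ≤ size c + q₀.eval (size c) :=
      (length_lt_size (f c)).le.trans (by omega)
    have h2 := ht.trans (Nat.add_le_add_right (Nat.mul_le_mul_right _ h1) 1)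
    simp only [Polynomial.eval_add, Polynomial.eval_mul, Polynomial.eval_X, Polynomial.eval_ofNat,
      Polynomial.eval_comp, Polynomial.eval_one, ← hNdef]
    omega
  · have := (Runs.pop (some true) (syms (word (f c)) ++ (syms (word (g c)) ++ m))).seq
      ((h m).seq (Runs.pop _ _))
    simpa [word_prod] using this

/-- Folds with parameters. -/
theorem PT.foldl {f : γ → List α} {g : γ → σ} {h : γ → σ → α → σ} (hf : PT f) (hg : PT g)
    (hh : PT (fun p : (γ × σ) × α => h p.1.1 p.1.2 p.2)) (B : Polynomial ℕ)
    (hB : ∀ c l, l <+: f c → size (l.foldl (h c) (g c)) ≤ B.eval (size c)) :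
    PT (fun c => (f c).foldl (h c) (g c)) := by
  have key : ∀ c (l : List α) s, l.foldl (fun (s : γ × σ) a => (s.1, h s.1 s.2 a)) (c, s) =
      (c, l.foldl (h c) s) := by
    intro c l
    induction l with
    | nil => intro s; rfl
    | cons a l ih => intro s; exact ih _
  have := PT.foldl_aux (f := f) (g := fun c => (c, g c))
    (step := fun p => (p.1.1, h p.1.1 p.1.2 p.2)) hf (by fun_prop)
    (PT.prodMk (by fun_prop) hh) (.X + B + 1)
    (fun c l hl => by
      rw [key, size_mk]
      have := hB c l hl
      simp only [Polynomial.eval_add, Polynomial.eval_X, Polynomial.eval_one]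
      omega)
  have h2 := PT.snd this
  simpa only [key] using h2

end

end StoquasticLH

namespace StoquasticLH

open Prog

/-! ### From the tree machine to the class P -/

/-- Distinguish the three symbols on the top of a work stack and remove the symbol. -/
def caseTop (X : Work) (p₁ p₀ p : Prog Sym) : Prog Sym :=
  ifOne X (.seq (del X) p₁)
    (.ite (some X) (fun o => decide (o = some (some false))) (.seq (del X) p₀) (.seq (del X) p))

/-- Move the input to the counter stack. -/
def unload : Prog Sym :=
  .loop (some .aux) Option.isSome
    (caseTop .aux (psh .cnt (some true)) (psh .cnt (some false)) (psh .cnt none))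

theorem exec_unload (l : List (Option Bool)) (c) :
    ∃ t ≤ 5 * l.length + 1, Exec unload (st [] l c []) t (st [] [] (l.reverse ++ c) []) := by
  induction l generalizing c with
  | nil => exact ⟨1, by simp, Exec.loop_neg (by simp)⟩
  | cons s l ih =>
    obtain ⟨t, ht, h⟩ := ih (s :: c)
    rw [List.reverse_cons, List.append_assoc, List.singleton_append]
    rcases s with _ | _ | _
    · exact ⟨_, by rw [List.length_cons]; omega, .loop_pos (by simp)
        (.ite_neg (by simp) (.ite_neg (by simp) ((exec_pop_aux _).seq (exec_push_cnt _)))) h⟩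
    · exact ⟨_, by rw [List.length_cons]; omega, .loop_pos (by simp)
        (.ite_neg (by simp) (.ite_pos (by simp) ((exec_pop_aux _).seq (exec_push_cnt _)))) h⟩
    · exact ⟨_, by rw [List.length_cons]; omega, .loop_pos (by simp)
        (.ite_pos (by simp) ((exec_pop_aux _).seq (exec_push_cnt _))) h⟩

/-- Convert the reversed input to a pair of lists on the main stack. -/
def load : Prog Sym :=
  .loop (some .cnt) Option.isSome
    (caseTop .cnt (pushes (true :: word true)) (pushes (true :: word false)) (pushes [false]))

/-- The contents of the main stack after the symbols `l`, the last one first, are loaded. -/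
def loaded : List (Option Bool) → List (Option Bool) → List (Option Bool)
  | [], m => m
  | some b :: l, m => loaded l (syms (true :: word b) ++ m)
  | none :: l, m => loaded l (some false :: m)

theorem exec_load (l : List (Option Bool)) (m) :
    ∃ t ≤ 20 * l.length + 1, Exec load (st m [] l []) t (st (loaded l m) [] [] []) := by
  induction l generalizing m with
  | nil => exact ⟨1, by simp, Exec.loop_neg (by simp)⟩
  | cons s l ih =>
    rcases s with _ | _ | _
    · obtain ⟨t, ht, h⟩ := ih (some false :: m)
      exact ⟨_, by simp only [List.length_cons, List.length_nil]; omega, .loop_pos (by simp)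
        (.ite_neg (by simp) (.ite_neg (by simp)
          ((exec_pop_cnt _).seq (runs_pushes [false] _ _ _ _)))) h⟩
    · obtain ⟨t, ht, h⟩ := ih (syms (true :: word false) ++ m)
      exact ⟨_, by simp only [List.length_cons, List.length_nil, word_false]; omega,
        .loop_pos (by simp) (.ite_neg (by simp) (.ite_pos (by simp)
          ((exec_pop_cnt _).seq (runs_pushes (true :: word false) _ _ _ _)))) h⟩
    · obtain ⟨t, ht, h⟩ := ih (syms (true :: word true) ++ m)
      exact ⟨_, by simp only [List.length_cons, List.length_nil, word_true]; omega,
        .loop_pos (by simp) (.ite_pos (by simp)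
          ((exec_pop_cnt _).seq (runs_pushes (true :: word true) _ _ _ _))) h⟩

theorem loaded_append (u v m) : loaded (u ++ v) m = loaded v (loaded u m) := by
  induction u generalizing m with
  | nil => rfl
  | cons s u ih => rcases s with _ | b <;> exact ih _

theorem loaded_reverse (x u : List Bool) (m) :
    loaded (syms x).reverse (syms (word u) ++ m) = syms (word (x ++ u)) ++ m := by
  induction x with
  | nil => rfl
  | cons b x ih =>
    rw [show syms (b :: x) = some b :: syms x from rfl, List.reverse_cons, loaded_append, ih]
    simp [loaded, word_cons]

theorem loaded_encodePair (z : List Bool × List Bool) :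
    some true :: loaded (encodePair z).reverse [some false] = syms (word z) := by
  have h1 := loaded_reverse z.2 [] []
  have h2 := fun m => loaded_reverse z.1 [] m
  simp only [word_nil, List.append_nil, List.map_cons, List.map_nil, List.singleton_append]
    at h1 h2
  rw [encodePair, List.reverse_append, List.reverse_cons, List.append_assoc, loaded_append, h1]
  simp only [List.singleton_append, loaded, h2]
  simp [word_prod]

theorem PT.inP {f : List Bool × List Bool → Bool} (hf : PT f) : InP f := by
  obtain ⟨p, q, hp⟩ := hf
  refine Prog.computableInPolyTime (Γ := Sym)
    (.seq unload (.seq (.seq (psh .main (some false)) (.seq load (psh .main (some true))))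
      (.seq p (ifOne .main (.seq (del .main) (.seq (del .main) (.seq (del .main)
        (.push none true)))) (.seq (del .main) (.push none false))))))
    (some .aux) none (Equiv.refl _) (Equiv.refl _) _ _ _ (25 * .X + 20 + q.comp (4 * .X + 4))
    (fun z => ?_)
  obtain ⟨t₁, ht₁, h₁⟩ := exec_unload (encodePair z) []
  obtain ⟨t₂, ht₂, h₂⟩ := exec_load (encodePair z).reverse [some false]
  obtain ⟨t₃, ht₃, h₃⟩ := hp z
  have hsize : size z ≤ 4 * (encodePair z).length + 4 := by
    have e1 := size_bits_le z.1
    have e2 := size_bits_le z.2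
    rw [size_prod]
    simp only [encodePair, List.length_append, List.length_map, List.length_cons]
    omega
  have hq := ht₃.trans (eval_mono q hsize)
  have hS : single (Γ := Sym) (some .aux) ((encodePair z).map (Equiv.refl _).symm) =
      st [] (encodePair z) [] [] := by
    funext k; rcases k with _ | _ | _ | _ <;> simp [single, st]
  have hS' : single (Γ := Sym) none ((Computability.encodeBool (f z)).map (Equiv.refl _).symm) =
      st [] [] [] [f z] := by
    funext k; rcases k with _ | _ | _ | _ <;> simp [single, st, Computability.encodeBool]
  rw [hS, hS']
  have h4 : Exec (ifOne .main (.seq (del .main) (.seq (del .main) (.seq (del .main)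
        (.push none true)))) (.seq (del .main) (.push none false)))
      (st (syms (word (f z))) [] [] []) (bif f z then 5 else 3) (st [] [] [] [f z]) := by
    cases f z
    · exact .ifOne_neg rfl ((exec_pop_main _).seq ((Exec.push _ _ _).congr rfl (by simp)))
    · exact .ifOne_pos rfl ((exec_pop_main _).seq ((exec_pop_main _).seq ((exec_pop_main _).seq
        ((Exec.push _ _ _).congr rfl (by simp)))))
  have h5 := h₃ [] [] [] []
  rw [List.append_nil, List.append_nil, ← loaded_encodePair] at h5
  rw [List.append_nil] at h₁
  refine ⟨_, ?_, h₁.seq (((exec_push_main _).seq (h₂.seq (exec_push_main _))).seq (h5.seq h4))⟩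
  have : (bif f z then 5 else 3) ≤ 5 := by cases f z <;> simp
  rw [List.length_reverse] at ht₂
  simp only [Polynomial.eval_add, Polynomial.eval_mul, Polynomial.eval_X, Polynomial.eval_ofNat,
    Polynomial.eval_comp]
  omega

end StoquasticLH

namespace StoquasticLH

open Prog

/-! ### Polynomial-time operations on lists and natural numbers -/

section

variable {α β γ δ σ : Type} [Enc α] [Enc β] [Enc γ] [Enc δ] [Enc σ]

theorem PT.exists_size_le {f : α → β} (hf : PT f) :
    ∃ q : Polynomial ℕ, ∀ a, size (f a) ≤ q.eval (size a) := by
  obtain ⟨p, q, hp⟩ := hf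
  refine ⟨.X + q, fun a => ?_⟩
  obtain ⟨t, ht, h⟩ := hp a
  have := (h []).size_le
  simp only [Polynomial.eval_add, Polynomial.eval_X]
  omega

/-- A fold is computable in polynomial time if some measure of the accumulator is at first
polynomially bounded and grows by a polynomially bounded amount in each step. -/
theorem PT.foldl_measure {f : γ → List α} {g : γ → σ} {h : γ → σ → α → σ} (hf : PT f) (hg : PT g)
    (hh : PT (fun p : (γ × σ) × α => h p.1.1 p.1.2 p.2)) (μ : γ → σ → ℕ) (B k : Polynomial ℕ)
    (hμ : ∀ c s, size s ≤ μ c s) (h0 : ∀ c, μ c (g c) ≤ B.eval (size c))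
    (hs : ∀ c s, ∀ a ∈ f c, μ c (h c s a) ≤ μ c s + k.eval (size c)) :
    PT (fun c => (f c).foldl (h c) (g c)) := by
  obtain ⟨q, hq⟩ := hf.exists_size_le
  refine PT.foldl hf hg hh (B + q * k) fun c l hl => (hμ c _).trans ?_
  have key : ∀ l : List α, ∀ s, (∀ a ∈ l, a ∈ f c) →
      μ c (l.foldl (h c) s) ≤ μ c s + l.length * k.eval (size c) := by
    intro l
    induction l with
    | nil => simp
    | cons a l ih =>
      intro s hl
      have h1 := ih (h c s a) fun b hb => hl b (List.mem_cons_of_mem _ hb)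
      have h2 := hs c s a (hl a List.mem_cons_self)
      rw [List.length_cons, add_mul, List.foldl_cons]
      omega
  have h1 := key l (g c) fun a ha => hl.subset ha
  have h2 : l.length ≤ q.eval (size c) :=
    (length_lt_size l).le.trans ((size_prefix_le hl).trans (hq c))
  have h3 := Nat.mul_le_mul_right (k.eval (size c)) h2
  have h4 := h0 c
  simp only [Polynomial.eval_add, Polynomial.eval_mul]
  omega

/-- A fold whose accumulator grows by at most a constant multiple of the current list item. -/
theorem PT.foldl_of_size_le {f : γ → List α} {g : γ → σ} {h : γ → σ → α → σ} (hf : PT f)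
    (hg : PT g) (hh : PT (fun p : (γ × σ) × α => h p.1.1 p.1.2 p.2)) (k : ℕ)
    (hs : ∀ c s a, size (h c s a) ≤ size s + k * size a) :
    PT (fun c => (f c).foldl (h c) (g c)) := by
  obtain ⟨q, hq⟩ := hf.exists_size_le
  obtain ⟨q', hq'⟩ := hg.exists_size_le
  refine PT.foldl_measure hf hg hh (fun _ s => size s) q' (.C k * q) (fun _ _ => le_rfl) hq'
    fun c s a ha => (hs c s a).trans ?_
  simp only [Polynomial.eval_mul, Polynomial.eval_C]
  exact Nat.add_le_add_left (Nat.mul_le_mul_left k ((size_le_of_mem ha).trans (hq c))) _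

@[fun_prop]
theorem PT.not {f : α → Bool} (hf : PT f) : PT (fun a => !f a) := by
  have : PT (fun a => bif f a then false else true) := by fun_prop
  convert this using 2 with a; cases f a <;> rfl

@[fun_prop]
theorem PT.and {f g : α → Bool} (hf : PT f) (hg : PT g) : PT (fun a => f a && g a) := by
  have : PT (fun a => bif f a then g a else false) := by fun_prop
  convert this using 2 with a; cases f a <;> rfl

@[fun_prop]
theorem PT.or {f g : α → Bool} (hf : PT f) (hg : PT g) : PT (fun a => f a || g a) := by
  have : PT (fun a => bif f a then true else g a) := by fun_prop
  convert this using 2 with a; cases f a <;> rfl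

@[fun_prop]
theorem PT.xor {f g : α → Bool} (hf : PT f) (hg : PT g) : PT (fun a => f a ^^ g a) := by
  have : PT (fun a => bif f a then !g a else g a) := by fun_prop
  convert this using 2 with a; cases f a <;> simp

@[fun_prop]
theorem PT.cons {f : α → β} {g : α → List β} (hf : PT f) (hg : PT g) :
    PT (fun a => f a :: g a) := (PT.prodMk hf hg).of_tree_eq fun _ => rfl

@[fun_prop]
theorem PT.isEmpty {f : α → List β} (hf : PT f) : PT (fun a => (f a).isEmpty) := by
  suffices PT (fun l : List β => l.isEmpty) from PT.comp this hf
  refine .of_runs (ifOne .main (.seq skipTree (pushes (word false)))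
    (.seq (del .main) (pushes (word true)))) (7 * .X + 20)
    (fun l => bif l.isEmpty then 7 else 7 * size l + 11) (fun l m => ?_) (fun l => ?_)
  · rcases l with _ | ⟨b, l⟩
    · exact ((Runs.pop _ _).seq (runs_pushes _ _)).ifOne_neg
    · exact ((runs_skip (b :: l) m).seq (runs_pushes _ _)).ifOne_pos
  · cases l.isEmpty <;> simp [Polynomial.eval_add]

@[fun_prop]
theorem PT.tail {f : α → List β} (hf : PT f) : PT (fun a => (f a).tail) := by
  suffices PT (fun l : List β => l.tail) from PT.comp this hf
  refine .of_runs (ifOne .main (.seq (del .main) skipTree)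
    (.seq (psh .main none) (del .main))) (7 * .X + 20)
    (fun l => match l with | [] => 3 | b :: _ => 7 * size b + 9) (fun l m => ?_) (fun l => ?_)
  · rcases l with _ | ⟨b, l⟩
    · exact ((Runs.push _ _).seq (Runs.pop _ _)).ifOne_neg
    · have := ((Runs.pop (some true) _).seq (runs_skip b (syms (word l) ++ m))).ifOne_pos
        (q := .seq (psh .main none) (del .main))
      rw [show 1 + (7 * size b + 7) + 1 = 7 * size b + 9 by ring] at this
      simpa [word_cons] using this
  · rcases l with _ | ⟨b, l⟩
    · simp [Polynomial.eval_add]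
    · simp [Polynomial.eval_add, size_cons]; omega

@[fun_prop]
theorem PT.headD {f : α → List β} (hf : PT f) (d : β) : PT (fun a => (f a).headD d) := by
  suffices PT (fun l : List β => l.headD d) from PT.comp this hf
  refine .of_runs (ifOne .main (.seq (del .main) (dip skipTree))
    (.seq (del .main) (pushes (word d)))) (9 * .X + 20 + .C (word d).length)
    (fun l => match l with
      | [] => 1 + ((word d).length + 2) + 1
      | b :: l => 1 + (9 * size b + (7 * size l + 7) + 7) + 1) (fun l m => ?_) (fun l => ?_)
  · rcases l with _ | ⟨b, l⟩
    · exact ((Runs.pop _ _).seq (runs_pushes _ _)).ifOne_neg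
    · have := ((Runs.pop (some true) _).seq ((runs_skip l m).dip' b)).ifOne_pos
        (q := .seq (del .main) (pushes (word d)))
      simpa [word_cons] using this
  · rcases l with _ | ⟨b, l⟩
    · simp [Polynomial.eval_add]; omega
    · simp [Polynomial.eval_add, size_cons]; omega

@[fun_prop]
theorem PT.append {f g : α → List β} (hf : PT f) (hg : PT g) : PT (fun a => f a ++ g a) := by
  have h1 : ∀ {f g : α → List β}, PT f → PT g →
      PT (fun a => (f a).foldl (fun s b => b :: s) (g a)) := fun hf hg =>
    PT.foldl_of_size_le hf hg (by fun_prop) 2 fun c s a => by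
      rw [size_cons]; have := size_pos a; omega
  have h2 := h1 (h1 hf (PT.const [])) hg
  simpa [List.foldl_flip_cons_eq_append'] using h2

@[fun_prop]
theorem PT.reverse {f : α → List β} (hf : PT f) : PT (fun a => (f a).reverse) := by
  have : PT (fun a => (f a).foldl (fun s b => b :: s) []) :=
    PT.foldl_of_size_le hf (PT.const []) (by fun_prop) 2 fun c s a => by
      rw [size_cons]; have := size_pos a; omega
  simpa [List.foldl_flip_cons_eq_append'] using this

theorem size_reverse (l : List α) : size l.reverse = size l := by
  induction l with
  | nil => rfl
  | cons a l ih =>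
    have := size_append l.reverse [a]
    rw [List.reverse_cons, size_cons]
    rw [size_cons, size_nil] at this
    omega

theorem take_succ_headD {β : Type} (d : β) (l : List β) (n : ℕ) (h : l.drop n ≠ []) :
    l.take (n + 1) = l.take n ++ [(l.drop n).headD d] := by
  induction l generalizing n with
  | nil => simp at h
  | cons a l ih => cases n <;> simp_all

theorem foldl_split {β γ : Type} (d : β) (c : List γ) (l : List β) (n : ℕ) :
    c.foldl (fun s _ => bif s.2.isEmpty then s else (s.2.headD d :: s.1, s.2.tail))
      ((l.take n).reverse, l.drop n) =
      ((l.take (n + c.length)).reverse, l.drop (n + c.length)) := by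
  induction c generalizing n with
  | nil => rfl
  | cons x c ih =>
    rw [List.foldl_cons, List.length_cons, show n + (c.length + 1) = n + 1 + c.length by ring,
      ← ih]
    congr 1
    by_cases h : l.drop n = []
    · have h1 : l.length ≤ n := by simpa using h
      have h2 : l.length ≤ n + 1 := by omega
      rw [List.take_of_length_le h1, List.take_of_length_le h2, List.drop_eq_nil_of_le h1,
        List.drop_eq_nil_of_le h2]
      rfl
    · have h' : (l.drop n).isEmpty = false := by simpa using h
      rw [take_succ_headD d l n h]
      simp [h']

theorem PT.split {f : α → List γ} {g : α → List β} (hf : PT f) (hg : PT g) (d : β) :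
    PT (fun a => ((g a).take (f a).length, (g a).drop (f a).length)) := by
  have : PT (fun a => (f a).foldl (fun s _ => bif s.2.isEmpty then s else
      (s.2.headD d :: s.1, s.2.tail)) ([], g a)) := by
    refine PT.foldl_of_size_le hf (by fun_prop) (by fun_prop) 1 fun c s a => ?_
    rcases s with ⟨u, _ | ⟨b, v⟩⟩
    · simp
    · simp [size_mk, size_cons]; omega
  have h2 : PT (fun a => ((f a).foldl (fun s _ => bif s.2.isEmpty then s else
      (s.2.headD d :: s.1, s.2.tail)) (([] : List β), g a)).1.reverse) := by fun_prop
  have h := PT.prodMk h2 (PT.snd this)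
  have key := fun a => foldl_split d (f a) (g a) 0
  simp only [List.take_zero, List.reverse_nil, List.drop_zero, zero_add] at key
  simpa only [key, List.reverse_reverse] using h

@[fun_prop]
theorem PT.take {f : α → List γ} {g : α → List Bool} (hf : PT f) (hg : PT g) :
    PT (fun a => (g a).take (f a).length) := PT.fst (PT.split hf hg false)

@[fun_prop]
theorem PT.drop {f : α → List γ} {g : α → List Bool} (hf : PT f) (hg : PT g) :
    PT (fun a => (g a).drop (f a).length) := PT.snd (PT.split hf hg false)

end

/-! #### Binary numbers -/

/-- The number with the given binary digits, least significant digit first. -/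
def val (l : List Bool) : ℕ := l.foldr Nat.bit 0

@[simp] theorem val_nil : val [] = 0 := rfl
@[simp] theorem val_cons (b : Bool) (l : List Bool) : val (b :: l) = Nat.bit b (val l) := rfl

theorem val_append (u v : List Bool) : val (u ++ v) = val u + 2 ^ u.length * val v := by
  induction u with
  | nil => simp
  | cons b u ih => simp [ih, Nat.bit_val]; ring

theorem val_lt (l : List Bool) : val l < 2 ^ l.length := by
  induction l with
  | nil => simp
  | cons b u ih => simp [Nat.bit_val, pow_succ]; cases b <;> simp <;> omega

@[simp] theorem val_bits (n : ℕ) : val n.bits = n := by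
  induction n using Nat.binaryRec' with
  | zero => simp
  | bit b n h ih => rw [Nat.bits_append_bit n b h, val_cons, ih]

theorem bits_val (l : List Bool) :
    (val l).bits = l.reverse.foldl (fun s b => bif !b && s.isEmpty then s else b :: s) [] := by
  induction l with
  | nil => simp
  | cons b l ih =>
    rw [List.reverse_cons, List.foldl_append, ← ih, val_cons, List.foldl_cons, List.foldl_nil]
    by_cases h : val l = 0 → b = true
    · rw [Nat.bits_append_bit _ _ h]
      cases b
      · have h0 : (val l).bits.isEmpty = false := by
          rw [List.isEmpty_eq_false_iff]
          intro hc
          have h1 := congrArg val hc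
          rw [val_bits] at h1
          exact absurd (h h1) (by simp)
        simp [h0]
      · simp
    · push Not at h
      obtain ⟨h, hb⟩ := h
      simp_all

theorem length_bits (n : ℕ) : n.bits.length = n.size := Nat.size_eq_bits_len n

theorem size_nat_le (n : ℕ) : size n ≤ 4 * n.size + 1 := by
  rw [size_nat]; exact (size_bits_le _).trans (by rw [length_bits])

theorem natSize_le_size (n : ℕ) : n.size ≤ size n := by
  rw [size_nat, ← length_bits]; exact (length_lt_size _).le

section

variable {α β γ δ σ : Type} [Enc α] [Enc β] [Enc γ] [Enc δ] [Enc σ]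

@[fun_prop]
theorem PT.bits {f : α → ℕ} (hf : PT f) : PT (fun a => (f a).bits) := hf.of_tree_eq fun _ => rfl

@[fun_prop]
theorem PT.valOf {f : α → List Bool} (hf : PT f) : PT (fun a => val (f a)) := by
  have : PT (fun a => (f a).reverse.foldl (fun s b => bif !b && s.isEmpty then s else b :: s)
      []) := PT.foldl_of_size_le (by fun_prop) (by fun_prop) (by fun_prop) 2 fun c s a => by
    have := size_pos a
    cases (!a && s.isEmpty) <;> simp [size_cons]; omega
  exact this.of_tree_eq fun a => by rw [← bits_val]; rfl

theorem size_val_le (l : List Bool) : size (val l) ≤ size l := by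
  rw [size_nat]
  induction l with
  | nil => simp
  | cons b l ih =>
    rw [bits_val, List.reverse_cons, List.foldl_append, ← bits_val, size_cons]
    cases h : (!b && (val l).bits.isEmpty) <;> simp [h, size_cons] <;> omega

@[fun_prop]
theorem PT.natBit {f : α → Bool} {g : α → ℕ} (hf : PT f) (hg : PT g) :
    PT (fun a => Nat.bit (f a) (g a)) := by
  have : PT (fun a => val (f a :: (g a).bits)) := by fun_prop
  simpa using this

@[fun_prop]
theorem PT.bodd {f : α → ℕ} (hf : PT f) : PT (fun a => (f a).bodd) := by
  have : PT (fun a => (f a).bits.headD false) := by fun_prop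
  convert this using 2 with a
  rw [Nat.bodd_eq_bits_head]
  cases (f a).bits <;> rfl

@[fun_prop]
theorem PT.div2 {f : α → ℕ} (hf : PT f) : PT (fun a => (f a).div2) := by
  have : PT (fun a => val (f a).bits.tail) := by fun_prop
  convert this using 2 with a
  rw [← Nat.div2_bits_eq_tail, val_bits]

theorem iterate_div2_eq_zero {ι : Type} (l : List ι) (n : ℕ) (h : n < 2 ^ l.length) :
    l.foldl (fun m _ => m.div2) n = 0 := by
  induction l generalizing n with
  | nil => simpa using h
  | cons a l ih =>
    refine ih _ ?_
    simp only [Nat.div2_val]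
    rw [List.length_cons, pow_succ] at h
    omega

/-- One step of the addition of binary numbers. -/
def addStep (s : (ℕ × ℕ) × Bool × List Bool) : (ℕ × ℕ) × Bool × List Bool :=
  ((s.1.1.div2, s.1.2.div2),
    (s.1.1.bodd && s.1.2.bodd || s.2.1 && (s.1.1.bodd || s.1.2.bodd)),
    (s.1.1.bodd ^^ s.1.2.bodd ^^ s.2.1) :: s.2.2)

theorem foldl_addStep_fst {ι : Type} (l : List ι) (s : (ℕ × ℕ) × Bool × List Bool) :
    (l.foldl (fun s _ => addStep s) s).1 =
      (l.foldl (fun m _ => m.div2) s.1.1, l.foldl (fun m _ => m.div2) s.1.2) := by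
  induction l generalizing s with
  | nil => rfl
  | cons a l ih => exact ih _

theorem val_addStep (s : (ℕ × ℕ) × Bool × List Bool) :
    val (addStep s).2.2.reverse + 2 ^ (addStep s).2.2.length *
      ((addStep s).1.1 + (addStep s).1.2 + (addStep s).2.1.toNat) =
    val s.2.2.reverse + 2 ^ s.2.2.length * (s.1.1 + s.1.2 + s.2.1.toNat) := by
  obtain ⟨⟨x, y⟩, c, o⟩ := s
  have hx := Nat.bodd_add_div2 x
  have hy := Nat.bodd_add_div2 y
  simp only [addStep, List.reverse_cons, val_append, List.length_reverse, List.length_cons,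
    val_cons, val_nil, Nat.bit_val]
  generalize x.div2 = x' at *
  generalize y.div2 = y' at *
  generalize x.bodd = d at *
  generalize y.bodd = e at *
  subst hx hy
  cases d <;> cases e <;> cases c <;> simp <;> ring

theorem val_foldl_addStep {ι : Type} (l : List ι) (s : (ℕ × ℕ) × Bool × List Bool) :
    let r := l.foldl (fun s _ => addStep s) s
    val r.2.2.reverse + 2 ^ r.2.2.length * (r.1.1 + r.1.2 + r.2.1.toNat) =
    val s.2.2.reverse + 2 ^ s.2.2.length * (s.1.1 + s.1.2 + s.2.1.toNat) := by
  induction l generalizing s with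
  | nil => rfl
  | cons a l ih => exact (ih _).trans (val_addStep s)

theorem add_eq_foldl (a b : ℕ) : a + b =
    val (((a.bits ++ b.bits).foldl (fun s _ => addStep s) ((a, b), false, [])).2.2.reverse ++
      [((a.bits ++ b.bits).foldl (fun s _ => addStep s) ((a, b), false, [])).2.1]) := by
  have h := val_foldl_addStep (a.bits ++ b.bits) ((a, b), false, [])
  have h1 := foldl_addStep_fst (a.bits ++ b.bits) ((a, b), false, [])
  have ha : a < 2 ^ (a.bits ++ b.bits).length := by
    rw [List.length_append, length_bits, length_bits, pow_add]
    exact (Nat.lt_size_self a).trans_le (Nat.le_mul_of_pos_right _ (by positivity))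
  have hb : b < 2 ^ (a.bits ++ b.bits).length := by
    rw [List.length_append, length_bits, length_bits, pow_add]
    exact (Nat.lt_size_self b).trans_le (Nat.le_mul_of_pos_left _ (by positivity))
  rw [iterate_div2_eq_zero _ _ ha, iterate_div2_eq_zero _ _ hb] at h1
  simp only [h1] at h
  simp only [zero_add, add_zero, List.reverse_nil, val_nil, List.length_nil, pow_zero, Bool.toNat_false] at h
  rw [val_append, List.length_reverse, val_cons, val_nil, Nat.bit_val]
  simp only [mul_zero, zero_add]
  omega

theorem size_div2_le (n : ℕ) : size n.div2 ≤ size n := by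
  rw [size_nat, size_nat, Nat.div2_bits_eq_tail]
  exact size_suffix_le (List.tail_suffix _)

@[fun_prop]
theorem PT.add {f g : α → ℕ} (hf : PT f) (hg : PT g) : PT (fun a => f a + g a) := by
  have : PT (fun a => ((f a).bits ++ (g a).bits).foldl (fun s _ => addStep s)
      ((f a, g a), false, ([] : List Bool))) := by
    refine PT.foldl_of_size_le (by fun_prop) (by fun_prop) (by unfold addStep; fun_prop) 10
      fun c s a => ?_
    obtain ⟨⟨x, y⟩, c, o⟩ := s
    simp only [addStep, size_mk, size_cons]
    have h1 := size_div2_le x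
    have h2 := size_div2_le y
    have h3 := size_bool_le (x.bodd && y.bodd || c && (x.bodd || y.bodd))
    have h4 := size_bool_le (x.bodd ^^ y.bodd ^^ c)
    have h5 := size_pos a
    omega
  simp only [add_eq_foldl]
  fun_prop

theorem mul_eq_foldl (l : List Bool) (b : ℕ) :
    l.reverse.foldl (fun s d => Nat.bit false s + bif d then b else 0) 0 = val l * b := by
  induction l with
  | nil => simp
  | cons d l ih =>
    rw [List.reverse_cons, List.foldl_append, ih, val_cons, List.foldl_cons, List.foldl_nil,
      Nat.bit_val, Nat.bit_val]
    cases d <;> simp <;> ring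

theorem natSize_mul_le (a b : ℕ) : (a * b).size ≤ a.size + b.size := by
  rw [Nat.size_le, pow_add]
  exact Nat.mul_lt_mul'' (Nat.lt_size_self a) (Nat.lt_size_self b)

@[fun_prop]
theorem PT.mul {f g : α → ℕ} (hf : PT f) (hg : PT g) : PT (fun a => f a * g a) := by
  obtain ⟨q, hq⟩ := hf.exists_size_le
  obtain ⟨q', hq'⟩ := hg.exists_size_le
  have : PT (fun a => (f a).bits.reverse.foldl
      (fun s d => Nat.bit false s + bif d then g a else 0) 0) := by
    refine PT.foldl (by fun_prop) (by fun_prop) (by fun_prop) (4 * q + 4 * q' + 1) fun c l hl => ?_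
    have h := mul_eq_foldl l.reverse (g c)
    rw [List.reverse_reverse] at h
    rw [h]
    refine (size_nat_le _).trans ?_
    have h1 := natSize_mul_le (val l.reverse) (g c)
    have h2 : (val l.reverse).size ≤ l.length := by
      rw [Nat.size_le]; simpa using val_lt l.reverse
    have h3 := hl.length_le
    rw [List.length_reverse, length_bits] at h3
    have h4 := (natSize_le_size (f c)).trans (hq c)
    have h5 := (natSize_le_size (g c)).trans (hq' c)
    simp only [Polynomial.eval_add, Polynomial.eval_mul, Polynomial.eval_ofNat,
      Polynomial.eval_one]
    omega
  simpa only [mul_eq_foldl, val_bits] using this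

/-- One step of the comparison of binary numbers. -/
def ltStep (s : (ℕ × ℕ) × Bool) : (ℕ × ℕ) × Bool :=
  ((s.1.1.div2, s.1.2.div2), bif s.1.1.bodd ^^ s.1.2.bodd then s.1.2.bodd else s.2)

theorem foldl_ltStep_fst {ι : Type} (l : List ι) (s : (ℕ × ℕ) × Bool) :
    (l.foldl (fun s _ => ltStep s) s).1 =
      (l.foldl (fun m _ => m.div2) s.1.1, l.foldl (fun m _ => m.div2) s.1.2) := by
  induction l generalizing s with
  | nil => rfl
  | cons a l ih => exact ih _

theorem ltStep_iff (s : (ℕ × ℕ) × Bool) :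
    ((ltStep s).1.1 < (ltStep s).1.2 ∨ (ltStep s).1.1 = (ltStep s).1.2 ∧ (ltStep s).2 = true) ↔
      (s.1.1 < s.1.2 ∨ s.1.1 = s.1.2 ∧ s.2 = true) := by
  obtain ⟨⟨x, y⟩, c⟩ := s
  have hx := Nat.bodd_add_div2 x
  have hy := Nat.bodd_add_div2 y
  simp only [ltStep]
  generalize x.div2 = x' at *
  generalize y.div2 = y' at *
  generalize x.bodd = d at *
  generalize y.bodd = e at *
  subst hx hy
  cases d <;> cases e <;> cases c <;> simp <;> omega

theorem foldl_ltStep_iff {ι : Type} (l : List ι) (s : (ℕ × ℕ) × Bool) :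
    let r := l.foldl (fun s _ => ltStep s) s
    (r.1.1 < r.1.2 ∨ r.1.1 = r.1.2 ∧ r.2 = true) ↔
      (s.1.1 < s.1.2 ∨ s.1.1 = s.1.2 ∧ s.2 = true) := by
  induction l generalizing s with
  | nil => exact Iff.rfl
  | cons a l ih => exact (ih _).trans (ltStep_iff s)

theorem lt_eq_foldl (a b : ℕ) : decide (a < b) =
    ((a.bits ++ b.bits).foldl (fun s _ => ltStep s) ((a, b), false)).2 := by
  have h := foldl_ltStep_iff (a.bits ++ b.bits) ((a, b), false)
  have h1 := foldl_ltStep_fst (a.bits ++ b.bits) ((a, b), false)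
  have ha : a < 2 ^ (a.bits ++ b.bits).length := by
    rw [List.length_append, length_bits, length_bits, pow_add]
    exact (Nat.lt_size_self a).trans_le (Nat.le_mul_of_pos_right _ (by positivity))
  have hb : b < 2 ^ (a.bits ++ b.bits).length := by
    rw [List.length_append, length_bits, length_bits, pow_add]
    exact (Nat.lt_size_self b).trans_le (Nat.le_mul_of_pos_left _ (by positivity))
  rw [iterate_div2_eq_zero _ _ ha, iterate_div2_eq_zero _ _ hb] at h1
  simp only [h1] at h
  rw [Bool.eq_iff_iff]
  simpa using h.symm

@[fun_prop]
theorem PT.lt {f g : α → ℕ} (hf : PT f) (hg : PT g) : PT (fun a => decide (f a < g a)) := by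
  have : PT (fun a => ((f a).bits ++ (g a).bits).foldl (fun s _ => ltStep s)
      ((f a, g a), false)) := by
    refine PT.foldl_of_size_le (by fun_prop) (by fun_prop) (by unfold ltStep; fun_prop) 10
      fun c s a => ?_
    obtain ⟨⟨x, y⟩, c⟩ := s
    simp only [ltStep, size_mk]
    have h1 := size_div2_le x
    have h2 := size_div2_le y
    have h3 := size_bool_le (bif x.bodd ^^ y.bodd then y.bodd else c)
    have h5 := size_pos a
    omega
  simp only [lt_eq_foldl]
  fun_prop

/-- The loop that compares two bit strings. -/
def beqFold (a b : List Bool) (ok : Bool) : List Bool × Bool :=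
  a.foldl (fun s x => (s.1.tail, s.2 && (!s.1.isEmpty && !(s.1.headD false ^^ x)))) (b, ok)

theorem beqFold_eq (a b : List Bool) (ok : Bool) :
    ((beqFold a b ok).2 && (beqFold a b ok).1.isEmpty) = (ok && a == b) := by
  induction a generalizing b ok with
  | nil => cases b <;> rfl
  | cons x a ih =>
    refine (ih _ _).trans ?_
    cases b with
    | nil => simp
    | cons y b => cases x <;> cases y <;> cases ok <;> simp

@[fun_prop]
theorem PT.beq {f g : α → List Bool} (hf : PT f) (hg : PT g) : PT (fun a => f a == g a) := by
  have : PT (fun a => beqFold (f a) (g a) true) := by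
    refine PT.foldl_of_size_le (by fun_prop) (by fun_prop) (by fun_prop) 10 fun c s a => ?_
    rw [size_mk, size_prod s]
    have h1 := size_suffix_le (List.tail_suffix s.1)
    have h2 := size_bool_le (s.2 && (!s.1.isEmpty && !(s.1.headD false ^^ a)))
    have h3 := size_pos a
    omega
  have h := fun a => beqFold_eq (f a) (g a) true
  simp only [Bool.true_and] at h
  simp only [← h]
  fun_prop

end

end StoquasticLH

namespace StoquasticLH

/-! ### Parsing descriptions of Hamiltonians -/

section

variable {α β γ σ : Type} [Enc α] [Enc β] [Enc σ]

/-- A fold for which a measure, linearly related to the size of the accumulator, grows by at most a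
constant multiple of the current list item. -/
theorem PT.foldl_of_measure_le [Enc γ] {f : γ → List α} {g : γ → σ} {h : γ → σ → α → σ} (hf : PT f)
    (hg : PT g) (hh : PT (fun p : (γ × σ) × α => h p.1.1 p.1.2 p.2)) (μ : σ → ℕ) (K k : ℕ)
    (hμ : ∀ s, size s ≤ μ s) (hμ' : ∀ s, μ s ≤ K * size s)
    (hs : ∀ c s a, μ (h c s a) ≤ μ s + k * size a) :
    PT (fun c => (f c).foldl (h c) (g c)) := by
  obtain ⟨q, hq⟩ := hf.exists_size_le
  obtain ⟨q', hq'⟩ := hg.exists_size_le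
  refine PT.foldl_measure hf hg hh (fun _ => μ) (.C K * q') (.C k * q) (fun _ => hμ) (fun c => ?_)
    fun c s a ha => (hs c s a).trans ?_
  · simp only [Polynomial.eval_mul, Polynomial.eval_C]
    exact (hμ' _).trans (Nat.mul_le_mul_left K (hq' c))
  · simp only [Polynomial.eval_mul, Polynomial.eval_C]
    exact Nat.add_le_add_left (Nat.mul_le_mul_left k ((size_le_of_mem ha).trans (hq c))) _

/-- One step of `parseMany`. -/
def parseStep (p : γ → List Bool → α × List Bool) (c : γ) (s : List α × List Bool × Bool) :
    List α × List Bool × Bool :=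
  bif s.2.2 then s else
    bif s.2.1.headD false then ((p c s.2.1.tail).1 :: s.1, (p c s.2.1.tail).2, false)
    else (s.1, s.2.1.tail, true)

/-- Parse a list that is encoded by `encList`; the items are returned in reversed order. -/
def parseMany (p : γ → List Bool → α × List Bool) (c : γ) (u : List Bool) : List α × List Bool :=
  let r := u.foldl (fun s _ => parseStep p c s) (([] : List α), u, false)
  (r.1, r.2.1)

/-- The parser produces data of a size bounded in terms of the number of bits it consumes. -/
def Thrifty (p : γ → List Bool → α × List Bool) : Prop :=
  ∃ d, ∀ k ≥ d, ∀ c u, size (p c u).1 + k * (p c u).2.length ≤ k * u.length + d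

theorem parseStep_le {p : γ → List Bool → α × List Bool} {d k : ℕ}
    (hp : ∀ c u, size (p c u).1 + k * (p c u).2.length ≤ k * u.length + d) (hk : d + 1 ≤ k) (c s) :
    size (parseStep p c s).1 + k * (parseStep p c s).2.1.length ≤
      size s.1 + k * s.2.1.length := by
  obtain ⟨l, u, b⟩ := s
  cases b
  · rcases u with _ | ⟨_ | _, u⟩
    · simp [parseStep]
    · simp [parseStep, mul_add]
    · have := hp c u
      simp only [parseStep, cond_false, List.headD_cons, cond_true, List.tail_cons, size_cons,
        List.length_cons, mul_add, mul_one]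
      omega
  · simp [parseStep]

theorem Thrifty.parseMany {p : γ → List Bool → α × List Bool} (hp : Thrifty p) :
    Thrifty (parseMany p) := by
  obtain ⟨d, hd⟩ := hp
  refine ⟨d + 1, fun k hk c u => ?_⟩
  have key : ∀ (l : List Bool) s, size (l.foldl (fun s _ => parseStep p c s) s).1 +
      k * (l.foldl (fun s _ => parseStep p c s) s).2.1.length ≤ size s.1 + k * s.2.1.length := by
    intro l
    induction l with
    | nil => exact fun s => le_rfl
    | cons b l ih => exact fun s => (ih _).trans (parseStep_le (hd k (by omega)) hk c s)
  have := key u ([], u, false)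
  simp only [size_nil] at this
  simp only [StoquasticLH.parseMany]
  omega

theorem PT.parseMany [Enc γ] {p : γ → List Bool → α × List Bool}
    (hp : PT (fun z : γ × List Bool => p z.1 z.2))
    (ht : Thrifty p) {f : β → γ} {g : β → List Bool} (hf : PT f) (hg : PT g) :
    PT (fun a => parseMany p (f a) (g a)) := by
  obtain ⟨d, hd⟩ := ht
  obtain ⟨q, hq⟩ := hg.exists_size_le
  suffices PT (fun a => (g a).foldl (fun s _ => parseStep p (f a) s) (([] : List α), g a, false)) by
    unfold StoquasticLH.parseMany
    fun_prop
  have hp' : ∀ {f' : (β × List α × List Bool × Bool) × Bool → γ}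
      {g' : (β × List α × List Bool × Bool) × Bool → List Bool}, PT f' → PT g' →
      PT (fun z => p (f' z) (g' z)) := fun hf' hg' => PT.comp hp (PT.prodMk hf' hg')
  refine PT.foldl_measure (h := fun a s _ => parseStep p (f a) s) hg (by fun_prop)
    (by
      have h1 := hp' (f' := fun z => f z.1.1) (g' := fun z => z.1.2.2.1.tail)
        (by fun_prop) (by fun_prop)
      unfold parseStep
      fun_prop)
    (fun _ s => size s.1 + (d + 4) * s.2.1.length + 6) (.C (d + 4) * q + 7) 0
    (fun c s => ?_) (fun c => ?_) (fun c s a _ => ?_)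
  · have h1 := size_bits_le s.2.1
    have h2 := size_bool_le s.2.2
    rw [size_prod, size_prod, add_mul]
    omega
  · have h1 := Nat.mul_le_mul_left (d + 4) ((length_lt_size (g c)).le.trans (hq c))
    simp only [size_nil, Polynomial.eval_add, Polynomial.eval_mul, Polynomial.eval_C,
      Polynomial.eval_ofNat]
    omega
  · have := parseStep_le (hd (d + 4) (by omega)) (by omega) (f c) s
    simpa using this

theorem parseMany_encList {α γ δ : Type} {p : γ → List Bool → α × List Bool} {c : γ}
    {enc : δ → List Bool} {g : δ → α} (l : List δ)
    (h : ∀ x ∈ l, ∀ u, p c (enc x ++ u) = (g x, u)) (u : List Bool) :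
    parseMany p c (encList enc l ++ u) = ((l.map g).reverse, u) := by
  have done : ∀ (v : List Bool) (s : List α × List Bool × Bool), s.2.2 = true →
      v.foldl (fun s _ => parseStep p c s) s = s := by
    intro v
    induction v with
    | nil => exact fun s _ => rfl
    | cons b v ih =>
      intro s hs
      have : parseStep p c s = s := by simp [parseStep, hs]
      rw [List.foldl_cons, this, ih s hs]
  have key : ∀ (l : List δ), (∀ x ∈ l, ∀ u, p c (enc x ++ u) = (g x, u)) →
      ∀ (v : List Bool) (acc : List α), l.length < v.length →
      v.foldl (fun s _ => parseStep p c s) (acc, encList enc l ++ u, false) =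
        ((l.map g).reverse ++ acc, u, true) := by
    intro l
    induction l with
    | nil =>
      intro _ v acc hv
      obtain ⟨b, v, rfl⟩ := List.exists_cons_of_length_pos hv
      rw [List.foldl_cons, done _ _ (by simp [parseStep, encList])]
      simp [parseStep, encList]
    | cons x l ih =>
      intro h v acc hv
      obtain ⟨b, v, rfl⟩ := List.exists_cons_of_length_pos (Nat.zero_lt_of_lt hv)
      have h1 := ih (fun y hy => h y (List.mem_cons_of_mem _ hy)) v (g x :: acc)
        (by simpa using hv)
      rw [List.foldl_cons]
      have h2 : parseStep p c (acc, encList enc (x :: l) ++ u, false) =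
          (g x :: acc, encList enc l ++ u, false) := by
        have := h x List.mem_cons_self (encList enc l ++ u)
        simp only [encList, List.append_assoc, List.singleton_append] at this
        simp [parseStep, encList, this]
      rw [h2, h1]
      simp
  have hlen : l.length < (encList enc l ++ u).length := by
    have : l.length ≤ (l.flatMap fun a => true :: enc a).length := by
      clear h
      induction l with
      | nil => simp
      | cons a l ih => simp only [List.flatMap_cons, List.length_append, List.length_cons] at *; omega
    simp only [encList, List.length_append, List.length_singleton]
    omega
  unfold parseMany
  simp only [key l h _ _ hlen, List.append_nil]

end

/-- Consume nothing. -/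
def unitP (_ : Unit) (u : List Bool) : Unit × List Bool := ((), u)

/-- Read one bit. -/
def bitP (_ : Unit) (u : List Bool) : Bool × List Bool := (u.headD false, u.tail)

/-- Read a natural number. -/
def natP (u : List Bool) : ℕ × List Bool :=
  (val (parseMany bitP () u).1.reverse, (parseMany bitP () u).2)

/-- Read a rational number: sign, absolute value of the numerator, denominator. -/
def ratP (u : List Bool) : (Bool × ℕ × ℕ) × List Bool :=
  ((u.headD false, (natP u.tail).1, (natP (natP u.tail).2).1), (natP (natP u.tail).2).2)

/-- A matrix entry: row and column, sign, absolute value of the numerator, denominator. -/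
abbrev Entry := (List Bool × List Bool) × Bool × ℕ × ℕ

/-- An interaction: the indicator string of its support and its matrix entries. -/
abbrev TermData := List Bool × List Entry

/-- The positions of the matrix entries of an interaction. -/
def positions (k : ℕ) : List (List Bool × List Bool) :=
  ((List.finRange (2 ^ k)).product (List.finRange (2 ^ k))).map fun rc =>
    (List.ofFn (bitsOf k rc.1), List.ofFn (bitsOf k rc.2))

/-- Read the matrix entry at a given position, dropping its imaginary part. -/
def entryStep (s : List Entry × List Bool) (rc : List Bool × List Bool) :
    List Entry × List Bool :=
  ((rc, (ratP s.2).1) :: s.1, (ratP (ratP s.2).2).2)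

/-- Read the entries at the given positions; they are returned in reversed order. -/
def entriesP (pos : List (List Bool × List Bool)) (u : List Bool) : List Entry × List Bool :=
  pos.foldl entryStep ([], u)

/-- Read an interaction; the length of the list `nl` is the number of qubits. -/
def termP (k : ℕ) (nl : List Unit) (u : List Bool) : TermData × List Bool :=
  ((u.take nl.length, (entriesP (positions k) (u.drop nl.length)).1),
    (entriesP (positions k) (u.drop nl.length)).2)

/-- The number of qubits in unary and the interactions of a Hamiltonian. -/
def parse (k : ℕ) (x : List Bool) : List Unit × List TermData :=
  ((parseMany unitP () x).1,
    (parseMany (termP k) (parseMany unitP () x).1 (parseMany unitP () x).2).1)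

section

variable {α : Type} [Enc α]

theorem thrifty_unitP : Thrifty unitP := ⟨1, fun k _ c u => by simp [unitP, size_unit]; omega⟩

theorem thrifty_bitP : Thrifty bitP := by
  refine ⟨3, fun k _ c u => ?_⟩
  have := size_bool_le (u.headD false)
  have h := Nat.mul_le_mul_left k (Nat.sub_le u.length 1)
  simp only [bitP, List.length_tail]
  omega

@[fun_prop]
theorem PT.unary {f : α → List Bool} (hf : PT f) : PT (fun a => StoquasticLH.parseMany unitP () (f a)) :=
  PT.parseMany (by unfold unitP; fun_prop) thrifty_unitP (by fun_prop) hf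

@[fun_prop]
theorem PT.natP {f : α → List Bool} (hf : PT f) : PT (fun a => natP (f a)) := by
  have : PT (fun a => StoquasticLH.parseMany bitP () (f a)) :=
    PT.parseMany (by unfold bitP; fun_prop) thrifty_bitP (by fun_prop) hf
  unfold StoquasticLH.natP
  fun_prop

theorem natP_le : ∃ d, ∀ k ≥ d, ∀ u, size (natP u).1 + k * (natP u).2.length ≤ k * u.length + d := by
  obtain ⟨d, hd⟩ := thrifty_bitP.parseMany
  refine ⟨d, fun k hk u => le_trans ?_ (hd k hk () u)⟩
  have := size_val_le (parseMany bitP () u).1.reverse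
  rw [size_reverse] at this
  simp only [natP]
  omega

attribute [irreducible] natP

@[fun_prop]
theorem PT.ratP {f : α → List Bool} (hf : PT f) : PT (fun a => ratP (f a)) := by
  unfold StoquasticLH.ratP
  fun_prop

theorem ratP_le : ∃ d, ∀ k ≥ d, ∀ u, size (ratP u).1 + k * (ratP u).2.length ≤ k * u.length + d := by
  obtain ⟨d, hd⟩ := natP_le
  refine ⟨2 * d + 5, fun k hk u => ?_⟩
  have h1 := hd k (by omega) u.tail
  have h2 := hd k (by omega) (natP u.tail).2
  have h3 := size_bool_le (u.headD false)
  have h := Nat.mul_le_mul_left k (Nat.sub_le u.length 1)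
  rw [List.length_tail] at h1
  simp only [ratP, size_mk]
  omega

attribute [irreducible] ratP

theorem entryStep_le : ∃ d, ∀ k ≥ d, ∀ s rc, size (entryStep s rc).1 +
    k * (entryStep s rc).2.length ≤ size s.1 + k * s.2.length + (size rc + d) := by
  obtain ⟨d, hd⟩ := ratP_le
  refine ⟨2 * d + 2, fun k hk s rc => ?_⟩
  have h1 := hd k (by omega) s.2
  have h2 := hd k (by omega) (ratP s.2).2
  simp only [entryStep, size_cons, size_mk]
  omega

@[fun_prop]
theorem PT.entriesP (pos : List (List Bool × List Bool)) {f : α → List Bool} (hf : PT f) :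
    PT (fun a => entriesP pos (f a)) := by
  obtain ⟨d, hd⟩ := entryStep_le
  refine PT.foldl_of_measure_le (h := fun _ => entryStep) (PT.const pos) (by fun_prop)
    (by unfold entryStep; fun_prop) (fun s => size s.1 + (d + 4) * s.2.length + 2) (d + 7) (d + 1)
    (fun s => ?_) (fun s => ?_) fun c s a => ?_
  · have := size_bits_le s.2
    rw [size_prod, add_mul]
    omega
  · have := Nat.mul_le_mul_left (d + 4) (length_lt_size s.2).le
    have h3 := size_pos s.1
    rw [size_prod, show d + 7 = (d + 4) + 3 by rfl, add_mul, mul_add, mul_add]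
    nlinarith
  · have := hd (d + 4) (by omega) s a
    have h2 := Nat.le_mul_of_pos_right d (size_pos a)
    rw [add_mul d 1]
    omega

theorem entriesP_le (pos : List (List Bool × List Bool)) : ∃ d, ∀ k ≥ d, ∀ u,
    size (entriesP pos u).1 + k * (entriesP pos u).2.length ≤ k * u.length + d := by
  obtain ⟨d, hd⟩ := entryStep_le
  have key : ∀ (k) (_ : k ≥ d) (pos : List (List Bool × List Bool)) s, size (pos.foldl entryStep s).1 +
      k * (pos.foldl entryStep s).2.length ≤ size s.1 + k * s.2.length + (d + 1) * size pos := by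
    intro k hk pos
    induction pos with
    | nil => intro s; exact Nat.le_add_right _ _
    | cons rc pos ih =>
      intro s
      have h1 := ih (entryStep s rc)
      have h2 := hd k hk s rc
      have h3 := Nat.le_mul_of_pos_right d (size_pos rc)
      rw [List.foldl_cons, size_cons, mul_add, mul_add]
      nlinarith
  refine ⟨(d + 1) * size pos + d + 1, fun k hk u => ?_⟩
  have := key k (by omega) pos ([], u)
  simp only [size_nil] at this
  unfold entriesP
  omega

theorem PT.termP (k : ℕ) : PT (fun z : List Unit × List Bool => termP k z.1 z.2) := by
  unfold StoquasticLH.termP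
  fun_prop

theorem thrifty_termP (k : ℕ) : Thrifty (termP k) := by
  obtain ⟨d, hd⟩ := entriesP_le (positions k)
  refine ⟨d + 4, fun m hm c u => ?_⟩
  have h1 := hd m (by omega) (u.drop c.length)
  have h2 := size_bits_le (u.take c.length)
  have h3 := congrArg (fun l => m * l.length) (List.take_append_drop c.length u)
  simp only [List.length_append, mul_add] at h3
  have h4 := Nat.mul_le_mul_right (u.take c.length).length (show 4 ≤ m by omega)
  simp only [termP, size_mk]
  omega

@[fun_prop]
theorem PT.parse (k : ℕ) {f : α → List Bool} (hf : PT f) : PT (fun a => parse k (f a)) := by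
  have : PT (fun a => StoquasticLH.parseMany (StoquasticLH.termP k)
      (StoquasticLH.parseMany unitP () (f a)).1 (StoquasticLH.parseMany unitP () (f a)).2) :=
    PT.parseMany (PT.termP k) (thrifty_termP k) (by fun_prop) (by fun_prop)
  unfold StoquasticLH.parse
  fun_prop

end

end StoquasticLH

namespace StoquasticLH

/-! ### The verifier -/

/-- The bits of `x` on the support of an interaction. -/
def sel (ind x : List Bool) : List Bool :=
  (ind.foldl (fun (s : List Bool × List Bool) b =>
    (s.1.tail, bif b then s.1.headD false :: s.2 else s.2)) (x, [])).2.reverse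

/-- Whether `x` and `y` agree outside the support of an interaction. -/
def agree (ind x y : List Bool) : Bool :=
  (ind.foldl (fun (s : (List Bool × List Bool) × Bool) b =>
    ((s.1.1.tail, s.1.2.tail), s.2 && (b || !(s.1.1.headD false ^^ s.1.2.headD false))))
    ((x, y), true)).2

/-- Add a matrix entry `± a / b` to `(P - N) / B`: in absolute value if `c.1.1`, and with a minus
sign if `c.1.2` and the position of the entry is `c.2`. -/
def addEntry (c : (Bool × Bool) × List Bool × List Bool) (s : ℕ × ℕ × ℕ) (e : Entry) : ℕ × ℕ × ℕ :=
  let m := c.1.2 && (e.1.1 == c.2.1 && e.1.2 == c.2.2)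
  (s.1 * e.2.2.2 + (bif c.1.1 then e.2.2.1 * s.2.2 else 0) +
      (bif m && e.2.1 then e.2.2.1 * s.2.2 else 0),
    s.2.1 * e.2.2.2 + (bif m && !e.2.1 then e.2.2.1 * s.2.2 else 0),
    s.2.2 * e.2.2.2)

/-- Add all matrix entries of an interaction. -/
def addTerm (c : (Bool × Bool) × List Bool × List Bool) (s : ℕ × ℕ × ℕ) (t : TermData) :
    ℕ × ℕ × ℕ :=
  t.2.foldl (addEntry ((c.1.1, c.1.2 && agree t.1 c.2.1 c.2.2), sel t.1 c.2.1, sel t.1 c.2.2)) s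

/-- Whether the transition from `x` to `y` gets the diagonal weight: in the main branch if
`x = y`, in the reference branch if both are zero. -/
def diag (fl : Bool) (x y : List Bool) : Bool :=
  bif fl then x == y else decide (val x + val y < 1)

/-- The weight `(P - N) / B` of the transition from `x` to `y`. -/
def weight (T : List TermData) (fl : Bool) (x y : List Bool) : ℕ × ℕ × ℕ :=
  T.foldl (addTerm ((diag fl x y, fl), x, y)) (bif diag fl x y then 1 else 0, 0, 1)

/-- Whether `w` is smaller than the integer weight of the transition from `x` to `y`. -/
def check (T : List TermData) (fl : Bool) (x w y : List Bool) : Bool :=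
  decide (val w + (weight T fl x y).2.1 < (weight T fl x y).1)

/-- Read one transition; the parameters are the branch, a string of the length of the blocks, the
number of qubits and the interactions. -/
def walkStep (c : (Bool × List Bool) × List Unit × List TermData) (s : List Bool × List Bool × Bool) :
    List Bool × List Bool × Bool :=
  bif s.1.isEmpty then s else
    ((s.1.drop c.1.2.length).drop c.1.2.length, (s.1.drop c.1.2.length).take c.1.2.length,
      s.2.2 && check c.2.2 c.1.1 (s.2.1.take c.2.1.length) (s.1.take c.1.2.length)
        (((s.1.drop c.1.2.length).take c.1.2.length).take c.2.1.length))

/-- Read a walk from a string of random bits. -/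
def walk (c : (Bool × List Bool) × List Unit × List TermData) (y : List Bool) : Bool :=
  ((y.drop c.1.2.length).foldl (fun s _ => walkStep c s)
    (y.drop c.1.2.length, y.take c.1.2.length, true)).2.2

/-- The first random bit, which selects the branch. -/
def branchBit (z : List Bool × List Bool) : Bool := z.2.headD false

/-- Whether the random bits describe a walk in the selected branch; the reference branch gets half
of the probability. -/
def verify (k : ℕ) (z : List Bool × List Bool) : Bool :=
  (z.2.headD false || z.2.tail.headD false) &&
    walk ((z.2.headD false, z.1), parse k z.1) z.2.tail.tail

section

variable {α : Type} [Enc α]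

@[fun_prop]
theorem PT.sel {f g : α → List Bool} (hf : PT f) (hg : PT g) : PT (fun a => sel (f a) (g a)) := by
  have : PT (fun a => (f a).foldl (fun (s : List Bool × List Bool) b =>
      (s.1.tail, bif b then s.1.headD false :: s.2 else s.2)) (g a, [])) := by
    refine PT.foldl_of_size_le hf (by fun_prop) (by fun_prop) 4 fun c s a => ?_
    have h1 := size_suffix_le (List.tail_suffix s.1)
    have h2 := size_bool_le (s.1.headD false)
    have h3 := size_pos a
    rw [size_prod, size_prod s]
    cases a
    · simp only [cond_false]; omega
    · simp only [cond_true, size_cons]; omega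
  unfold StoquasticLH.sel
  fun_prop

@[fun_prop]
theorem PT.agree {f g h : α → List Bool} (hf : PT f) (hg : PT g) (hh : PT h) :
    PT (fun a => agree (f a) (g a) (h a)) := by
  have : PT (fun a => (f a).foldl (fun (s : (List Bool × List Bool) × Bool) b =>
      ((s.1.1.tail, s.1.2.tail), s.2 && (b || !(s.1.1.headD false ^^ s.1.2.headD false))))
      ((g a, h a), true)) := by
    refine PT.foldl_of_size_le hf (by fun_prop) (by fun_prop) 4 fun c s a => ?_
    have h1 := size_suffix_le (List.tail_suffix s.1.1)
    have h2 := size_suffix_le (List.tail_suffix s.1.2)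
    have h3 := size_bool_le (s.2 && (a || !(s.1.1.headD false ^^ s.1.2.headD false)))
    have h4 := size_pos a
    rw [size_mk, size_mk, size_prod s, size_prod s.1]
    omega
  unfold StoquasticLH.agree
  fun_prop

/-- The maximal number of binary digits of the components. -/
def digits (s : ℕ × ℕ × ℕ) : ℕ := max s.1.size (max s.2.1.size s.2.2.size)

theorem size_le_digits (s : ℕ × ℕ × ℕ) : size s ≤ 12 * digits s + 5 := by
  have h1 := size_nat_le s.1
  have h2 := size_nat_le s.2.1
  have h3 := size_nat_le s.2.2
  rw [size_prod, size_prod]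
  unfold digits
  omega

theorem digits_le_size (s : ℕ × ℕ × ℕ) : digits s ≤ size s := by
  have h1 := natSize_le_size s.1
  have h2 := natSize_le_size s.2.1
  have h3 := natSize_le_size s.2.2
  rw [size_prod, size_prod]
  unfold digits
  omega

theorem digits_addEntry_le (c) (s : ℕ × ℕ × ℕ) (e : Entry) :
    digits (addEntry c s e) ≤ digits s + (e.2.2.1.size + e.2.2.2.size + 2) := by
  obtain ⟨P, N, B⟩ := s
  obtain ⟨rc, sg, a, b⟩ := e
  set d := digits (P, N, B) with hd
  have lt_of {m : ℕ} (h : m.size ≤ d) : m < 2 ^ d := Nat.size_le.1 h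
  have hP : P < 2 ^ d := lt_of (by simp [hd, digits])
  have hN : N < 2 ^ d := lt_of (by simp [hd, digits])
  have hB : B < 2 ^ d := lt_of (by simp [hd, digits])
  have ha := Nat.lt_size_self a
  have hb := Nat.lt_size_self b
  have h1 : 2 ^ (d + (a.size + b.size + 2)) = 4 * (2 ^ d * 2 ^ a.size * 2 ^ b.size) := by
    rw [pow_add, pow_add, pow_add]; ring
  have pa : 0 < 2 ^ a.size := by positivity
  have pb : 0 < 2 ^ b.size := by positivity
  have mul_lt {m : ℕ} (h : m < 2 ^ d) : m * b < 2 ^ d * 2 ^ a.size * 2 ^ b.size := by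
    refine Nat.mul_lt_mul'' (h.trans_le ?_) hb
    exact Nat.le_mul_of_pos_right _ pa
  have haB : a * B < 2 ^ d * 2 ^ a.size * 2 ^ b.size := by
    rw [mul_comm a]
    exact (Nat.mul_lt_mul'' hB ha).trans_le (Nat.le_mul_of_pos_right _ pb)
  have ite_lt (c : Bool) : (bif c then a * B else 0) < 2 ^ d * 2 ^ a.size * 2 ^ b.size := by
    cases c
    · simp
    · exact haB
  simp only [digits, addEntry]
  refine max_le ?_ (max_le ?_ ?_) <;> rw [Nat.size_le, h1]
  · have h2 := mul_lt hP
    have h3 := ite_lt c.1.1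
    have h4 := ite_lt (c.1.2 && (rc.1 == c.2.1 && rc.2 == c.2.2) && sg)
    omega
  · have h2 := mul_lt hN
    have h4 := ite_lt (c.1.2 && (rc.1 == c.2.1 && rc.2 == c.2.2) && !sg)
    omega
  · have h2 := mul_lt hB
    omega

theorem digits_addEntry_le_size (c) (s : ℕ × ℕ × ℕ) (e : Entry) :
    digits (addEntry c s e) ≤ digits s + 2 * size e := by
  have h := digits_addEntry_le c s e
  have h1 := natSize_le_size e.2.2.1
  have h2 := natSize_le_size e.2.2.2
  have h3 := size_pos e.1
  have h4 := size_pos e.2.1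
  have h5 : size e = size e.1 + (size e.2.1 + (size e.2.2.1 + size e.2.2.2 + 1) + 1) + 1 := by
    rw [size_prod e, size_prod e.2, size_prod e.2.2]
  omega

theorem digits_addTerm_le_size (c) (s : ℕ × ℕ × ℕ) (t : TermData) :
    digits (addTerm c s t) ≤ digits s + 2 * size t := by
  have key : ∀ (c) (l : List Entry) (s), digits (l.foldl (addEntry c) s) ≤
      digits s + 2 * size l := by
    intro c l
    induction l with
    | nil => intro s; exact Nat.le_add_right _ _
    | cons e l ih =>
      intro s
      have h1 := ih (addEntry c s e)
      have h2 := digits_addEntry_le_size c s e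
      rw [List.foldl_cons, size_cons]
      omega
  have := key ((c.1.1, c.1.2 && agree t.1 c.2.1 c.2.2), sel t.1 c.2.1, sel t.1 c.2.2) t.2 s
  rw [size_prod]
  unfold addTerm
  omega

@[fun_prop]
theorem PT.addEntry {c : α → (Bool × Bool) × List Bool × List Bool} {s : α → ℕ × ℕ × ℕ}
    {e : α → Entry} (hc : PT c) (hs : PT s) (he : PT e) :
    PT (fun a => addEntry (c a) (s a) (e a)) := by
  unfold StoquasticLH.addEntry
  fun_prop

attribute [irreducible] addEntry

@[fun_prop]
theorem PT.addTerm {c : α → (Bool × Bool) × List Bool × List Bool} {s : α → ℕ × ℕ × ℕ}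
    {t : α → TermData} (hc : PT c) (hs : PT s) (ht : PT t) :
    PT (fun a => addTerm (c a) (s a) (t a)) :=
  PT.foldl_of_measure_le (f := fun a => (t a).2) (g := s)
    (h := fun a => StoquasticLH.addEntry (((c a).1.1, (c a).1.2 && StoquasticLH.agree (t a).1
      (c a).2.1 (c a).2.2), StoquasticLH.sel (t a).1 (c a).2.1, StoquasticLH.sel (t a).1 (c a).2.2))
    (by fun_prop) hs (by fun_prop)
    (fun s => 12 * digits s + 5) 17 24 size_le_digits
    (fun s => by have := digits_le_size s; have := size_pos s; omega)
    (fun _ s e => (Nat.add_le_add_right (Nat.mul_le_mul_left 12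
      (digits_addEntry_le_size _ s e)) 5).trans (by omega))

attribute [irreducible] addTerm

@[fun_prop]
theorem PT.diag {f : α → Bool} {g h : α → List Bool} (hf : PT f) (hg : PT g) (hh : PT h) :
    PT (fun a => diag (f a) (g a) (h a)) := by
  unfold StoquasticLH.diag
  fun_prop

@[fun_prop]
theorem PT.weight {T : α → List TermData} {f : α → Bool} {g h : α → List Bool} (hT : PT T)
    (hf : PT f) (hg : PT g) (hh : PT h) : PT (fun a => weight (T a) (f a) (g a) (h a)) := by
  refine PT.foldl_of_measure_le (h := fun a => StoquasticLH.addTerm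
    ((StoquasticLH.diag (f a) (g a) (h a), f a), g a, h a)) hT (by fun_prop)
    (by fun_prop)
    (fun s => 12 * digits s + 5) 17 24 size_le_digits
    (fun s => by have := digits_le_size s; have := size_pos s; omega)
    (fun c s t => ?_)
  have := digits_addTerm_le_size ((StoquasticLH.diag (f c) (g c) (h c), f c), g c, h c) s t
  omega

attribute [irreducible] weight

@[fun_prop]
theorem PT.check {T : α → List TermData} {f : α → Bool} {g h w : α → List Bool} (hT : PT T)
    (hf : PT f) (hg : PT g) (hw : PT w) (hh : PT h) :
    PT (fun a => check (T a) (f a) (g a) (w a) (h a)) := by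
  unfold StoquasticLH.check
  fun_prop

attribute [irreducible] check

@[fun_prop]
theorem PT.walkStep {c : α → (Bool × List Bool) × List Unit × List TermData}
    {s : α → List Bool × List Bool × Bool} (hc : PT c) (hs : PT s) :
    PT (fun a => walkStep (c a) (s a)) := by
  unfold StoquasticLH.walkStep
  fun_prop

@[fun_prop]
theorem PT.walk {f : α → (Bool × List Bool) × List Unit × List TermData} {g : α → List Bool}
    (hf : PT f) (hg : PT g) : PT (fun a => walk (f a) (g a)) := by
  have hd : PT (fun a => (g a).drop (f a).1.2.length) := by fun_prop
  have ht : PT (fun a => (g a).take (f a).1.2.length) := by fun_prop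
  obtain ⟨q, hq⟩ := hg.exists_size_le
  have : PT (fun a => ((g a).drop (f a).1.2.length).foldl (fun s _ => StoquasticLH.walkStep (f a) s)
      ((g a).drop (f a).1.2.length, (g a).take (f a).1.2.length, true)) := by
    refine PT.foldl_measure (h := fun a s _ => StoquasticLH.walkStep (f a) s) hd (by fun_prop)
      (by fun_prop)
      (fun _ s => 2 * max (size s.1) (size s.2.1) + 5) (2 * q + 5) 0
      (fun c s => ?_) (fun c => ?_) (fun c s a _ => ?_)
    · have := size_bool_le s.2.2
      rw [size_prod, size_prod]
      omega
    · have h1 := size_suffix_le (List.drop_suffix (f c).1.2.length (g c))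
      have h2 := size_prefix_le (List.take_prefix (f c).1.2.length (g c))
      have h3 := hq c
      simp only [Polynomial.eval_add, Polynomial.eval_mul, Polynomial.eval_ofNat]
      omega
    · rw [Polynomial.eval_zero, add_zero]
      unfold StoquasticLH.walkStep
      cases s.1.isEmpty
      · have h1 := size_suffix_le (List.drop_suffix (f c).1.2.length s.1)
        have h2 := size_suffix_le (List.drop_suffix (f c).1.2.length (s.1.drop (f c).1.2.length))
        have h3 := size_prefix_le (List.take_prefix (f c).1.2.length (s.1.drop (f c).1.2.length))
        simp only [cond_false]
        omega
      · simp
  unfold StoquasticLH.walk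
  fun_prop

theorem inP_branchBit : InP branchBit := PT.inP (by unfold branchBit; fun_prop)

theorem inP_verify (k : ℕ) : InP (verify k) := PT.inP (by unfold verify; fun_prop)

end

end StoquasticLH

namespace StoquasticLH

/-! ### The description of a Hamiltonian is parsed correctly -/

/-- Sign, absolute value of the numerator and denominator of a rational number. -/
def ratData (q : ℚ) : Bool × ℕ × ℕ := (decide (q < 0), q.num.natAbs, q.den)

section terms

variable {k n : ℕ}

/-- The indicator string of the support. -/
def LocalTerm.ind (t : LocalTerm k n) : List Bool :=
  (List.finRange n).map fun i => decide (∃ j, t.site j = i)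

/-- The rows and columns of the matrices of interactions. -/
def indexPairs (k : ℕ) : List (Fin (2 ^ k) × Fin (2 ^ k)) :=
  (List.finRange (2 ^ k)).product (List.finRange (2 ^ k))

/-- The entry of the matrix of an interaction at a given position. -/
def LocalTerm.entry (t : LocalTerm k n) (rc : Fin (2 ^ k) × Fin (2 ^ k)) : Entry :=
  ((List.ofFn (bitsOf k rc.1), List.ofFn (bitsOf k rc.2)),
    ratData (t.re (bitsOf k rc.1) (bitsOf k rc.2)))

/-- An interaction as read by the parser. -/
def LocalTerm.data (t : LocalTerm k n) : TermData :=
  (t.ind, (indexPairs k).reverse.map t.entry)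

end terms

theorem natP_encNat (m : ℕ) (u : List Bool) : natP (encNat m ++ u) = (m, u) := by
  have := parseMany_encList (p := bitP) (c := ()) (enc := fun b : Bool => [b]) (g := id) m.bits
    (fun x _ u => rfl) u
  unfold natP encNat
  rw [this]
  simp

theorem ratP_encRat (q : ℚ) (u : List Bool) : ratP (encRat q ++ u) = (ratData q, u) := by
  unfold ratP encRat
  simp [natP_encNat, ratData]

theorem foldl_entryStep {k n : ℕ} (t : LocalTerm k n) (l : List (Fin (2 ^ k) × Fin (2 ^ k)))
    (acc : List Entry) (u : List Bool) :
    (l.map fun rc => (List.ofFn (bitsOf k rc.1), List.ofFn (bitsOf k rc.2))).foldl entryStep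
      (acc, (l.flatMap fun rc => encRat (t.re (bitsOf k rc.1) (bitsOf k rc.2)) ++
        encRat (t.im (bitsOf k rc.1) (bitsOf k rc.2))) ++ u) =
      (l.reverse.map t.entry ++ acc, u) := by
  induction l generalizing acc with
  | nil => rfl
  | cons rc l ih =>
    rw [List.map_cons, List.foldl_cons, List.flatMap_cons, List.append_assoc, List.append_assoc]
    simp only [entryStep, ratP_encRat]
    rw [ih]
    simp [LocalTerm.entry]

theorem encTerm_eq {k n : ℕ} (t : LocalTerm k n) : encTerm t = t.ind ++
    (indexPairs k).flatMap fun rc => encRat (t.re (bitsOf k rc.1) (bitsOf k rc.2)) ++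
      encRat (t.im (bitsOf k rc.1) (bitsOf k rc.2)) := by
  unfold encTerm indexPairs LocalTerm.ind List.product
  rw [List.flatMap_assoc, ← List.map_eq_flatMap]
  simp only [List.flatMap_map]

theorem termP_encTerm {k n : ℕ} (t : LocalTerm k n) (nl : List Unit) (hn : nl.length = n)
    (u : List Bool) : termP k nl (encTerm t ++ u) = (t.data, u) := by
  have hl : t.ind.length = nl.length := by simp [LocalTerm.ind, hn]
  have h1 : (encTerm t ++ u).take nl.length = t.ind := by
    rw [encTerm_eq, List.append_assoc, List.take_left' hl]
  have h2 : (encTerm t ++ u).drop nl.length = ((indexPairs k).flatMap fun rc =>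
      encRat (t.re (bitsOf k rc.1) (bitsOf k rc.2)) ++
        encRat (t.im (bitsOf k rc.1) (bitsOf k rc.2))) ++ u := by
    rw [encTerm_eq, List.append_assoc, List.drop_left' hl]
  have h3 := foldl_entryStep t (indexPairs k) [] u
  unfold termP entriesP
  rw [h1, h2]
  simp only [positions, LocalTerm.data] at *
  unfold indexPairs at *
  simp [h3]

theorem parse_encode {k : ℕ} (D : LocalHamiltonian k) :
    parse k (encode D) = (List.replicate D.n (), D.terms.reverse.map LocalTerm.data) := by
  have h1 : encode D = encList (fun _ : Unit => []) (List.replicate D.n ()) ++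
      (encList encTerm D.terms ++ []) := by
    simp [encode, encList, List.flatMap_replicate]
  have h2 := parseMany_encList (p := unitP) (c := ()) (enc := fun _ : Unit => []) (g := id)
    (List.replicate D.n ()) (fun x _ u => rfl) (encList encTerm D.terms ++ [])
  rw [List.map_id, List.reverse_replicate] at h2
  have h3 := parseMany_encList (p := termP k) (c := List.replicate D.n ()) (enc := encTerm)
    (g := LocalTerm.data) D.terms (fun t _ u => termP_encTerm t _ (by simp) u) []
  unfold parse
  rw [h1, h2, h3]
  simp

/-! ### The weights of transitions -/

section weights

variable {k n : ℕ}

theorem sel_map {ι : Type} (p x : ι → Bool) (l : List ι) :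
    sel (l.map p) (l.map x) = (l.filter p).map x := by
  have key : ∀ (l : List ι) (acc : List Bool),
      ((l.map p).foldl (fun (s : List Bool × List Bool) b =>
        (s.1.tail, bif b then s.1.headD false :: s.2 else s.2)) (l.map x, acc)).2 =
      ((l.filter p).map x).reverse ++ acc := by
    intro l
    induction l with
    | nil => intro acc; rfl
    | cons i l ih =>
      intro acc
      simp only [List.map_cons, List.foldl_cons, List.tail_cons, List.headD_cons]
      rw [ih]
      cases h : p i <;> simp [h]
  unfold sel
  rw [key, List.append_nil, List.reverse_reverse]

theorem agree_map {ι : Type} (p x y : ι → Bool) (l : List ι) :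
    agree (l.map p) (l.map x) (l.map y) = true ↔ ∀ i ∈ l, p i = false → x i = y i := by
  have key : ∀ (l : List ι) (ok : Bool),
      ((l.map p).foldl (fun (s : (List Bool × List Bool) × Bool) b =>
        ((s.1.1.tail, s.1.2.tail), s.2 && (b || !(s.1.1.headD false ^^ s.1.2.headD false))))
        ((l.map x, l.map y), ok)).2 = true ↔ ok = true ∧ ∀ i ∈ l, p i = false → x i = y i := by
    intro l
    induction l with
    | nil => simp
    | cons i l ih =>
      intro ok
      simp only [List.map_cons, List.foldl_cons, List.tail_cons, List.headD_cons]
      rw [ih]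
      cases h : p i <;> cases hx : x i <;> cases hy : y i <;> simp [h, hx, hy]
  unfold agree
  rw [key]
  simp

theorem filter_finRange_site (f : Fin k ↪o Fin n) :
    (List.finRange n).filter (fun i => decide (∃ j, f j = i)) = (List.finRange k).map f := by
  refine List.Perm.eq_of_pairwise (le := (· < ·)) (fun a b _ _ h1 h2 => absurd h1 h2.asymm)
    ((List.pairwise_lt_finRange n).filter _)
    (List.pairwise_map.2 ((List.pairwise_lt_finRange k).imp fun h => f.strictMono h)) ?_
  refine (List.perm_ext_iff_of_nodup ((List.nodup_finRange n).filter _)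
    ((List.nodup_finRange k).map f.injective)).2 fun i => ?_
  simp

theorem LocalTerm.sel_ind (t : LocalTerm k n) (x : Fin n → Bool) :
    sel t.ind (List.ofFn x) = List.ofFn (x ∘ t.site) := by
  rw [LocalTerm.ind, List.ofFn_eq_map, sel_map, filter_finRange_site, List.ofFn_eq_map,
    List.map_map]

theorem LocalTerm.agree_ind (t : LocalTerm k n) (x y : Fin n → Bool) :
    agree t.ind (List.ofFn x) (List.ofFn y) = true ↔
      ∀ i : Fin n, (∀ j, t.site j ≠ i) → x i = y i := by
  rw [LocalTerm.ind, List.ofFn_eq_map, List.ofFn_eq_map, agree_map]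
  simp

/-- The rational number represented by an accumulator. -/
noncomputable def quot (s : ℕ × ℕ × ℕ) : ℝ := ((s.1 : ℝ) - s.2.1) / s.2.2

theorem ratData_eq (q : ℚ) : ((ratData q).2.1 : ℝ) / (ratData q).2.2 = |(q : ℝ)| ∧
    (q : ℝ) = (bif (ratData q).1 then -1 else 1) * (((ratData q).2.1 : ℝ) / (ratData q).2.2) := by
  have h : ((ratData q).2.1 : ℝ) / (ratData q).2.2 = |(q : ℝ)| := by
    have h1 : |q| = (q.num.natAbs : ℚ) / q.den := by
      conv_lhs => rw [← Rat.num_div_den q]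
      rw [abs_div, Nat.abs_cast, Nat.cast_natAbs, Int.cast_abs]
    have h2 := congrArg (fun r : ℚ => (r : ℝ)) h1
    push_cast at h2
    rw [h2]
    simp [ratData]
  refine ⟨h, ?_⟩
  rw [h]
  by_cases hq : q < 0
  · have : (q : ℝ) < 0 := by exact_mod_cast hq
    simp [ratData, hq, abs_of_neg this]
  · have : (0 : ℝ) ≤ q := by exact_mod_cast not_lt.1 hq
    simp [ratData, hq, abs_of_nonneg this]

theorem quot_addEntry (c : (Bool × Bool) × List Bool × List Bool) (s : ℕ × ℕ × ℕ)
    (hs : 0 < s.2.2) (p : List Bool × List Bool) (q : ℚ) :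
    0 < (addEntry c s (p, ratData q)).2.2 ∧ quot (addEntry c s (p, ratData q)) =
      quot s + ((if c.1.1 = true then |(q : ℝ)| else 0) -
        if c.1.2 = true ∧ p = c.2 then (q : ℝ) else 0) := by
  obtain ⟨h1, h2⟩ := ratData_eq q
  have hb : 0 < (ratData q).2.2 := q.den_pos
  have hb' : ((ratData q).2.2 : ℝ) ≠ 0 := by positivity
  have hs' : (s.2.2 : ℝ) ≠ 0 := by positivity
  generalize ratData q = e at *
  obtain ⟨sg, a, b⟩ := e
  have hm : (c.1.2 && (p.1 == c.2.1 && p.2 == c.2.2)) = decide (c.1.2 = true ∧ p = c.2) := by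
    rw [Bool.eq_iff_iff]
    simp [Prod.ext_iff]
  unfold addEntry
  simp only [hm]
  refine ⟨Nat.mul_pos hs hb, ?_⟩
  rw [← h1, h2]
  simp only at hb' ⊢
  by_cases hc : c.1.1 = true <;> by_cases hd : c.1.2 = true ∧ p = c.2 <;> cases sg <;>
    simp only [quot, hc, hd] <;> simp <;> field_simp <;> ring

theorem foldl_quot {α : Type} (step : ℕ × ℕ × ℕ → α → ℕ × ℕ × ℕ) (f : α → ℝ)
    (h : ∀ s a, 0 < s.2.2 → 0 < (step s a).2.2 ∧ quot (step s a) = quot s + f a) (l : List α)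
    (s : ℕ × ℕ × ℕ) (hs : 0 < s.2.2) :
    0 < (l.foldl step s).2.2 ∧ quot (l.foldl step s) = quot s + (l.map f).sum := by
  induction l generalizing s with
  | nil => simpa using hs
  | cons a l ih =>
    obtain ⟨h1, h2⟩ := h s a hs
    obtain ⟨h3, h4⟩ := ih _ h1
    refine ⟨h3, ?_⟩
    rw [List.foldl_cons, h4, h2, List.map_cons, List.sum_cons, add_assoc]

theorem sum_indexPairs (f : (Fin k → Bool) → (Fin k → Bool) → ℝ) :
    ((indexPairs k).map fun rc => f (bitsOf k rc.1) (bitsOf k rc.2)).sum = ∑ a, ∑ b, f a b := by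
  have hbij : Function.Bijective (bitsOf k) :=
    (Fintype.bijective_iff_surjective_and_card _).2 ⟨bitsOf_surjective k, by simp⟩
  have h1 : ∀ (l l' : List (Fin (2 ^ k))) (g : Fin (2 ^ k) × Fin (2 ^ k) → ℝ),
      ((l.product l').map g).sum = (l.map fun r => (l'.map fun c => g (r, c)).sum).sum := by
    intro l l' g
    induction l with
    | nil => rfl
    | cons r l ih =>
      rw [show (r :: l).product l' = l'.map (fun c => (r, c)) ++ l.product l' from rfl,
        List.map_append, List.sum_append, ih, List.map_cons, List.sum_cons,
        List.map_map]
      rfl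
  rw [indexPairs, h1]
  simp only [← Fin.sum_univ_def]
  rw [hbij.sum_comp (fun a => ∑ c, f a (bitsOf k c))]
  exact Finset.sum_congr rfl fun a _ => hbij.sum_comp (fun b => f a b)

/-- The sum of the absolute values of the real parts of the matrix entries. -/
noncomputable def LocalTerm.absSum (t : LocalTerm k n) : ℝ := ∑ a, ∑ b, |(t.re a b : ℝ)|

theorem quot_addTerm (dg fl : Bool) (x y : Fin n → Bool) (s : ℕ × ℕ × ℕ) (t : LocalTerm k n)
    (hs : 0 < s.2.2) :
    0 < (addTerm ((dg, fl), List.ofFn x, List.ofFn y) s t.data).2.2 ∧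
      quot (addTerm ((dg, fl), List.ofFn x, List.ofFn y) s t.data) = quot s +
        ((if dg = true then t.absSum else 0) - if fl = true then (t.op x y).re else 0) := by
  set m := fl && agree t.ind (List.ofFn x) (List.ofFn y) with hm
  have h := foldl_quot (fun s rc => addEntry ((dg, m), sel t.ind (List.ofFn x),
      sel t.ind (List.ofFn y)) s (t.entry rc)) _ (fun s rc hs =>
    quot_addEntry ((dg, m), sel t.ind (List.ofFn x), sel t.ind (List.ofFn y)) s hs
      (List.ofFn (bitsOf k rc.1), List.ofFn (bitsOf k rc.2)) _) (indexPairs k).reverse s hs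
  unfold addTerm
  simp only [LocalTerm.data, List.foldl_map, ← hm]
  refine ⟨h.1, h.2.trans ?_⟩
  congr 1
  rw [List.map_reverse, List.sum_reverse]
  have e := sum_indexPairs (k := k) fun a b => (if dg = true then |(t.re a b : ℝ)| else 0) -
    if m = true ∧ (List.ofFn a, List.ofFn b) = (sel t.ind (List.ofFn x), sel t.ind (List.ofFn y))
      then (t.re a b : ℝ) else 0
  refine e.trans ?_
  simp only [Finset.sum_sub_distrib]
  congr 1
  · unfold LocalTerm.absSum
    cases dg <;> simp
  · simp only [LocalTerm.sel_ind, Prod.mk.injEq, List.ofFn_inj]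
    have hm' : m = true ↔ fl = true ∧ ∀ i : Fin n, (∀ j, t.site j ≠ i) → x i = y i := by
      rw [hm, Bool.and_eq_true, LocalTerm.agree_ind]
    by_cases h1 : fl = true
    · by_cases h2 : ∀ i : Fin n, (∀ j, t.site j ≠ i) → x i = y i
      · have hmt : m = true := hm'.2 ⟨h1, h2⟩
        simp only [hmt, true_and, h1, if_true, LocalTerm.op, Matrix.of_apply, if_pos h2,
          LocalTerm.mat, ite_and]
        simp
      · have hmt : ¬ m = true := fun hc => h2 (hm'.1 hc).2
        simp [hmt, h1, LocalTerm.op, if_neg h2]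
    · have hmt : ¬ m = true := fun hc => h1 (hm'.1 hc).1
      simp [hmt, h1]

end weights

end StoquasticLH

namespace StoquasticLH

theorem addEntry_den (c s e) : (addEntry c s e).2.2 = s.2.2 * e.2.2.2 := by unfold addEntry; rfl

/-- The product of all denominators. -/
def denom (T : List TermData) : ℕ := (T.map fun t => (t.2.map fun e => e.2.2.2).prod).prod

theorem addTerm_den (c s t) :
    (addTerm c s t).2.2 = s.2.2 * (t.2.map fun e => e.2.2.2).prod := by
  have key : ∀ (c) (l : List Entry) (s), (l.foldl (addEntry c) s).2.2 =
      s.2.2 * (l.map fun e => e.2.2.2).prod := by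
    intro c l
    induction l with
    | nil => simp
    | cons e l ih => intro s; rw [List.foldl_cons, ih, addEntry_den]; simp [mul_assoc]
  unfold addTerm
  exact key _ _ _

theorem weight_den (T : List TermData) (fl : Bool) (x y : List Bool) :
    (weight T fl x y).2.2 = denom T := by
  have key : ∀ (c) (T : List TermData) (s), (T.foldl (addTerm c) s).2.2 = s.2.2 * denom T := by
    intro c T
    induction T with
    | nil => simp [denom]
    | cons t T ih => intro s; rw [List.foldl_cons, ih, addTerm_den]; simp [denom, mul_assoc]
  unfold weight
  rw [key]
  simp

theorem digits_addTerm_le {k n : ℕ} (c) (s : ℕ × ℕ × ℕ) (t : LocalTerm k n) :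
    digits (addTerm c s t.data) ≤ digits s + (encTerm t).length := by
  have hq : ∀ q : ℚ, (ratData q).2.1.size + (ratData q).2.2.size + 2 ≤ (encRat q).length := by
    intro q
    have h : ∀ l : List Bool, (encList (fun b => [b]) l).length = 2 * l.length + 1 := by
      intro l
      induction l with
      | nil => rfl
      | cons b l ih => simp [encList] at *; omega
    simp only [encRat, encNat, List.length_cons, List.length_append, h, length_bits, ratData]
    omega
  have key : ∀ (c) (l : List (Fin (2 ^ k) × Fin (2 ^ k))) (s),
      digits ((l.map t.entry).foldl (addEntry c) s) ≤ digits s +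
        (l.flatMap fun rc => encRat (t.re (bitsOf k rc.1) (bitsOf k rc.2)) ++
          encRat (t.im (bitsOf k rc.1) (bitsOf k rc.2))).length := by
    intro c l
    induction l with
    | nil => simp
    | cons rc l ih =>
      intro s
      have h1 := ih (addEntry c s (t.entry rc))
      have h2 := digits_addEntry_le c s (t.entry rc)
      have h3 := hq (t.re (bitsOf k rc.1) (bitsOf k rc.2))
      rw [List.map_cons, List.foldl_cons, List.flatMap_cons, List.length_append,
        List.length_append]
      simp only [LocalTerm.entry] at h1 h2 ⊢
      omega
  have hlen : ∀ (l : List (Fin (2 ^ k) × Fin (2 ^ k))) (f : _ → List Bool),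
      (l.reverse.flatMap f).length = (l.flatMap f).length := by
    intro l f
    simp [List.length_flatMap]
  have h := key ((c.1.1, c.1.2 && agree t.ind c.2.1 c.2.2), sel t.ind c.2.1, sel t.ind c.2.2)
    (indexPairs k).reverse s
  rw [hlen] at h
  rw [encTerm_eq, List.length_append]
  unfold addTerm
  simp only [LocalTerm.data]
  omega

namespace LocalHamiltonian

variable {k : ℕ} (D : LocalHamiltonian k)

/-- The interactions as read by the parser. -/
def data : List TermData := D.terms.reverse.map LocalTerm.data

/-- A bound on the norm of the Hamiltonian. -/
noncomputable def shift : ℝ := 1 + (D.terms.map LocalTerm.absSum).sum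

/-- The matrix of weights: the shifted negative of the Hamiltonian in the main branch, a matrix
with a single non-zero entry in the reference branch. -/
noncomputable def weights : Bool → Matrix (Fin D.n → Bool) (Fin D.n → Bool) ℝ
  | true => Matrix.of fun x y => (if x = y then D.shift else 0) - (D.matrix x y).re
  | false => Matrix.of fun x y =>
      if x = (fun _ => false) ∧ y = (fun _ => false) then D.shift else 0

theorem matrix_re (x y : Fin D.n → Bool) :
    (D.matrix x y).re = (D.terms.map fun t => (t.op x y).re).sum := by
  unfold LocalHamiltonian.matrix
  induction D.terms with
  | nil => simp
  | cons t l ih => simp [ih]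

theorem weight_den_pos (fl : Bool) (x y : Fin D.n → Bool) :
    0 < denom D.data ∧ quot (weight D.data fl (List.ofFn x) (List.ofFn y)) =
      (if diag fl (List.ofFn x) (List.ofFn y) = true then D.shift else 0) -
        if fl = true then (D.matrix x y).re else 0 := by
  set dg := diag fl (List.ofFn x) (List.ofFn y) with hdg
  have h := foldl_quot (fun s (t : LocalTerm k D.n) =>
    addTerm ((dg, fl), List.ofFn x, List.ofFn y) s t.data) _
    (fun s t hs => quot_addTerm dg fl x y s t hs) D.terms.reverse
    (bif dg then 1 else 0, 0, 1) Nat.one_pos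
  have hw : weight D.data fl (List.ofFn x) (List.ofFn y) =
      D.terms.reverse.foldl (fun s t => addTerm ((dg, fl), List.ofFn x, List.ofFn y) s t.data)
        (bif dg then 1 else 0, 0, 1) := by
    unfold weight
    rw [data, List.foldl_map]
  rw [← weight_den D.data fl (List.ofFn x) (List.ofFn y), hw]
  refine ⟨h.1, h.2.trans ?_⟩
  have hsub : ∀ (l : List (LocalTerm k D.n)) (f g : LocalTerm k D.n → ℝ),
      (l.map fun t => f t - g t).sum = (l.map f).sum - (l.map g).sum := by
    intro l f g
    induction l with
    | nil => simp
    | cons t l ih => simp only [List.map_cons, List.sum_cons, ih]; ring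
  rw [List.map_reverse, List.sum_reverse, matrix_re, hsub]
  unfold shift
  cases dg <;> cases fl <;> simp [quot, add_sub_assoc]

theorem val_ofFn_eq_zero {n : ℕ} (x : Fin n → Bool) :
    val (List.ofFn x) = 0 ↔ x = fun _ => false := by
  have : ∀ l : List Bool, val l = 0 ↔ ∀ b ∈ l, b = false := by
    intro l
    induction l with
    | nil => simp
    | cons b l ih => cases b <;> simp [ih, Nat.bit_val]
  rw [this, List.forall_mem_ofFn_iff, funext_iff]

/-- The weights that the verifier computes. -/
theorem weight_sub (fl : Bool) (x y : Fin D.n → Bool) :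
    ((weight D.data fl (List.ofFn x) (List.ofFn y)).1 : ℝ) -
      (weight D.data fl (List.ofFn x) (List.ofFn y)).2.1 = denom D.data * D.weights fl x y := by
  obtain ⟨h0, h⟩ := D.weight_den_pos fl x y
  have h0' : (denom D.data : ℝ) ≠ 0 := by positivity
  rw [quot, weight_den, div_eq_iff h0'] at h
  rw [h, mul_comm]
  congr 1
  cases fl
  · have : diag false (List.ofFn x) (List.ofFn y) = true ↔
        x = (fun _ => false) ∧ y = fun _ => false := by
      rw [← val_ofFn_eq_zero, ← val_ofFn_eq_zero]
      simp [diag]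
    simp only [this, weights, Matrix.of_apply]
    simp
  · have : diag true (List.ofFn x) (List.ofFn y) = true ↔ x = y := by
      simp [diag, List.ofFn_inj]
    simp only [this, weights, Matrix.of_apply]
    simp

theorem weight_lt (fl : Bool) (x y : List Bool) :
    (weight D.data fl x y).1 < 2 ^ (encode D).length := by
  have key : ∀ (c) (l : List (LocalTerm k D.n)) (s),
      digits ((l.map LocalTerm.data).foldl (addTerm c) s) ≤
        digits s + (l.flatMap fun t => true :: encTerm t).length := by
    intro c l
    induction l with
    | nil => simp
    | cons t l ih =>
      intro s
      have h1 := ih (addTerm c s t.data)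
      have h2 := digits_addTerm_le c s t
      rw [List.map_cons, List.foldl_cons, List.flatMap_cons, List.length_append,
        List.length_cons]
      omega
  have h := key ((diag fl x y, fl), x, y) D.terms.reverse (bif diag fl x y then 1 else 0, 0, 1)
  have hlen : ∀ (l : List (LocalTerm k D.n)) (f : _ → List Bool),
      (l.reverse.flatMap f).length = (l.flatMap f).length := by
    intro l f
    simp [List.length_flatMap]
  have hd : digits ((bif diag fl x y then 1 else 0, 0, 1) : ℕ × ℕ × ℕ) = 1 := by
    cases diag fl x y <;> simp [digits]
  rw [hlen, hd] at h
  rw [← Nat.size_le]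
  have h2 : (weight D.data fl x y).1.size ≤ digits (weight D.data fl x y) := le_max_left _ _
  refine h2.trans ?_
  unfold weight
  refine h.trans ?_
  simp only [encode, encList, List.length_append, List.length_singleton]
  omega

theorem absSum_nonneg {n : ℕ} (t : LocalTerm k n) : 0 ≤ t.absSum :=
  Finset.sum_nonneg fun _ _ => Finset.sum_nonneg fun _ _ => abs_nonneg _

theorem sum_absSum_nonneg : 0 ≤ (D.terms.map LocalTerm.absSum).sum :=
  List.sum_nonneg fun r hr => by
    obtain ⟨t, -, rfl⟩ := List.mem_map.1 hr
    exact absSum_nonneg t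

theorem shift_pos : 0 < D.shift := by
  have := D.sum_absSum_nonneg
  unfold shift
  linarith

theorem sum_abs_op_re_le {n : ℕ} (t : LocalTerm k n) (x : Fin n → Bool) :
    ∑ y, |(t.op x y).re| ≤ t.absSum := by
  classical
  have h1 : ∑ y, |(t.op x y).re| =
      ∑ y ∈ Finset.univ.filter (fun y : Fin n → Bool => ∀ i : Fin n, (∀ j, t.site j ≠ i) → x i = y i),
        |(t.re (x ∘ t.site) (y ∘ t.site) : ℝ)| := by
    rw [Finset.sum_filter]
    refine Finset.sum_congr rfl fun y _ => ?_
    by_cases h : ∀ i : Fin n, (∀ j, t.site j ≠ i) → x i = y i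
    · simp only [LocalTerm.op, LocalTerm.mat, Matrix.of_apply, if_pos h]
    · simp only [LocalTerm.op, Matrix.of_apply, if_neg h, Complex.zero_re, abs_zero]
  rw [h1]
  have hinj : Set.InjOn (fun y : Fin n → Bool => y ∘ t.site) (Finset.univ.filter
      (fun y : Fin n → Bool => ∀ i : Fin n, (∀ j, t.site j ≠ i) → x i = y i) : Finset _) := by
    intro y hy z hz hyz
    simp only [Finset.coe_filter, Finset.mem_univ, true_and, Set.mem_ofPred_eq] at hy hz
    funext i
    by_cases hi : ∀ j, t.site j ≠ i
    · rw [← hy i hi, ← hz i hi]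
    · push Not at hi
      obtain ⟨j, rfl⟩ := hi
      exact congrFun hyz j
  rw [← Finset.sum_image (f := fun b => |(t.re (x ∘ t.site) b : ℝ)|) hinj]
  calc _ ≤ ∑ b, |(t.re (x ∘ t.site) b : ℝ)| :=
        Finset.sum_le_sum_of_subset_of_nonneg (Finset.subset_univ _) fun _ _ _ => abs_nonneg _
    _ ≤ t.absSum := Finset.single_le_sum (f := fun a => ∑ b, |(t.re a b : ℝ)|)
        (fun _ _ => Finset.sum_nonneg fun _ _ => abs_nonneg _) (Finset.mem_univ _)

theorem sum_abs_re_le (x : Fin D.n → Bool) : ∑ y, |(D.matrix x y).re| ≤ D.shift - 1 := by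
  have : ∀ l : List (LocalTerm k D.n), ∑ y, |(l.map fun t => (t.op x y).re).sum| ≤
      (l.map LocalTerm.absSum).sum := by
    intro l
    induction l with
    | nil => simp
    | cons t l ih =>
      simp only [List.map_cons, List.sum_cons]
      refine (Finset.sum_le_sum fun y _ => abs_add_le _ _).trans ?_
      rw [Finset.sum_add_distrib]
      exact add_le_add (sum_abs_op_re_le t x) ih
  simpa only [matrix_re, shift, add_sub_cancel_left] using this D.terms

theorem weights_nonneg (hD : D.IsStoquastic) (fl : Bool) (x y : Fin D.n → Bool) :
    0 ≤ D.weights fl x y := by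
  have hs := D.shift_pos
  cases fl
  · simp only [weights, Matrix.of_apply]
    split_ifs <;> linarith
  · simp only [weights, Matrix.of_apply]
    by_cases h : x = y
    · have h1 := Finset.single_le_sum (f := fun y => |(D.matrix x y).re|)
        (fun _ _ => abs_nonneg _) (Finset.mem_univ y)
      have h2 := D.sum_abs_re_le x
      have h3 := le_abs_self (D.matrix x y).re
      rw [if_pos h]
      linarith
    · have := (hD x y h).2
      rw [if_neg h]
      linarith

end LocalHamiltonian

end StoquasticLH

namespace StoquasticLH

/-! ### Sums over bit strings -/

/-- The sum of `F` over all bit strings of length `m`. -/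
noncomputable def sumL (m : ℕ) (F : List Bool → ℝ) : ℝ := ∑ y : Fin m → Bool, F (List.ofFn y)

theorem sumL_congr {m : ℕ} {F G : List Bool → ℝ} (h : ∀ u, u.length = m → F u = G u) :
    sumL m F = sumL m G := Finset.sum_congr rfl fun _ _ => h _ List.length_ofFn

theorem sumL_add (a b : ℕ) (F : List Bool → ℝ) :
    sumL (a + b) F = sumL a fun u => sumL b fun v => F (u ++ v) := by
  unfold sumL
  rw [← (Fin.appendEquiv a b).sum_comp, Fintype.sum_prod_type]
  simp [Fin.appendEquiv, List.ofFn_fin_append]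

theorem sumL_one (F : List Bool → ℝ) : sumL 1 F = F [true] + F [false] := by
  unfold sumL
  rw [← (Equiv.funUnique (Fin 1) Bool).symm.sum_comp, Fintype.sum_bool]
  simp

theorem sumL_zero (F : List Bool → ℝ) : sumL 0 F = F [] := by
  unfold sumL
  simp

theorem sumL_succ (m : ℕ) (F : List Bool → ℝ) : sumL (1 + m) F =
    sumL m (fun v => F (true :: v)) + sumL m fun v => F (false :: v) := by
  rw [sumL_add, sumL_one]
  rfl

theorem sumL_const (m : ℕ) (c : ℝ) : sumL m (fun _ => c) = 2 ^ m * c := by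
  simp [sumL]

theorem mul_sumL (m : ℕ) (c : ℝ) (F : List Bool → ℝ) :
    c * sumL m F = sumL m fun u => c * F u := Finset.mul_sum _ _ _

theorem prob_eq_sumL (m : ℕ) (E : List Bool → Bool) :
    prob m E = sumL m (fun y => if E y = true then 1 else 0) / 2 ^ m := by
  rw [prob, sumL, Finset.sum_boole]

theorem val_bitsOf (s : ℕ) : ∀ r : ℕ, val (List.ofFn fun j : Fin s => r.testBit j) = r % 2 ^ s := by
  induction s with
  | zero => intro r; simp [Nat.mod_one]
  | succ s ih =>
    intro r
    have h := ih (r / 2)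
    simp only [Nat.testBit_div_two] at h
    rw [List.ofFn_succ, val_cons]
    simp only [Fin.val_zero, Fin.val_succ, h, Nat.bit_val, Nat.testBit_zero]
    rw [pow_succ, mul_comm (2 ^ s), Nat.mod_mul]
    have : (decide (r % 2 = 1)).toNat = r % 2 := by
      rcases Nat.mod_two_eq_zero_or_one r with h | h <;> simp [h]
    omega

theorem sumL_lt {s d : ℕ} (h : d ≤ 2 ^ s) :
    sumL s (fun w => if val w < d then 1 else 0) = d := by
  have hbij : Function.Bijective (bitsOf s) :=
    (Fintype.bijective_iff_surjective_and_card _).2 ⟨bitsOf_surjective s, by simp⟩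
  have h1 : ∀ r : Fin (2 ^ s), val (List.ofFn (bitsOf s r)) = r := fun r =>
    (val_bitsOf s r).trans (Nat.mod_eq_of_lt r.isLt)
  unfold sumL
  rw [← hbij.sum_comp]
  simp only [h1]
  rw [Fin.sum_univ_eq_sum_range (fun i => if i < d then (1 : ℝ) else 0), Finset.sum_boole]
  congr 1
  refine (congrArg Finset.card (?_ : _ = Finset.range d)).trans (Finset.card_range d)
  ext i
  simp only [Finset.mem_filter, Finset.mem_range]
  omega

/-! ### Counting walks -/

/-- Whether `v` describes a walk of the given length from `cur`, with blocks of length `s`. -/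
def isWalk (c : (Bool × List Bool) × List Unit × List TermData) : ℕ → List Bool → List Bool → Bool
  | 0, _, _ => true
  | L + 1, cur, v =>
    check c.2.2 c.1.1 (cur.take c.2.1.length) (v.take c.1.2.length)
        (((v.drop c.1.2.length).take c.1.2.length).take c.2.1.length) &&
      isWalk c L ((v.drop c.1.2.length).take c.1.2.length)
        ((v.drop c.1.2.length).drop c.1.2.length)

theorem foldl_walkStep {c : (Bool × List Bool) × List Unit × List TermData}
    (hc : 0 < c.1.2.length) (L : ℕ) (fuel : List Bool) (hf : L ≤ fuel.length) (v cur : List Bool)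
    (ok : Bool) (hv : v.length = L * (c.1.2.length + c.1.2.length)) :
    (fuel.foldl (fun s _ => walkStep c s) (v, cur, ok)).2.2 = (ok && isWalk c L cur v) := by
  induction L generalizing fuel v cur ok with
  | zero =>
    have hv' : v = [] := by simpa using hv
    subst hv'
    have : ∀ fuel : List Bool, fuel.foldl (fun s _ => walkStep c s) ([], cur, ok) =
        ([], cur, ok) := by
      intro fuel
      induction fuel with
      | nil => rfl
      | cons b fuel ih => exact ih
    simp [this, isWalk]
  | succ L ih =>
    obtain ⟨b, fuel, rfl⟩ := List.exists_cons_of_length_pos (Nat.zero_lt_of_lt hf)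
    have hne : v.isEmpty = false := by
      rw [List.isEmpty_eq_false_iff, ← List.length_pos_iff, hv]
      positivity
    rw [List.foldl_cons, show walkStep c (v, cur, ok) = _ by
      unfold walkStep; simp only [hne, cond_false]; rfl]
    rw [ih fuel (by simpa using hf)]
    · simp [isWalk, Bool.and_assoc]
    · simp only [List.length_drop, hv, add_mul]
      omega

theorem walk_append {c : (Bool × List Bool) × List Unit × List TermData}
    (hc : 0 < c.1.2.length) (L : ℕ) (u v : List Bool) (hu : u.length = c.1.2.length)
    (hv : v.length = L * (c.1.2.length + c.1.2.length)) :
    walk c (u ++ v) = isWalk c L u v := by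
  unfold walk
  rw [List.drop_left' hu, List.take_left' hu, foldl_walkStep hc L v ?_ v u true hv]
  · simp
  · rw [hv]; exact Nat.le_mul_of_pos_right L (by omega)

namespace LocalHamiltonian

variable {k : ℕ} (D : LocalHamiltonian k)

/-- The parameters of the verifier. -/
def params (fl : Bool) : (Bool × List Bool) × List Unit × List TermData :=
  ((fl, encode D), List.replicate D.n (), D.data)

theorem n_lt_length_encode : D.n < (encode D).length := by
  simp [encode]

/-- The number of random strings by which the transition from `x` to `y` is accepted. -/
theorem sumL_check (hD : D.IsStoquastic) (fl : Bool) (x y : Fin D.n → Bool) :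
    sumL (encode D).length (fun w =>
      if check D.data fl (List.ofFn x) w (List.ofFn y) = true then 1 else 0) =
      denom D.data * D.weights fl x y := by
  set W := weight D.data fl (List.ofFn x) (List.ofFn y) with hW
  have h1 := D.weight_sub fl x y
  have h2 := D.weight_lt fl (List.ofFn x) (List.ofFn y)
  have h3 : (0 : ℝ) ≤ denom D.data * D.weights fl x y :=
    mul_nonneg (Nat.cast_nonneg _) (D.weights_nonneg hD fl x y)
  rw [← hW] at h1 h2
  rw [← h1] at h3 ⊢
  have h4 : W.2.1 ≤ W.1 := by
    have : (W.2.1 : ℝ) ≤ W.1 := by linarith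
    exact_mod_cast this
  rw [← Nat.cast_sub h4, ← sumL_lt (s := (encode D).length) (d := W.1 - W.2.1) (by omega)]
  congr 1
  funext w
  unfold check
  rw [← hW]
  congr 1
  rw [decide_eq_true_eq, eq_iff_iff]
  omega

/-- The number of walks of length `L` from `cur`. -/
theorem sumL_isWalk (hD : D.IsStoquastic) (fl : Bool) (L : ℕ) (cur : List Bool)
    (x : Fin D.n → Bool) (hcur : cur.take D.n = List.ofFn x) :
    sumL (L * ((encode D).length + (encode D).length)) (fun v =>
      if isWalk (D.params fl) L cur v = true then 1 else 0) =
      (2 ^ ((encode D).length - D.n) * denom D.data) ^ L *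
        ((D.weights fl ^ L).mulVec 1) x := by
  set s := (encode D).length with hs
  obtain ⟨pad, hpad⟩ := Nat.exists_eq_add_of_lt D.n_lt_length_encode
  have hpad' : s = D.n + (pad + 1) := by omega
  induction L generalizing cur x with
  | zero => simp [isWalk, sumL_zero]
  | succ L ih =>
    have hsplit : ∀ (w u v : List Bool), w.length = s → u.length = s →
        (if isWalk (D.params fl) (L + 1) cur (w ++ (u ++ v)) = true then (1 : ℝ) else 0) =
          (if check D.data fl (List.ofFn x) w (u.take D.n) = true then 1 else 0) *
            if isWalk (D.params fl) L u v = true then 1 else 0 := by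
      intro w u v hw hu
      simp only [isWalk, params, List.length_replicate, hcur, List.take_left' hw,
        List.drop_left' hw, List.take_left' hu, List.drop_left' hu, Bool.and_eq_true, ite_and, ← hs]
      by_cases h1 : check D.data fl (List.ofFn x) w (u.take D.n) = true
      · simp [h1]
        rfl
      · simp [h1]
    rw [show (L + 1) * (s + s) = s + (s + L * (s + s)) by ring, sumL_add]
    have h1 : ∀ w : List Bool, w.length = s → (sumL (s + L * (s + s)) fun v =>
        if isWalk (D.params fl) (L + 1) cur (w ++ v) = true then (1 : ℝ) else 0) =
        sumL (D.n + (pad + 1)) fun u =>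
          (if check D.data fl (List.ofFn x) w (u.take D.n) = true then 1 else 0) *
            sumL (L * (s + s)) fun v => if isWalk (D.params fl) L u v = true then 1 else 0 := by
      intro w hw
      rw [sumL_add, ← hpad']
      refine sumL_congr fun u hu => ?_
      rw [mul_sumL]
      exact sumL_congr fun v _ => hsplit w u v hw hu
    rw [sumL_congr h1]
    have h2 : ∀ w : List Bool, (sumL (D.n + (pad + 1)) fun u =>
          (if check D.data fl (List.ofFn x) w (u.take D.n) = true then (1 : ℝ) else 0) *
            sumL (L * (s + s)) fun v => if isWalk (D.params fl) L u v = true then 1 else 0) =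
        ∑ y : Fin D.n → Bool, 2 ^ (pad + 1) *
          ((if check D.data fl (List.ofFn x) w (List.ofFn y) = true then 1 else 0) *
          ((2 ^ (s - D.n) * denom D.data) ^ L * ((D.weights fl ^ L).mulVec 1) y)) := by
      intro w
      rw [sumL_add]
      refine Finset.sum_congr rfl fun y _ => ?_
      rw [← sumL_const]
      refine sumL_congr fun u _ => ?_
      have ht : (List.ofFn y ++ u).take D.n = List.ofFn y := List.take_left' List.length_ofFn
      rw [ht, ih _ y ht]
    simp only [h2]
    unfold sumL
    rw [Finset.sum_comm]
    have h3 : ∀ y : Fin D.n → Bool, sumL s (fun w =>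
        if check D.data fl (List.ofFn x) w (List.ofFn y) = true then 1 else 0) =
        denom D.data * D.weights fl x y := D.sumL_check hD fl x
    unfold sumL at h3
    simp only [← Finset.mul_sum, ← Finset.sum_mul]
    simp only [h3]
    rw [pow_succ' (D.weights fl), ← Matrix.mulVec_mulVec]
    rw [show ((D.weights fl).mulVec ((D.weights fl ^ L).mulVec 1)) x =
      ∑ y, D.weights fl x y * ((D.weights fl ^ L).mulVec 1) y from rfl, Finset.mul_sum,
      Finset.mul_sum]
    refine Finset.sum_congr rfl fun y _ => ?_
    rw [show s - D.n = pad + 1 by omega]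
    ring

/-- The number of walks of length `L`. -/
theorem sumL_walk (hD : D.IsStoquastic) (fl : Bool) (L : ℕ) :
    sumL ((encode D).length + L * ((encode D).length + (encode D).length)) (fun v =>
      if walk (D.params fl) v = true then 1 else 0) =
      2 ^ ((encode D).length - D.n) * (2 ^ ((encode D).length - D.n) * denom D.data) ^ L *
        ∑ x, ((D.weights fl ^ L).mulVec 1) x := by
  set s := (encode D).length with hs
  have hn : D.n < s := D.n_lt_length_encode
  rw [sumL_add]
  have h1 : ∀ u : List Bool, u.length = s → (sumL (L * (s + s)) fun v =>
      if walk (D.params fl) (u ++ v) = true then (1 : ℝ) else 0) =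
      sumL (L * (s + s)) fun v => if isWalk (D.params fl) L u v = true then 1 else 0 := by
    intro u hu
    refine sumL_congr fun v hv => ?_
    rw [walk_append (c := D.params fl) (hs ▸ Nat.zero_lt_of_lt hn) L u v hu hv]
  rw [sumL_congr h1]
  have h2 : sumL s (fun u => sumL (L * (s + s)) fun v =>
      if isWalk (D.params fl) L u v = true then (1 : ℝ) else 0) =
      sumL (D.n + (s - D.n)) (fun u => sumL (L * (s + s)) fun v =>
      if isWalk (D.params fl) L u v = true then (1 : ℝ) else 0) := by
    rw [Nat.add_sub_cancel' hn.le]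
  rw [h2, sumL_add, Finset.mul_sum]
  refine Finset.sum_congr rfl fun x _ => ?_
  rw [mul_assoc, ← sumL_const]
  refine sumL_congr fun u _ => ?_
  exact D.sumL_isWalk hD fl L _ x (List.take_left' List.length_ofFn)

theorem verify_cons (f g : Bool) (y : List Bool) :
    verify k (encode D, f :: g :: y) = ((f || g) && walk (D.params f) y) := by
  simp [verify, params, parse_encode, data]

/-- The conditional probability that the verifier is in the main branch. -/
theorem condProb_eq (hD : D.IsStoquastic) (L : ℕ) :
    let m := (2 + (encode D).length + L * ((encode D).length + (encode D).length))
    let N := fun fl => ∑ x, ((D.weights fl ^ L).mulVec 1) x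
    (0 < 2 * N true + N false → 0 < prob m fun y => verify k (encode D, y)) ∧
    condProb m (fun y => branchBit (encode D, y)) (fun y => verify k (encode D, y)) =
      2 * N true / (2 * N true + N false) := by
  intro m N
  set s := (encode D).length with hs
  set Z : ℝ := 2 ^ (s - D.n) * (2 ^ (s - D.n) * denom D.data) ^ L with hZ
  have hden : 0 < denom D.data := (D.weight_den_pos true (fun _ => false) (fun _ => false)).1
  have hZpos : 0 < Z := by positivity
  have hm : m = 1 + (1 + (s + L * (s + s))) := by simp only [m]; ring
  have hw : ∀ fl, sumL (s + L * (s + s)) (fun v => if walk (D.params fl) v = true then 1 else 0) =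
      Z * N fl := fun fl => D.sumL_walk hD fl L
  have h1 : sumL m (fun y => if verify k (encode D, y) = true then 1 else 0) =
      Z * (2 * N true + N false) := by
    rw [hm]
    simp only [sumL_succ, verify_cons, Bool.true_or, Bool.or_true, Bool.true_and,
      Bool.or_self, Bool.false_and, hw]
    rw [sumL_const]
    simp
    ring
  have h2 : sumL m (fun y => if (branchBit (encode D, y) && verify k (encode D, y)) = true
      then 1 else 0) = Z * (2 * N true) := by
    rw [hm]
    simp only [sumL_succ, verify_cons, Bool.true_or, Bool.true_and,
      Bool.or_self, Bool.false_and, hw, branchBit, List.headD_cons]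
    rw [sumL_const]
    simp
    ring
  have hpow : (2 : ℝ) ^ m ≠ 0 := by positivity
  refine ⟨fun h => ?_, ?_⟩
  · rw [prob_eq_sumL, h1]
    positivity
  · rw [condProb, prob_eq_sumL, prob_eq_sumL, h1, h2, div_div_div_cancel_right₀ hpow,
      mul_div_mul_left _ _ hZpos.ne']

end LocalHamiltonian

end StoquasticLH

namespace StoquasticLH

/-! ### Spectral bounds -/

/-- A matrix has a row whose sum of absolute values is at least the modulus of an eigenvalue. -/
theorem exists_norm_le_sum_norm {V : Type*} [Fintype V] {M : Matrix V V ℂ} {v : V → ℂ} {μ : ℂ}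
    (hv : v ≠ 0) (h : M.mulVec v = μ • v) : ∃ x, ‖μ‖ ≤ ∑ y, ‖M x y‖ := by
  obtain ⟨y₀, hy₀⟩ := Function.ne_iff.1 hv
  obtain ⟨x, -, hx⟩ := Finset.exists_max_image Finset.univ (fun y => ‖v y‖) ⟨y₀, Finset.mem_univ _⟩
  have hpos : 0 < ‖v x‖ := (norm_pos_iff.2 hy₀).trans_le (hx y₀ (Finset.mem_univ _))
  refine ⟨x, le_of_mul_le_mul_right ?_ hpos⟩
  calc ‖μ‖ * ‖v x‖ = ‖M.mulVec v x‖ := by rw [h, Pi.smul_apply, smul_eq_mul, norm_mul]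
    _ ≤ ∑ y, ‖M x y * v y‖ := norm_sum_le _ _
    _ ≤ ∑ y, ‖M x y‖ * ‖v x‖ := Finset.sum_le_sum fun y _ => by
        rw [norm_mul]
        exact mul_le_mul_of_nonneg_left (hx y (Finset.mem_univ _)) (norm_nonneg _)
    _ = _ := (Finset.sum_mul _ _ _).symm

theorem pow_mulVec_eq {V : Type*} [Fintype V] [DecidableEq V] {M : Matrix V V ℂ} {v : V → ℂ}
    {μ : ℂ} (h : M.mulVec v = μ • v) (L : ℕ) : (M ^ L).mulVec v = μ ^ L • v := by
  induction L with
  | zero => simp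
  | succ L ih => rw [pow_succ, ← Matrix.mulVec_mulVec, h, Matrix.mulVec_smul, ih, smul_smul,
      pow_succ, mul_comm]

theorem pow_apply_nonneg {V : Type*} [Fintype V] [DecidableEq V] {M : Matrix V V ℝ}
    (h : ∀ x y, 0 ≤ M x y) (L : ℕ) (x y : V) : 0 ≤ (M ^ L) x y := by
  induction L generalizing y with
  | zero => rw [pow_zero, Matrix.one_apply]; split_ifs <;> simp
  | succ L ih =>
    rw [pow_succ, Matrix.mul_apply]
    exact Finset.sum_nonneg fun z _ => mul_nonneg (ih z) (h z y)

/-- If all eigenvalues of `M` in an orthonormal eigenbasis have modulus at most `r`, then the sum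
of all entries of `M ^ L` is at most `|V| r ^ L`. -/
theorem norm_sum_pow_mulVec_le {V : Type*} [Fintype V] [DecidableEq V] {M : Matrix V V ℂ}
    (hM : M.IsHermitian) (b : OrthonormalBasis V ℂ (EuclideanSpace ℂ V)) {μ : V → ℂ} {r : ℝ}
    (hb : ∀ i, M.mulVec (b i).ofLp = μ i • (b i).ofLp) (hμ : ∀ i, ‖μ i‖ ≤ r) (L : ℕ) :
    ‖∑ x, ((M ^ L).mulVec 1) x‖ ≤ Fintype.card V * r ^ L := by
  set e : EuclideanSpace ℂ V := WithLp.toLp 2 1 with he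
  have h1 : ∑ x, ((M ^ L).mulVec 1) x = inner ℂ e (WithLp.toLp 2 ((M ^ L).mulVec 1)) := by
    rw [EuclideanSpace.inner_eq_star_dotProduct]
    simp [he, dotProduct]
  have h2 : ∀ i, inner ℂ (b i) (WithLp.toLp 2 ((M ^ L).mulVec 1)) =
      star (μ i) ^ L * inner ℂ (b i) e := by
    intro i
    rw [EuclideanSpace.inner_eq_star_dotProduct, EuclideanSpace.inner_eq_star_dotProduct]
    simp only [he]
    rw [dotProduct_comm, Matrix.dotProduct_mulVec]
    have h3 := congrArg star (pow_mulVec_eq (hb i) L)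
    rw [Matrix.star_mulVec, (hM.pow L).eq] at h3
    rw [h3, star_smul, smul_dotProduct, dotProduct_comm, star_pow, smul_eq_mul]
  have h3 : ∑ i, ‖inner ℂ (b i) e‖ ^ 2 = Fintype.card V := by
    rw [b.sum_sq_norm_inner_right, EuclideanSpace.norm_sq_eq]
    simp [he]
  rw [h1, ← b.sum_inner_mul_inner, ← h3, Finset.sum_mul]
  refine (norm_sum_le _ _).trans (Finset.sum_le_sum fun i _ => ?_)
  rw [h2, norm_mul, norm_mul, norm_inner_symm e, norm_pow, norm_star]
  have := pow_le_pow_left₀ (norm_nonneg _) (hμ i) L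
  nlinarith [mul_le_mul_of_nonneg_right this (sq_nonneg ‖inner ℂ (b i) e‖)]

namespace LocalHamiltonian

variable {k : ℕ} (D : LocalHamiltonian k)

theorem ofReal_matrix_re (hD : D.IsStoquastic) (x y : Fin D.n → Bool) :
    ((D.matrix x y).re : ℂ) = D.matrix x y := by
  by_cases h : x = y
  · subst h
    exact D.isHermitian.coe_re_apply_self x
  · apply Complex.ext
    · simp
    · simp [(hD x y h).1]

theorem map_weights (hD : D.IsStoquastic) :
    (D.weights true).map (Complex.ofRealHom) = (D.shift : ℂ) • 1 - D.matrix := by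
  ext x y
  simp only [weights, Matrix.map_apply, Matrix.of_apply, Matrix.sub_apply, Matrix.smul_apply,
    Matrix.one_apply, map_sub, Complex.ofRealHom_eq_coe, D.ofReal_matrix_re hD]
  split_ifs <;> simp

theorem map_weights_mulVec (hD : D.IsStoquastic) (i : Fin D.n → Bool) :
    ((D.weights true).map (Complex.ofRealHom)).mulVec (D.isHermitian.eigenvectorBasis i).ofLp =
      ((D.shift - D.eigenvalue i : ℝ) : ℂ) • (D.isHermitian.eigenvectorBasis i).ofLp := by
  rw [D.map_weights hD, Matrix.sub_mulVec, D.isHermitian.mulVec_eigenvectorBasis,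
    Matrix.smul_mulVec, Matrix.one_mulVec]
  ext x
  simp [eigenvalue, sub_mul]

theorem eigenvectorBasis_ne_zero (i : Fin D.n → Bool) :
    (D.isHermitian.eigenvectorBasis i).ofLp ≠ 0 := fun h =>
  D.isHermitian.eigenvectorBasis.orthonormal.ne_zero i (by ext x; exact congrFun h x)

theorem abs_eigenvalue_le (hD : D.IsStoquastic) (i : Fin D.n → Bool) :
    |D.eigenvalue i| ≤ D.shift - 1 := by
  have h : D.matrix.mulVec (D.isHermitian.eigenvectorBasis i).ofLp =
      (D.eigenvalue i : ℂ) • (D.isHermitian.eigenvectorBasis i).ofLp := by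
    rw [D.isHermitian.mulVec_eigenvectorBasis]
    ext x
    simp [eigenvalue]
  obtain ⟨x, hx⟩ := exists_norm_le_sum_norm (D.eigenvectorBasis_ne_zero i) h
  rw [Complex.norm_real, Real.norm_eq_abs] at hx
  refine hx.trans (le_trans (Finset.sum_le_sum fun y _ => ?_) (D.sum_abs_re_le x))
  rw [← D.ofReal_matrix_re hD, Complex.norm_real, Real.norm_eq_abs, Complex.ofReal_re]

theorem map_weights_pow (L : ℕ) (x y : Fin D.n → Bool) :
    ((D.weights true).map (Complex.ofRealHom) ^ L) x y = (((D.weights true ^ L) x y : ℝ) : ℂ) := by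
  rw [← Matrix.map_pow]
  rfl

theorem pow_mulVec_one_nonneg (hD : D.IsStoquastic) (fl : Bool) (L : ℕ) (x : Fin D.n → Bool) :
    0 ≤ ((D.weights fl ^ L).mulVec 1) x :=
  Finset.sum_nonneg fun y _ => mul_nonneg
    (pow_apply_nonneg (D.weights_nonneg hD fl) L x y) zero_le_one

theorem pow_le_sum_pow (hD : D.IsStoquastic) (h : D.groundEnergy ≤ 0) (L : ℕ) :
    D.shift ^ L ≤ ∑ x, ((D.weights true ^ L).mulVec 1) x := by
  obtain ⟨i, -, hi⟩ := Finset.exists_mem_eq_inf' (Finset.univ_nonempty (α := Fin D.n → Bool))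
    D.eigenvalue
  have hi : D.eigenvalue i ≤ 0 := hi ▸ h
  obtain ⟨x, hx⟩ := exists_norm_le_sum_norm (D.eigenvectorBasis_ne_zero i)
    (pow_mulVec_eq (D.map_weights_mulVec hD i) L)
  have hs := D.shift_pos
  rw [← Complex.ofReal_pow, Complex.norm_real, Real.norm_eq_abs] at hx
  calc D.shift ^ L ≤ (D.shift - D.eigenvalue i) ^ L :=
        pow_le_pow_left₀ hs.le (by linarith) L
    _ ≤ _ := le_abs_self _
    _ ≤ _ := hx
    _ = ((D.weights true ^ L).mulVec 1) x := by
        simp only [Matrix.mulVec, dotProduct, Pi.one_apply, mul_one]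
        refine Finset.sum_congr rfl fun y _ => ?_
        rw [D.map_weights_pow, Complex.norm_real, Real.norm_eq_abs,
          abs_of_nonneg (pow_apply_nonneg (D.weights_nonneg hD true) L x y)]
    _ ≤ _ := Finset.single_le_sum (fun y _ => D.pow_mulVec_one_nonneg hD true L y)
        (Finset.mem_univ x)

theorem sum_pow_le (hD : D.IsStoquastic) {g : ℝ} (h : g ≤ D.groundEnergy) (L : ℕ) :
    ∑ x, ((D.weights true ^ L).mulVec 1) x ≤ 2 ^ D.n * (D.shift - g) ^ L := by
  have hμ : ∀ i, ‖((D.shift - D.eigenvalue i : ℝ) : ℂ)‖ ≤ D.shift - g := by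
    intro i
    have h1 := abs_le.1 (D.abs_eigenvalue_le hD i)
    have h2 : D.groundEnergy ≤ D.eigenvalue i := Finset.inf'_le _ (Finset.mem_univ i)
    rw [Complex.norm_real, Real.norm_eq_abs, abs_of_nonneg (by linarith)]
    linarith
  have hM : ((D.weights true).map (Complex.ofRealHom)).IsHermitian := by
    rw [D.map_weights hD]
    refine Matrix.IsHermitian.sub ?_ D.isHermitian
    ext x y
    by_cases hxy : x = y <;> simp [hxy, eq_comm]
  have h1 := norm_sum_pow_mulVec_le hM D.isHermitian.eigenvectorBasis
    (D.map_weights_mulVec hD) hμ L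
  have h2 : ∑ x, (((D.weights true).map (Complex.ofRealHom) ^ L).mulVec 1) x =
      ((∑ x, ((D.weights true ^ L).mulVec 1) x : ℝ) : ℂ) := by
    simp [Matrix.mulVec, dotProduct, D.map_weights_pow]
  rw [h2, Complex.norm_real, Real.norm_eq_abs] at h1
  refine (le_abs_self _).trans (h1.trans_eq ?_)
  simp

/-- In the reference branch exactly one walk contributes. -/
theorem sum_pow_false (L : ℕ) :
    ∑ x, ((D.weights false ^ (L + 1)).mulVec 1) x = D.shift ^ (L + 1) := by
  have h : ∀ L, (D.weights false ^ (L + 1)).mulVec 1 =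
      Pi.single (fun _ => false) (D.shift ^ (L + 1)) := by
    intro L
    induction L with
    | zero =>
      ext x
      by_cases hx : x = fun _ => false
      · simp [weights, Matrix.mulVec, dotProduct, hx]
      · simp [weights, Matrix.mulVec, dotProduct, hx]
    | succ L ih =>
      rw [pow_succ', ← Matrix.mulVec_mulVec, ih]
      ext x
      by_cases hx : x = fun _ => false
      · simp [weights, hx, pow_succ']
      · simp [weights, hx]
  rw [h]
  simp

end LocalHamiltonian

/-! ### The theorem -/

theorem exists_natPolynomial (q : Polynomial ℝ) :
    ∃ P : Polynomial ℕ, ∀ n : ℕ, |q.eval (n : ℝ)| ≤ P.eval n := by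
  induction q using Polynomial.induction_on' with
  | add p q hp hq =>
    obtain ⟨P, hP⟩ := hp
    obtain ⟨Q, hQ⟩ := hq
    refine ⟨P + Q, fun n => ?_⟩
    rw [Polynomial.eval_add, Polynomial.eval_add, Nat.cast_add]
    exact (abs_add_le _ _).trans (add_le_add (hP n) (hQ n))
  | monomial m a =>
    refine ⟨Polynomial.monomial m ⌈|a|⌉₊, fun n => ?_⟩
    rw [Polynomial.eval_monomial, Polynomial.eval_monomial, abs_mul, abs_pow, Nat.abs_cast]
    push_cast
    gcongr
    exact Nat.le_ceil _

theorem LocalTerm.abs_re_le {k n : ℕ} (t : LocalTerm k n) (a b : Fin k → Bool) :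
    |(t.re a b : ℝ)| ≤ t.opNorm := by
  have h1 : |(t.re a b : ℝ)| ≤ ‖t.mat a b‖ := Complex.abs_re_le_norm (t.mat a b)
  refine h1.trans ?_
  have h2 := (Matrix.toEuclideanCLM (n := Fin k → Bool) (𝕜 := ℂ) t.mat).le_opNorm
    (EuclideanSpace.single b 1)
  rw [PiLp.norm_single, norm_one, mul_one] at h2
  refine le_trans (le_of_eq ?_) ((PiLp.norm_apply_le _ a).trans h2)
  rw [Matrix.ofLp_toEuclideanCLM]
  congr 1
  exact (congrFun (Matrix.mulVec_single_one t.mat b) a).symm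

namespace LocalHamiltonian

variable {k : ℕ} (D : LocalHamiltonian k)

theorem length_terms_le : D.terms.length ≤ (encode D).length := by
  have : ∀ l : List (LocalTerm k D.n), l.length ≤ (encList encTerm l).length := by
    intro l
    induction l with
    | nil => simp
    | cons t l ih => simp [encList] at *; omega
  have := this D.terms
  simp only [encode, List.length_append]
  omega

theorem shift_le {r : ℝ} (h : ∀ t ∈ D.terms, t.opNorm ≤ r) (hr : 0 ≤ r) :
    D.shift ≤ 1 + (encode D).length * (4 ^ k * r) := by
  have h1 : ∀ t ∈ D.terms, t.absSum ≤ 4 ^ k * r := by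
    intro t ht
    have : t.absSum ≤ ∑ _a : Fin k → Bool, ∑ _b : Fin k → Bool, r :=
      Finset.sum_le_sum fun a _ => Finset.sum_le_sum fun b _ => (t.abs_re_le a b).trans (h t ht)
    refine this.trans_eq ?_
    simp only [Finset.sum_const, Finset.card_univ, Fintype.card_pi, Fintype.card_bool,
      Finset.prod_const, Fintype.card_fin, nsmul_eq_mul]
    rw [← mul_assoc, show (4 : ℝ) = 2 * 2 by norm_num, mul_pow]
    norm_num
  have h2 := List.sum_le_card_nsmul (D.terms.map LocalTerm.absSum) (4 ^ k * r) (by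
    intro x hx
    obtain ⟨t, ht, rfl⟩ := List.mem_map.1 hx
    exact h1 t ht)
  rw [List.length_map, nsmul_eq_mul] at h2
  have h3 : (D.terms.length : ℝ) ≤ (encode D).length := by exact_mod_cast D.length_terms_le
  unfold shift
  have h4 : (D.terms.length : ℝ) * (4 ^ k * r) ≤ (encode D).length * (4 ^ k * r) :=
    mul_le_mul_of_nonneg_right h3 (by positivity)
  linarith

end LocalHamiltonian

/-- `2 ^ n (c - 1 / q) ^ L` is much smaller than `c ^ L` when `L` is large. -/
theorem two_pow_mul_pow_le {n L : ℕ} {c q : ℝ} (hc : 0 < c) (hq : 0 < q) (h : 0 ≤ c - 1 / q)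
    (hL : (n + 2) * (c * q) ≤ L) : 4 * (2 ^ n * (c - 1 / q) ^ L) ≤ c ^ L := by
  have h1 : c - 1 / q ≤ c * Real.exp (-(1 / (c * q))) := by
    have := mul_le_mul_of_nonneg_left (Real.one_sub_le_exp_neg (1 / (c * q))) hc.le
    refine le_trans (le_of_eq ?_) this
    field_simp
  have h2 : (c - 1 / q) ^ L ≤ c ^ L * Real.exp (-(1 / (c * q))) ^ L := by
    rw [← mul_pow]
    exact pow_le_pow_left₀ h h1 L
  have h3 : Real.exp (-(1 / (c * q))) ^ L ≤ Real.exp (-1) ^ (n + 2) := by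
    rw [← Real.exp_nat_mul, ← Real.exp_nat_mul, Real.exp_le_exp]
    have : ((n : ℝ) + 2) ≤ L * (1 / (c * q)) := by
      rw [mul_one_div, le_div_iff₀ (by positivity)]
      exact hL
    push_cast
    linarith
  have h4 : Real.exp (-1) ≤ 1 / 2 := by
    rw [Real.exp_neg, ← one_div]
    exact one_div_le_one_div_of_le two_pos (by linarith [Real.add_one_le_exp (1 : ℝ)])
  have h5 : Real.exp (-1) ^ (n + 2) ≤ (1 / 2) ^ (n + 2) :=
    pow_le_pow_left₀ (Real.exp_pos _).le h4 _
  calc 4 * (2 ^ n * (c - 1 / q) ^ L) = 2 ^ (n + 2) * (c - 1 / q) ^ L := by ring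
    _ ≤ 2 ^ (n + 2) * (c ^ L * (1 / 2) ^ (n + 2)) := by
        gcongr
        exact h2.trans (mul_le_mul_of_nonneg_left (h3.trans h5) (by positivity))
    _ = c ^ L * (2 * (1 / 2)) ^ (n + 2) := by rw [mul_pow]; ring
    _ = c ^ L := by norm_num

end StoquasticLH

open StoquasticLH in
theorem mainTheorem3 (k : ℕ) (p₁ p₂ p₃ : Polynomial ℝ)
    (hp₂ : ∀ n : ℕ, k ≤ n → 0 < p₂.eval (n : ℝ))
    (hp₃ : ∀ n : ℕ, k ≤ n → 0 < p₃.eval (n : ℝ)) :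
    StoquasticLH.stoquasticLHMin k p₁ p₂ p₃ ∈ StoquasticLH.PostBPP := by
  obtain ⟨P₁, hP₁⟩ := exists_natPolynomial p₁
  obtain ⟨P₂, hP₂⟩ := exists_natPolynomial p₂
  set Q : Polynomial ℕ := (Polynomial.X + 2) * ((1 + Polynomial.X * (4 ^ k * P₁)) * P₂) with hQ
  have hQe : ∀ l : ℕ, Q.eval l = (l + 2) * ((1 + l * (4 ^ k * P₁.eval l)) * P₂.eval l) := by
    intro l
    simp [hQ]
  have hpe : ∀ l : ℕ, (2 + Polynomial.X + (Q + 1) * (Polynomial.X + Polynomial.X)).eval l =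
      2 + l + (Q.eval l + 1) * (l + l) := by
    intro l
    simp
  have hyes : ∀ D : LocalHamiltonian k, D.IsStoquastic → D.groundEnergy ≤ 0 → ∀ L : ℕ,
      2 / 3 ≤ 2 * (∑ x, ((D.weights true ^ (L + 1)).mulVec 1) x) /
        (2 * (∑ x, ((D.weights true ^ (L + 1)).mulVec 1) x) +
          ∑ x, ((D.weights false ^ (L + 1)).mulVec 1) x) := by
    intro D hD h L
    have h1 := D.pow_le_sum_pow hD h (L + 1)
    have h2 : 0 < D.shift ^ (L + 1) := pow_pos D.shift_pos _
    rw [D.sum_pow_false, le_div_iff₀ (by linarith)]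
    linarith
  have hno : ∀ D ∈ Omega k p₁ p₂, D.IsStoquastic → ¬ D.groundEnergy ≤ 0 →
      2 * (∑ x, ((D.weights true ^ (Q.eval (encode D).length + 1)).mulVec 1) x) /
        (2 * (∑ x, ((D.weights true ^ (Q.eval (encode D).length + 1)).mulVec 1) x) +
          ∑ x, ((D.weights false ^ (Q.eval (encode D).length + 1)).mulVec 1) x) ≤ 1 / 3 := by
    rintro D ⟨hk, hnorm, hgap⟩ hD h
    have hg := hgap.resolve_left h
    have hq := hp₂ D.n hk
    have hn : D.n ≤ (encode D).length := D.n_lt_length_encode.le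
    have hs := D.shift_pos
    have hbound : ∀ P : Polynomial ℕ, ((P.eval D.n : ℕ) : ℝ) ≤ (P.eval (encode D).length : ℕ) := fun P => by
      exact_mod_cast eval_mono P hn
    have hc := D.shift_le (fun t ht => ((hnorm t ht).trans (le_abs_self _)).trans
      ((hP₁ D.n).trans (hbound P₁))) (Nat.cast_nonneg _)
    have hq' : p₂.eval (D.n : ℝ) ≤ P₂.eval (encode D).length :=
      (le_abs_self _).trans ((hP₂ D.n).trans (hbound P₂))
    have hpos : 0 ≤ D.shift - 1 / p₂.eval (D.n : ℝ) := by
      have h1 := abs_le.1 (D.abs_eigenvalue_le hD fun _ => false)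
      have h2 : D.groundEnergy ≤ D.eigenvalue fun _ => false :=
        Finset.inf'_le _ (Finset.mem_univ _)
      linarith
    have hL : ((D.n : ℝ) + 2) * (D.shift * p₂.eval (D.n : ℝ)) ≤
        ((Q.eval (encode D).length + 1 : ℕ) : ℝ) := by
      have hn' : (D.n : ℝ) ≤ (encode D).length := by exact_mod_cast hn
      rw [hQe]
      push_cast
      refine le_trans ?_ (le_add_of_nonneg_right zero_le_one)
      gcongr
    have h1 := D.sum_pow_le hD hg (Q.eval (encode D).length + 1)
    have h2 := two_pow_mul_pow_le hs hq hpos hL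
    have h3 : 0 < D.shift ^ (Q.eval (encode D).length + 1) := pow_pos hs _
    have h4 : 0 ≤ ∑ x, ((D.weights true ^ (Q.eval (encode D).length + 1)).mulVec 1) x :=
      Finset.sum_nonneg fun x _ => D.pow_mulVec_one_nonneg hD true _ x
    rw [D.sum_pow_false, div_le_iff₀ (by linarith)]
    linarith
  refine ⟨2 + Polynomial.X + (Q + 1) * (Polynomial.X + Polynomial.X), branchBit, verify k,
    inP_branchBit, inP_verify k, ?_, ?_, ?_⟩
  · have key : ∀ D : LocalHamiltonian k, D.IsStoquastic →
        0 < prob (2 + (encode D).length + (Q.eval (encode D).length + 1) *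
          ((encode D).length + (encode D).length)) (fun y => verify k (encode D, y)) := by
      intro D hD
      refine (D.condProb_eq hD _).1 ?_
      have h1 : 0 < D.shift ^ (Q.eval (encode D).length + 1) := pow_pos D.shift_pos _
      have h2 := Finset.sum_nonneg fun x (_ : x ∈ Finset.univ) =>
        D.pow_mulVec_one_nonneg hD true (Q.eval (encode D).length + 1) x
      simp only [D.sum_pow_false]
      linarith
    rintro x (⟨D, -, hD, -, rfl, -⟩ | ⟨D, -, hD, -, rfl, -⟩) <;> rw [hpe] <;> exact key D hD
  · rintro x ⟨D, -, hD, -, rfl, h⟩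
    rw [hpe, (D.condProb_eq hD _).2]
    exact hyes D hD h _
  · rintro x ⟨D, hΩ, hD, -, rfl, h⟩
    rw [hpe, (D.condProb_eq hD _).2]
    exact hno D hΩ hD h
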